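/- **Setting.** Let $G$ be a finite group, and let $A,B\subseteq G$ be sets of generators that are closed under inverses, with $|A|=|B|=\Delta\ge 1$; identify both $A$ and $B$ with $\{1,\dots,\Delta\}$. The 4-fold left-right Cayley complex $\mathcal G_2=\mathcal G_2(G,A,B)$ has the vertex set $V=V_{00}\sqcup V_{10}\sqcup V_{01}\sqcup V_{11}$ (four copies of $G$), the vertical edges $E^|$, namely $(g,ag)$ from $V_{0q}$ to $V_{1q}$, the horizontal edges $E^-$, namely $(g,gb)$ from $V_{p0}$ to $V_{p1}$ ($p,q\in\{0,1\}$), and the faces $F=\{(g,ag,gb,agb)\}$ with vertices in $V_{00},V_{10},V_{01},V_{11}$ respectively ($g\in G$, $a\in A$, $b\in B$). Put $E=E^-\cup E^|$, and let $E(v)$ be the set of edges incident to $v\in V$. Let $H_A:\mathbb F_2^\Delta\to\mathbb F_2^{m_a}$ and $H_B:\mathbb F_2^\Delta\to\mathbb F_2^{m_b}$ be surjective, $m_a+m_b\ge1$, $C_A=\ker H_A$, $C_B=\ker H_B$. The complex $$X(\mathcal G_2,C_A,C_B):\quad \mathbb F_2^F\xrightarrow{\partial_2}(\mathbb F_2^{m_a})^{E^-}\oplus(\mathbb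 F_2^{m_b})^{E^|}\xrightarrow{\partial_1}(\mathbb F_2^{m_a\times m_b})^V$$ is given by Tanner maps: $\partial_2$ reads, at each horizontal (vertical) edge, the $\Delta$ values on the incident faces, indexed by $A$ (by $B$), and applies $H_A$ (resp. $H_B$); $\partial_1$ is the sum of the Tanner map that reads the values of the $\Delta$ horizontal edges at each vertex, indexed by $B$, and applies $\mathrm{id}\otimes H_B$, and the one that reads the values of the $\Delta$ vertical edges, indexed by $A$, and applies $H_A\otimes\mathrm{id}$. Let $\delta^1=\partial_2^T$, $\delta^0=\partial_1^T$, $B^1=\operatorname{im}\delta^0$, and let $X(1)$ be the basis of the middle term, so $|X(1)|=2\Delta(m_a+m_b)|G|$. For $c^1$ in the middle term let $\|c^1\|_E$ be the number of edges $e$ with $c^1(e)\ne0$; let $|\cdot|$ be the Hamming weight on $\mathbb F_2^F$. **Small-set-flip decoder.** Input: $s\in\mathbb F_2^F$. As long as there are a vertex $v$ and a chain $e^1$ in the middle term supported on $E(v)$ with $|s+\delta^1e^1|<|s|$, choose any such $e^1$ and replace $s$ by $s+\delta^1e^1$. When there is none, stop and output the sum $\tilde c^1$ of the chosen $e^1$'s.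 **Theorem (Co-Decoder).** For all $\Delta\geq 1$ and $m_a,m_b$ with $m_a+m_b\ge1$ there is a constant $C$ such that for all $H_A,H_B$ as above there is a single program $P$ for a word RAM (unit-cost assignment, addition, truncated subtraction, multiplication, indirect array access and comparison tests) such that for all $G,A,B$ as above the following holds. 1. For any numbering of the elements of $G$ by $0,\dots,|G|-1$, given as input $|G|$, the tables of the maps $(g,a)\mapsto ag$ and $(g,b)\mapsto gb$, and an arbitrary $s\in\mathbb F_2^F$, the program $P$ halts after at most $C\,|X(1)|$ steps, writing only numbers that are at most $C\,|X(1)|$, and its output is the output of a run of the small-set-flip decoder on $s$. 2. Suppose that $d_1\in\mathbb R$, $d_2>0$, $\lambda\ge0$ are such that * $\mathrm{Cay}(G,A)$ and $\mathrm{Cay}(G,B)$ are $\lambda$-spectral expanders, i.e. all eigenvalues of the adjacency matrix, listed in decreasing order with multiplicity, except the first one, have absolute value at most $\lambda$; * $C_A^\perp$ and $C_B^\perp$ have distance at least $d_1$; * $(C_A^\perp,C_B^\perp)$ is $d_2$-robust: every matrix $c\in C_A^\perp\otimes\mathbb F_2^\Delta+\mathbb F_2^\Delta\otimes C_B^\perp$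 can be written as $c=c_a+c_b$, with the columns of $c_a$ in $C_A^\perp$ and the rows of $c_b$ in $C_B^\perp$, such that $|c|\ge d_2\,(\#\{\text{nonzero columns of }c_a\}+\#\{\text{nonzero rows of }c_b\})$; * $d_1d_2/4-\lambda d_2/2-8\lambda\Delta>0$. Let $$\eta=\frac{d_1d_2-\lambda d_2-8\lambda\Delta}{\Delta d_2/2+2\Delta},\qquad \eta'=\frac{d_1d_2/4-\lambda d_2/2-8\lambda\Delta}{\Delta d_2/4+2\Delta},\qquad \kappa=\frac{\Delta d_2/2+2\Delta}{8\Delta d_2+16\Delta^2}\,\eta'\eta .$$ Then for every $c^1\in(\mathbb F_2^{m_a})^{E^-}\oplus(\mathbb F_2^{m_b})^{E^|}$ with $$\|c^1\|_E\le\frac{\kappa}{2\Delta(m_a+m_b)}\,|X(1)|,$$ every run of the small-set-flip decoder on the syndrome $\delta^1c^1$ outputs some $\tilde c^1\in c^1+B^1$. In particular, $P$ is a linear-time co-decoder: on input $\delta^1c^1$ it outputs some $\tilde c^1\in c^1+B^1$ after at most $C\,|X(1)|$ steps. -/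

import Mathlib

namespace CoDec

open Matrix

/-! ### Local codes -/

/-- The linear code with parity-check matrix `H`. -/
def code {m n : ℕ} (H : Matrix (Fin m) (Fin n) (ZMod 2)) :
    Submodule (ZMod 2) (Fin n → ZMod 2) :=
  LinearMap.ker H.mulVecLin

/-- The dual code `C^⊥`. -/
def dual {n : ℕ} (C : Submodule (ZMod 2) (Fin n → ZMod 2)) :
    Submodule (ZMod 2) (Fin n → ZMod 2) where
  carrier := {x | ∀ y ∈ C, x ⬝ᵥ y = 0}
  zero_mem' := fun y _ => zero_dotProduct y
  add_mem' := fun {x x'} hx hx' y hy => by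
    rw [add_dotProduct, hx y hy, hx' y hy, add_zero]
  smul_mem' := fun r x hx y hy => by
    rw [smul_dotProduct, hx y hy, smul_zero]

/-- Every nonzero codeword of `C` has Hamming weight at least `d`. -/
def HasDistance {n : ℕ} (C : Submodule (ZMod 2) (Fin n → ZMod 2)) (d : ℝ) : Prop :=
  ∀ x ∈ C, x ≠ 0 → d ≤ (hammingNorm x : ℝ)

/-- Number of nonzero entries of a matrix. -/
def entryWeight {n : ℕ} (c : Matrix (Fin n) (Fin n) (ZMod 2)) : ℕ :=
  (Finset.univ.filter fun p : Fin n × Fin n => c p.1 p.2 ≠ 0).card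

/-- Number of nonzero columns of a matrix. -/
def colWeight {n : ℕ} (c : Matrix (Fin n) (Fin n) (ZMod 2)) : ℕ :=
  (Finset.univ.filter fun j : Fin n => ∃ i : Fin n, c i j ≠ 0).card

/-- Number of nonzero rows of a matrix. -/
def rowWeight {n : ℕ} (c : Matrix (Fin n) (Fin n) (ZMod 2)) : ℕ :=
  colWeight cᵀ

/-- Matrices all of whose columns lie in `C`, i.e. `C ⊗ 𝔽₂ⁿ`. -/
def ColsIn {n : ℕ} (C : Submodule (ZMod 2) (Fin n → ZMod 2))
    (c : Matrix (Fin n) (Fin n) (ZMod 2)) : Prop :=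
  ∀ j, (fun i => c i j) ∈ C

/-- Matrices all of whose rows lie in `C`, i.e. `𝔽₂ⁿ ⊗ C`. -/
def RowsIn {n : ℕ} (C : Submodule (ZMod 2) (Fin n → ZMod 2))
    (c : Matrix (Fin n) (Fin n) (ZMod 2)) : Prop :=
  ∀ i, (fun j => c i j) ∈ C

/-- `(C, C')` is `d`-robust: each `c ∈ C ⊗ 𝔽₂ⁿ + 𝔽₂ⁿ ⊗ C'` can be written as `ca + cb` with
`|c| ≥ d (number of nonzero columns of ca + number of nonzero rows of cb)`. -/
def IsRobust {n : ℕ} (C C' : Submodule (ZMod 2) (Fin n → ZMod 2)) (d : ℝ) : Prop :=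
  ∀ c : Matrix (Fin n) (Fin n) (ZMod 2),
    (∃ xa xb, ColsIn C xa ∧ RowsIn C' xb ∧ c = xa + xb) →
    ∃ ca cb, ColsIn C ca ∧ RowsIn C' cb ∧ c = ca + cb ∧
      d * ((colWeight ca : ℝ) + (rowWeight cb : ℝ)) ≤ (entryWeight c : ℝ)

/-! ### Cayley graphs and spectral expansion -/

/-- `a` lists, without repetition, the elements of a set of generators of `G` that is closed
under inverses. -/
def IsSymmGenSet {G : Type*} [Group G] {n : ℕ} (a : Fin n → G) : Prop :=
  Function.Injective a ∧ (∀ i, ∃ j, a j = (a i)⁻¹) ∧ Subgroup.closure (Set.range a) = ⊤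

/-- Adjacency matrix of the Cayley graph `Cay(G, A)`, `A = {a i}`: the edges are `{g, a i * g}`. -/
def cayleyAdj {G : Type*} [Group G] [DecidableEq G] {n : ℕ} (a : Fin n → G) :
    Matrix G G ℝ :=
  fun g h => if ∃ i, h = a i * g then 1 else 0

/-- All eigenvalues of the symmetric matrix `M`, listed with multiplicity in decreasing order,
except the first one, have absolute value at most `lam`. -/
def IsSpectralExpander {V : Type*} [Fintype V] [DecidableEq V] (M : Matrix V V ℝ) (lam : ℝ) :
    Prop :=
  ∃ hM : M.IsHermitian, ∀ k : Fin (Fintype.card V), k.val ≠ 0 → |hM.eigenvalues₀ k| ≤ lam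

/-! ### The 4-fold left-right Cayley complex

Booleans stand for the bits in `V_{pq}`, `E_{p*}`, `E_{*q}` (`false` is `0`, `true` is `1`). -/

/-- `(p, q, g)` is the vertex `g` of `V_{pq}`. -/
abbrev Vert (G : Type*) := Bool × Bool × G

/-- `(p, g, j)` is the horizontal edge of `E_{p*}` from `g ∈ V_{p0}` to `g * b j ∈ V_{p1}`. -/
abbrev HEdge (G : Type*) (n : ℕ) := Bool × G × Fin n

/-- `(q, g, i)` is the vertical edge of `E_{*q}` from `g ∈ V_{0q}` to `a i * g ∈ V_{1q}`. -/
abbrev VEdge (G : Type*) (n : ℕ) := Bool × G × Fin n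

/-- `(g, i, j)` is the face `(g, a i * g, g * b j, a i * g * b j)`. -/
abbrev Face (G : Type*) (n : ℕ) := G × Fin n × Fin n

/-- The face at the horizontal edge `e` in direction `a i`. -/
def faceH {G : Type*} [Group G] {n : ℕ} (a : Fin n → G) (e : HEdge G n) (i : Fin n) : Face G n :=
  (if e.1 then (a i)⁻¹ * e.2.1 else e.2.1, i, e.2.2)

/-- The face at the vertical edge `e` in direction `b j`. -/
def faceV {G : Type*} [Group G] {n : ℕ} (b : Fin n → G) (e : VEdge G n) (j : Fin n) : Face G n :=
  (if e.1 then e.2.1 * (b j)⁻¹ else e.2.1, e.2.2, j)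

/-- The horizontal edge at the vertex `v` in direction `b j`. -/
def edgeH {G : Type*} [Group G] {n : ℕ} (b : Fin n → G) (v : Vert G) (j : Fin n) : HEdge G n :=
  (v.1, if v.2.1 then v.2.2 * (b j)⁻¹ else v.2.2, j)

/-- The vertical edge at the vertex `v` in direction `a i`. -/
def edgeV {G : Type*} [Group G] {n : ℕ} (a : Fin n → G) (v : Vert G) (i : Fin n) : VEdge G n :=
  (v.2.1, if v.1 then (a i)⁻¹ * v.2.2 else v.2.2, i)

/-! ### Tanner codes and the chain complex -/

/-- Tanner code: `loc v l` is the edge carrying the local index `l` at the node `v`. The matrix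
reads the `n` values around every node `v` and applies `H` to them. -/
def tanner {N E : Type*} [DecidableEq E] {m n : ℕ} (loc : N → Fin n → E)
    (H : Matrix (Fin m) (Fin n) (ZMod 2)) : Matrix (N × Fin m) E (ZMod 2) :=
  fun x e => ∑ l, if loc x.1 l = e then H x.2 l else 0

/-- The basis of `(𝔽₂^ma)^(E⁻) ⊕ (𝔽₂^mb)^(E^|)`. -/
abbrev XOne (G : Type*) (n ma mb : ℕ) := (HEdge G n × Fin ma) ⊕ (VEdge G n × Fin mb)

/-- The basis of `(𝔽₂^(ma × mb))^V`. -/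
abbrev XZero (G : Type*) (ma mb : ℕ) := Vert G × Fin ma × Fin mb

/-- The boundary map `∂₂ : 𝔽₂^F → (𝔽₂^ma)^(E⁻) ⊕ (𝔽₂^mb)^(E^|)`. -/
def bdryTwo {G : Type*} [Group G] [DecidableEq G] {n ma mb : ℕ} (a b : Fin n → G)
    (HA : Matrix (Fin ma) (Fin n) (ZMod 2)) (HB : Matrix (Fin mb) (Fin n) (ZMod 2)) :
    Matrix (XOne G n ma mb) (Face G n) (ZMod 2) :=
  fun x f => Sum.elim (fun y => tanner (faceH a) HA y f) (fun y => tanner (faceV b) HB y f) x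

/-- The boundary map `∂₁ : (𝔽₂^ma)^(E⁻) ⊕ (𝔽₂^mb)^(E^|) → (𝔽₂^(ma × mb))^V`. -/
def bdryOne {G : Type*} [Group G] [DecidableEq G] {n ma mb : ℕ} (a b : Fin n → G)
    (HA : Matrix (Fin ma) (Fin n) (ZMod 2)) (HB : Matrix (Fin mb) (Fin n) (ZMod 2)) :
    Matrix (XZero G ma mb) (XOne G n ma mb) (ZMod 2) :=
  fun w x => Sum.elim
    (fun y => if y.2 = w.2.1 then tanner (edgeH b) HB (w.1, w.2.2) y.1 else 0)
    (fun y => if y.2 = w.2.2 then tanner (edgeV a) HA (w.1, w.2.1) y.1 else 0) x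

/-- The coboundary map `δ¹`, the transpose of `∂₂`. -/
def cobdryOne {G : Type*} [Group G] [Fintype G] [DecidableEq G] {n ma mb : ℕ} (a b : Fin n → G)
    (HA : Matrix (Fin ma) (Fin n) (ZMod 2)) (HB : Matrix (Fin mb) (Fin n) (ZMod 2))
    (c : XOne G n ma mb → ZMod 2) : Face G n → ZMod 2 :=
  (bdryTwo a b HA HB)ᵀ *ᵥ c

/-- The coboundary map `δ⁰`, the transpose of `∂₁`. -/
def cobdryZero {G : Type*} [Group G] [Fintype G] [DecidableEq G] {n ma mb : ℕ} (a b : Fin n → G)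
    (HA : Matrix (Fin ma) (Fin n) (ZMod 2)) (HB : Matrix (Fin mb) (Fin n) (ZMod 2))
    (c : XZero G ma mb → ZMod 2) : XOne G n ma mb → ZMod 2 :=
  (bdryOne a b HA HB)ᵀ *ᵥ c

/-- `c' ∈ c + B¹`. -/
def SameClass {G : Type*} [Group G] [Fintype G] [DecidableEq G] {n ma mb : ℕ} (a b : Fin n → G)
    (HA : Matrix (Fin ma) (Fin n) (ZMod 2)) (HB : Matrix (Fin mb) (Fin n) (ZMod 2))
    (c c' : XOne G n ma mb → ZMod 2) : Prop :=
  ∃ z : XZero G ma mb → ZMod 2, c' = c + cobdryZero a b HA HB z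

/-- The number of edges at which `c` does not vanish. -/
def edgeWeight {G : Type*} [Fintype G] {n ma mb : ℕ} (c : XOne G n ma mb → ZMod 2) : ℕ :=
  (Finset.univ.filter fun e : HEdge G n => ∃ k, c (Sum.inl (e, k)) ≠ 0).card +
    (Finset.univ.filter fun e : VEdge G n => ∃ k, c (Sum.inr (e, k)) ≠ 0).card

/-! ### The small-set-flip decoder -/

/-- `c` is supported on the edges incident to the vertex `v`. -/
def SupportedAt {G : Type*} [Group G] {n ma mb : ℕ} (a b : Fin n → G) (v : Vert G)
    (c : XOne G n ma mb → ZMod 2) : Prop :=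
  (∀ e k, c (Sum.inl (e, k)) ≠ 0 → ∃ j, edgeH b v j = e) ∧
    (∀ e k, c (Sum.inr (e, k)) ≠ 0 → ∃ i, edgeV a v i = e)

/-- `e` is a small-set flip which lowers the weight of the syndrome `s`. -/
def IsFlip {G : Type*} [Group G] [Fintype G] [DecidableEq G] {n ma mb : ℕ} (a b : Fin n → G)
    (HA : Matrix (Fin ma) (Fin n) (ZMod 2)) (HB : Matrix (Fin mb) (Fin n) (ZMod 2))
    (s : Face G n → ZMod 2) (e : XOne G n ma mb → ZMod 2) : Prop :=
  (∃ v, SupportedAt a b v e) ∧ hammingNorm (s + cobdryOne a b HA HB e) < hammingNorm s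

/-- `FlipRun s c`: some complete run of the small-set-flip decoder on the syndrome `s`, in which
flips are performed until there are none left, outputs `c`, the sum of the flips. -/
inductive FlipRun {G : Type*} [Group G] [Fintype G] [DecidableEq G] {n ma mb : ℕ}
    (a b : Fin n → G) (HA : Matrix (Fin ma) (Fin n) (ZMod 2))
    (HB : Matrix (Fin mb) (Fin n) (ZMod 2)) :
    (Face G n → ZMod 2) → (XOne G n ma mb → ZMod 2) → Prop
  | done (s) : (∀ e, ¬ IsFlip a b HA HB s e) → FlipRun a b HA HB s 0
  | flip (s e c) : IsFlip a b HA HB s e → FlipRun a b HA HB (s + cobdryOne a b HA HB e) c →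
      FlipRun a b HA HB s (e + c)

/-! ### The constants -/

/-- `η`. -/
noncomputable def etaC (n : ℕ) (d₁ d₂ lam : ℝ) : ℝ :=
  (d₁ * d₂ - lam * d₂ - 8 * lam * n) / (n * d₂ / 2 + 2 * n)

/-- `η'`. -/
noncomputable def etaC' (n : ℕ) (d₁ d₂ lam : ℝ) : ℝ :=
  (d₁ * d₂ / 4 - lam * d₂ / 2 - 8 * lam * n) / (n * d₂ / 4 + 2 * n)

/-- `κ`. -/
noncomputable def kappaC (n : ℕ) (d₁ d₂ lam : ℝ) : ℝ :=
  (n * d₂ / 2 + 2 * n) / (8 * n * d₂ + 16 * (n : ℝ) ^ 2) *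
    etaC' n d₁ d₂ lam * etaC n d₁ d₂ lam

/-! ### Word RAM programs and their running time -/

/-- Memory: numbered registers and numbered arrays, all holding natural numbers. -/
structure Mem where
  reg : ℕ → ℕ
  arr : ℕ → ℕ → ℕ

/-- Write `v` into register `r`. -/
def Mem.setReg (s : Mem) (r v : ℕ) : Mem :=
  { s with reg := Function.update s.reg r v }

/-- Write `v` into cell `p` of array `k`. -/
def Mem.setArr (s : Mem) (k p v : ℕ) : Mem :=
  { s with arr := Function.update s.arr k (Function.update (s.arr k) p v) }

/-- Programs. Register and array numbers are fixed in the text of the program; only the position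
inside an array is computed. -/
inductive Prog
  | const (r v : ℕ)
  | add (r x y : ℕ)
  | sub (r x y : ℕ)
  | mul (r x y : ℕ)
  /-- register `r` := cell (register `x`) of array `k` -/
  | load (r k x : ℕ)
  /-- cell (register `x`) of array `k` := register `y` -/
  | store (k x y : ℕ)
  | seq (p q : Prog)
  /-- if register `x` < register `y` then `p` else `q` -/
  | branch (x y : ℕ) (p q : Prog)
  /-- while register `x` < register `y` do `p` -/
  | loop (x y : ℕ) (p : Prog)

/-- `Exec W p s t s'`: started in memory `s`, the program `p` halts after exactly `t` steps in
memory `s'`, and no number that it writes exceeds the word bound `W`. Every assignment, memory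
access and test is one step. -/
inductive Exec (W : ℕ) : Prog → Mem → ℕ → Mem → Prop
  | const (s r v) : v ≤ W → Exec W (.const r v) s 1 (s.setReg r v)
  | add (s r x y) : s.reg x + s.reg y ≤ W →
      Exec W (.add r x y) s 1 (s.setReg r (s.reg x + s.reg y))
  | sub (s r x y) : s.reg x - s.reg y ≤ W →
      Exec W (.sub r x y) s 1 (s.setReg r (s.reg x - s.reg y))
  | mul (s r x y) : s.reg x * s.reg y ≤ W →
      Exec W (.mul r x y) s 1 (s.setReg r (s.reg x * s.reg y))
  | load (s r k x) : s.arr k (s.reg x) ≤ W →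
      Exec W (.load r k x) s 1 (s.setReg r (s.arr k (s.reg x)))
  | store (s k x y) : s.reg y ≤ W →
      Exec W (.store k x y) s 1 (s.setArr k (s.reg x) (s.reg y))
  | seq (p q s s' s'' t t') : Exec W p s t s' → Exec W q s' t' s'' →
      Exec W (.seq p q) s (t + t') s''
  | branchTrue (x y p q s s' t) : s.reg x < s.reg y → Exec W p s t s' →
      Exec W (.branch x y p q) s (t + 1) s'
  | branchFalse (x y p q s s' t) : ¬ s.reg x < s.reg y → Exec W q s t s' →
      Exec W (.branch x y p q) s (t + 1) s'
  | loopDone (x y p s) : ¬ s.reg x < s.reg y → Exec W (.loop x y p) s 1 s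
  | loopStep (x y p s s' s'' t t') : s.reg x < s.reg y → Exec W p s t s' →
      Exec W (.loop x y p) s' t' s'' → Exec W (.loop x y p) s (t + t' + 1) s''

/-- The input of a co-decoder. The elements of `G` are numbered by `num`. Register `0` holds the
order of `G`; array `0` holds at position `g * n + i` the number of `a i * g`; array `1` holds at
position `g * n + j` the number of `g * b j`; array `2` holds at position `(g * n + i) * n + j`
the bit of the syndrome at the face `(g, i, j)`. Everything else is `0`. -/
def inputMem {G : Type*} [Group G] [Fintype G] {n : ℕ} (a b : Fin n → G)
    (num : G ≃ Fin (Fintype.card G)) (s : Face G n → ZMod 2) : Mem where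
  reg r := if r = 0 then Fintype.card G else 0
  arr k p :=
    if k = 0 then
      if h : p < Fintype.card G * n then
        let x := finProdFinEquiv.symm (⟨p, h⟩ : Fin (Fintype.card G * n))
        (num (a x.2 * num.symm x.1)).val
      else 0
    else if k = 1 then
      if h : p < Fintype.card G * n then
        let x := finProdFinEquiv.symm (⟨p, h⟩ : Fin (Fintype.card G * n))
        (num (num.symm x.1 * b x.2)).val
      else 0
    else if k = 2 then
      if h : p < Fintype.card G * n * n then
        let y := finProdFinEquiv.symm (⟨p, h⟩ : Fin (Fintype.card G * n * n))
        let x := finProdFinEquiv.symm y.1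
        (s (num.symm x.1, x.2, y.2)).val
      else 0
    else 0

/-- The output `c` of a co-decoder, as found in the final memory: the bit `k` at the horizontal
edge `(p, g, j)` is in array `3` at position `((p * |G| + g) * n + j) * ma + k`, the bit `k` at
the vertical edge `(q, g, i)` is in array `4` at position `((q * |G| + g) * n + i) * mb + k`. -/
def IsOutput {G : Type*} [Fintype G] {n ma mb : ℕ} (num : G ≃ Fin (Fintype.card G))
    (m : Mem) (c : XOne G n ma mb → ZMod 2) : Prop :=
  (∀ (p : Bool) (g : G) (j : Fin n) (k : Fin ma),
    m.arr 3 (((p.toNat * Fintype.card G + num g) * n + j) * ma + k) =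
      (c (Sum.inl ((p, g, j), k))).val) ∧
  (∀ (q : Bool) (g : G) (i : Fin n) (k : Fin mb),
    m.arr 4 (((q.toNat * Fintype.card G + num g) * n + i) * mb + k) =
      (c (Sum.inr ((q, g, i), k))).val)

/-- On the syndrome `s`, the program `P` halts with output `c` after at most `T` steps, all numbers
written being at most `T`. -/
def Computes {G : Type*} [Group G] [Fintype G] {n ma mb : ℕ} (P : Prog) (T : ℕ)
    (a b : Fin n → G) (num : G ≃ Fin (Fintype.card G)) (s : Face G n → ZMod 2)
    (c : XOne G n ma mb → ZMod 2) : Prop :=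
  ∃ t m, t ≤ T ∧ Exec T P (inputMem a b num s) t m ∧ IsOutput num m c

end CoDec

open CoDec

namespace CoDec

open Matrix

set_option linter.unusedSectionVars false

/-! Correctness. On a face, `δ¹ c` is the sum of four bits, one from the dual codeword of each of
its edges (`wordH`, `wordV`). Call an edge active if `c` does not vanish on it, let `c` have the
least number `W` of active edges in its class, and let `deg v` be the number of active edges at `v`.
Robustness together with minimality gives `d₂ deg v ≤ |local view at v|`, and the distance gives
every active edge a codeword of weight at least `d₁`. If no flip lowers the syndrome, then at least
half of each local view and of each codeword lies on faces outside the syndrome. There the four bits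
cancel, so some other edge of the face is active as well, and the expander mixing lemma limits such
coincidences. With `N = |G|`, `sum_off_le` and `sum_deg_mul_offView_le` yield `d₁ W ≤ 2λW + ΔW²/N +
∑ deg²` and `(d₂/2) ∑ deg² ≤ 5λΔW + 2ΔW²/N`. Eliminating `∑ deg²` shows that `W = 0` or `W ≥ η' N`
(`IsMinimal.weight_le_of_not_lowers`). The same count without the assumption on flips, with the
syndrome as error term, bounds the syndrome from below (`IsMinimal.expansion`).

Along a run (`FlipRun.sameClass`) the syndrome only shrinks, and the residual error keeps a
representative of weight at most `η' N`: expansion improves this bound to `2/3 η' N` for the minimal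
representative, and one flip adds at most `1/8 η' N` modulo coboundaries. When the run stops, the
minimal representative is below the threshold `η' N`, so it vanishes.

Linear time. Whether a local chain at `v` lowers the syndrome depends only on the `Δ²` faces at `v`,
and the set of local chains does not depend on `G`. The program keeps a queue containing every
vertex which may still have a flip. A flip affects only the vertices sharing a face with `v`; these
are queued again, at most `4Δ²` entries. Each flip lowers the syndrome weight by at least one, so in
total `O(|G|)` entries are processed, each in constant time (`Pending`, `runs_processQueue`). Lookup
tables for the incidences are computed beforehand from the multiplication tables. -/

theorem add_self_zmodTwo {X : Type*} (f : X → ZMod 2) : f + f = 0 :=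
  funext fun _ => CharTwo.add_self_eq_zero _

/-! ### Dual codewords carried by the edges. -/

section Words

variable {G : Type*} {n ma mb : ℕ}

/-- The codeword of `C_A^⊥` which `c` puts on the faces at the horizontal edge `e`. -/
def wordH (HA : Matrix (Fin ma) (Fin n) (ZMod 2)) (c : XOne G n ma mb → ZMod 2) (e : HEdge G n)
    (i : Fin n) : ZMod 2 :=
  ∑ k, HA k i * c (Sum.inl (e, k))

/-- The codeword of `C_B^⊥` which `c` puts on the faces at the vertical edge `e`. -/
def wordV (HB : Matrix (Fin mb) (Fin n) (ZMod 2)) (c : XOne G n ma mb → ZMod 2) (e : VEdge G n)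
    (j : Fin n) : ZMod 2 :=
  ∑ k, HB k j * c (Sum.inr (e, k))

variable (HA : Matrix (Fin ma) (Fin n) (ZMod 2)) (HB : Matrix (Fin mb) (Fin n) (ZMod 2))

theorem wordH_add (c c' : XOne G n ma mb → ZMod 2) (e : HEdge G n) (i : Fin n) :
    wordH HA (c + c') e i = wordH HA c e i + wordH HA c' e i := by
  simp [wordH, mul_add, Finset.sum_add_distrib]

theorem wordV_add (c c' : XOne G n ma mb → ZMod 2) (e : VEdge G n) (j : Fin n) :
    wordV HB (c + c') e j = wordV HB c e j + wordV HB c' e j := by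
  simp [wordV, mul_add, Finset.sum_add_distrib]

end Words

/-! ### Edges and faces seen from a vertex; coordinate formulas for the coboundaries. -/

section Complex

variable {G : Type*} [Group G] {n ma mb : ℕ}

/-- The neighbour of the vertex `v` along the vertical edge in direction `a i`. -/
def stepA (a : Fin n → G) (v : Vert G) (i : Fin n) : Vert G :=
  (!v.1, v.2.1, if v.1 then (a i)⁻¹ * v.2.2 else a i * v.2.2)

/-- The neighbour of the vertex `v` along the horizontal edge in direction `b j`. -/
def stepB (b : Fin n → G) (v : Vert G) (j : Fin n) : Vert G :=
  (v.1, !v.2.1, if v.2.1 then v.2.2 * (b j)⁻¹ else v.2.2 * b j)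

/-- The face at the vertex `v` in directions `a i` and `b j`. -/
def faceAt (a b : Fin n → G) (v : Vert G) (i j : Fin n) : Face G n :=
  (if v.1 then (a i)⁻¹ * (if v.2.1 then v.2.2 * (b j)⁻¹ else v.2.2)
    else (if v.2.1 then v.2.2 * (b j)⁻¹ else v.2.2), i, j)

/-- The corner in `V_{pq}` of the face `f`. -/
def corner (a b : Fin n → G) (f : Face G n) (p q : Bool) : Vert G :=
  (p, q, if p then a f.2.1 * (if q then f.1 * b f.2.2 else f.1)
    else (if q then f.1 * b f.2.2 else f.1))

variable (a b : Fin n → G)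

@[simp] theorem stepA_stepA (v : Vert G) (i : Fin n) : stepA a (stepA a v i) i = v := by
  rcases v with ⟨_ | _, q, g⟩ <;> simp [stepA]

@[simp] theorem stepB_stepB (v : Vert G) (j : Fin n) : stepB b (stepB b v j) j = v := by
  rcases v with ⟨p, _ | _, g⟩ <;> simp [stepB]

@[simp] theorem edgeH_stepB (v : Vert G) (j : Fin n) : edgeH b (stepB b v j) j = edgeH b v j := by
  rcases v with ⟨p, _ | _, g⟩ <;> simp [stepB, edgeH]

@[simp] theorem edgeV_stepA (v : Vert G) (i : Fin n) : edgeV a (stepA a v i) i = edgeV a v i := by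
  rcases v with ⟨_ | _, q, g⟩ <;> simp [stepA, edgeV]

@[simp] theorem corner_faceAt (v : Vert G) (i j : Fin n) :
    corner a b (faceAt a b v i j) v.1 v.2.1 = v := by
  rcases v with ⟨_ | _, _ | _, g⟩ <;> simp [faceAt, corner, mul_assoc]

@[simp] theorem faceAt_corner (f : Face G n) (p q : Bool) :
    faceAt a b (corner a b f p q) f.2.1 f.2.2 = f := by
  rcases f with ⟨g, i, j⟩
  rcases p with _ | _ <;> rcases q with _ | _ <;> simp [faceAt, corner, mul_assoc]

theorem edgeH_injective (v : Vert G) : Function.Injective (edgeH b v) := fun j j' h => by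
  simpa [edgeH] using congrArg (fun e => e.2.2) h

theorem edgeV_injective (v : Vert G) : Function.Injective (edgeV a v) := fun j j' h => by
  simpa [edgeV] using congrArg (fun e => e.2.2) h

variable (HA : Matrix (Fin ma) (Fin n) (ZMod 2)) (HB : Matrix (Fin mb) (Fin n) (ZMod 2))

/-- The coboundary of the restriction of `c` to the edges at `v`, on the faces at `v`. -/
def localView (c : XOne G n ma mb → ZMod 2) (v : Vert G) : Matrix (Fin n) (Fin n) (ZMod 2) :=
  fun i j => wordH HA c (edgeH b v j) i + wordV HB c (edgeV a v i) j

variable [DecidableEq G]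

/-- A face records its own directions, so at most one local index at an edge can lead to it and the
Tanner sum has at most one term. The other three Tanner formulas hold for the same reason. -/
theorem tanner_faceH (p : Bool) (x g : G) (j' i j : Fin n) (k : Fin ma) :
    tanner (faceH a) HA ((p, x, j'), k) (g, i, j) =
      if x = (if p then a i * g else g) then if j' = j then HA k i else 0 else 0 := by
  have : ∀ l, faceH a (p, x, j') l = (g, i, j) ↔
      l = i ∧ x = (if p then a i * g else g) ∧ j' = j := by
    intro l
    rcases p with _ | _
    · simp only [faceH, Prod.mk.injEq]
      simp
      tauto
    · simp only [faceH, Prod.mk.injEq, inv_mul_eq_iff_eq_mul, if_true]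
      constructor
      · rintro ⟨h, rfl, rfl⟩
        exact ⟨rfl, h, rfl⟩
      · rintro ⟨rfl, h, rfl⟩
        exact ⟨h, rfl, rfl⟩
  simp only [tanner, this, ite_and]
  simp

theorem tanner_faceV (q : Bool) (x g : G) (i' i j : Fin n) (k : Fin mb) :
    tanner (faceV b) HB ((q, x, i'), k) (g, i, j) =
      if x = (if q then g * b j else g) then if i' = i then HB k j else 0 else 0 := by
  have : ∀ l, faceV b (q, x, i') l = (g, i, j) ↔
      l = j ∧ x = (if q then g * b j else g) ∧ i' = i := by
    intro l
    rcases q with _ | _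
    · simp only [faceV, Prod.mk.injEq]
      simp
      tauto
    · simp only [faceV, Prod.mk.injEq, mul_inv_eq_iff_eq_mul, if_true]
      constructor
      · rintro ⟨h, rfl, rfl⟩
        exact ⟨rfl, h, rfl⟩
      · rintro ⟨rfl, h, rfl⟩
        exact ⟨h, rfl, rfl⟩
  simp only [tanner, this, ite_and]
  simp

theorem tanner_edgeH (v : Vert G) (p : Bool) (x : G) (j : Fin n) (k : Fin mb) :
    tanner (edgeH b) HB (v, k) (p, x, j) =
      if v.1 = p then if v.2.2 = (if v.2.1 then x * b j else x) then HB k j else 0 else 0 := by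
  have : ∀ l, edgeH b v l = (p, x, j) ↔
      l = j ∧ v.1 = p ∧ v.2.2 = (if v.2.1 then x * b j else x) := by
    intro l
    rcases v with ⟨p', _ | _, g⟩
    · simp only [edgeH, Prod.mk.injEq]
      simp
      tauto
    · simp only [edgeH, Prod.mk.injEq, mul_inv_eq_iff_eq_mul, if_true]
      constructor
      · rintro ⟨h, h', rfl⟩
        exact ⟨rfl, h, h'⟩
      · rintro ⟨rfl, h, h'⟩
        exact ⟨h, h', rfl⟩
  simp only [tanner, this, ite_and]
  simp

theorem tanner_edgeV (v : Vert G) (q : Bool) (x : G) (i : Fin n) (k : Fin ma) :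
    tanner (edgeV a) HA (v, k) (q, x, i) =
      if v.2.1 = q then if v.2.2 = (if v.1 then a i * x else x) then HA k i else 0 else 0 := by
  have : ∀ l, edgeV a v l = (q, x, i) ↔
      l = i ∧ v.2.1 = q ∧ v.2.2 = (if v.1 then a i * x else x) := by
    intro l
    rcases v with ⟨_ | _, q', g⟩
    · simp only [edgeV, Prod.mk.injEq]
      simp
      tauto
    · simp only [edgeV, Prod.mk.injEq, inv_mul_eq_iff_eq_mul, if_true]
      constructor
      · rintro ⟨h, h', rfl⟩
        exact ⟨rfl, h, h'⟩
      · rintro ⟨rfl, h, h'⟩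
        exact ⟨h, h', rfl⟩
  simp only [tanner, this, ite_and]
  simp

variable [Fintype G]

theorem cobdryOne_apply (c : XOne G n ma mb → ZMod 2) (g : G) (i j : Fin n) :
    cobdryOne a b HA HB c (g, i, j) =
      wordH HA c (false, g, j) i + wordH HA c (true, a i * g, j) i +
        (wordV HB c (false, g, i) j + wordV HB c (true, g * b j, i) j) := by
  simp only [cobdryOne, mulVec, dotProduct, transpose_apply, bdryTwo, Fintype.sum_sum_type,
    Sum.elim_inl, Sum.elim_inr, Fintype.sum_prod_type, tanner_faceH, tanner_faceV,
    Fintype.sum_bool]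
  simp only [Bool.false_eq_true, if_false, if_true, ite_mul, zero_mul, Finset.sum_ite_irrel,
    Finset.sum_const_zero, Finset.sum_ite_eq', Finset.mem_univ, wordH, wordV]
  ring

/-- Of the four edges of a face at `v`, two are incident to `v` and two are opposite. This splitting
into local view and far edges underlies all the counting below. -/
theorem cobdryOne_faceAt (c : XOne G n ma mb → ZMod 2) (v : Vert G) (i j : Fin n) :
    cobdryOne a b HA HB c (faceAt a b v i j) =
      wordH HA c (edgeH b v j) i + wordH HA c (edgeH b (stepA a v i) j) i +
        (wordV HB c (edgeV a v i) j + wordV HB c (edgeV a (stepB b v j) i) j) := by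
  rcases v with ⟨_ | _, _ | _, g⟩ <;>
    simp [faceAt, edgeH, edgeV, stepA, stepB, cobdryOne_apply, mul_assoc, add_comm]

theorem cobdryOne_add (c c' : XOne G n ma mb → ZMod 2) :
    cobdryOne a b HA HB (c + c') = cobdryOne a b HA HB c + cobdryOne a b HA HB c' :=
  mulVec_add _ _ _

theorem cobdryZero_add (z z' : XZero G ma mb → ZMod 2) :
    cobdryZero a b HA HB (z + z') = cobdryZero a b HA HB z + cobdryZero a b HA HB z' :=
  mulVec_add _ _ _

theorem cobdryZero_inl_apply (z : XZero G ma mb → ZMod 2) (p : Bool) (x : G) (j : Fin n)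
    (k : Fin ma) :
    cobdryZero a b HA HB z (Sum.inl ((p, x, j), k)) =
      ∑ k', HB k' j * (z ((p, false, x), k, k') + z ((p, true, x * b j), k, k')) := by
  simp only [cobdryZero, mulVec, dotProduct, transpose_apply, bdryOne,
    Sum.elim_inl, Fintype.sum_prod_type, tanner_edgeH, ite_mul, zero_mul, Finset.sum_ite_irrel,
    Finset.sum_const_zero, Finset.sum_ite_eq, Finset.sum_ite_eq', Finset.mem_univ,
    Fintype.sum_bool, mul_add, Finset.sum_add_distrib]
  rcases p with _ | _ <;> simp [add_comm]

theorem cobdryZero_inr_apply (z : XZero G ma mb → ZMod 2) (q : Bool) (x : G) (i : Fin n)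
    (k : Fin mb) :
    cobdryZero a b HA HB z (Sum.inr ((q, x, i), k)) =
      ∑ k', HA k' i * (z ((false, q, x), k', k) + z ((true, q, a i * x), k', k)) := by
  simp only [cobdryZero, mulVec, dotProduct, transpose_apply, bdryOne,
    Sum.elim_inr, Fintype.sum_prod_type, tanner_edgeV, ite_mul, zero_mul, Finset.sum_ite_irrel,
    Finset.sum_const_zero, Finset.sum_ite_eq, Finset.sum_ite_eq', Finset.mem_univ,
    Fintype.sum_bool, mul_add, Finset.sum_add_distrib]
  rcases q with _ | _ <;> simp [add_comm]

theorem cobdryZero_edgeH (z : XZero G ma mb → ZMod 2) (v : Vert G) (j : Fin n) (k : Fin ma) :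
    cobdryZero a b HA HB z (Sum.inl (edgeH b v j, k)) =
      ∑ k', HB k' j * (z (v, k, k') + z (stepB b v j, k, k')) := by
  rcases v with ⟨p, _ | _, g⟩ <;> simp [edgeH, stepB, cobdryZero_inl_apply, add_comm]

theorem cobdryZero_edgeV (z : XZero G ma mb → ZMod 2) (v : Vert G) (i : Fin n) (k : Fin mb) :
    cobdryZero a b HA HB z (Sum.inr (edgeV a v i, k)) =
      ∑ k', HA k' i * (z (v, k', k) + z (stepA a v i, k', k)) := by
  rcases v with ⟨_ | _, q, g⟩ <;> simp [edgeV, stepA, cobdryZero_inr_apply, add_comm]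

theorem cobdryOne_cobdryZero (z : XZero G ma mb → ZMod 2) :
    cobdryOne a b HA HB (cobdryZero a b HA HB z) = 0 := by
  funext ⟨g, i, j⟩
  simp only [cobdryOne_apply, wordH, wordV, cobdryZero_inl_apply, cobdryZero_inr_apply,
    Finset.mul_sum, Pi.zero_apply]
  rw [Finset.sum_comm (f := fun (x : Fin mb) (y : Fin ma) => HB x j * _),
    Finset.sum_comm (f := fun (x : Fin mb) (y : Fin ma) => HB x j * _)]
  simp only [← Finset.sum_add_distrib]
  refine Finset.sum_eq_zero fun k _ => Finset.sum_eq_zero fun k' _ => ?_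
  have h2 : (2 : ZMod 2) = 0 := rfl
  rw [mul_assoc (a i) g (b j)]
  -- Each of the four corners of the face contributes once through its horizontal and once through
  -- its vertical edge, so the sum is twice something.
  linear_combination (HA k i * HB k' j * (z ((false, false, g), k, k') +
    z ((false, true, g * b j), k, k') + z ((true, false, a i * g), k, k') +
    z ((true, true, a i * (g * b j)), k, k'))) * h2

end Complex

/-! ### Classes modulo `B¹`. -/

section SameClass

variable {G : Type*} [Group G] [Fintype G] [DecidableEq G] {n ma mb : ℕ} {a b : Fin n → G}
  {HA : Matrix (Fin ma) (Fin n) (ZMod 2)} {HB : Matrix (Fin mb) (Fin n) (ZMod 2)}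
  {c c' c'' : XOne G n ma mb → ZMod 2}

theorem SameClass.refl (c : XOne G n ma mb → ZMod 2) : SameClass a b HA HB c c :=
  ⟨0, by simp [cobdryZero]⟩

theorem SameClass.symm (h : SameClass a b HA HB c c') : SameClass a b HA HB c' c := by
  obtain ⟨z, rfl⟩ := h
  refine ⟨z, ?_⟩
  rw [add_assoc, add_self_zmodTwo, add_zero]

theorem SameClass.trans (h : SameClass a b HA HB c c') (h' : SameClass a b HA HB c' c'') :
    SameClass a b HA HB c c'' := by
  obtain ⟨z, rfl⟩ := h
  obtain ⟨z', rfl⟩ := h'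
  exact ⟨z + z', by rw [cobdryZero_add, add_assoc]⟩

theorem SameClass.add (h : SameClass a b HA HB c c') {e e' : XOne G n ma mb → ZMod 2}
    (h' : SameClass a b HA HB e e') : SameClass a b HA HB (c + e) (c' + e') := by
  obtain ⟨z, rfl⟩ := h
  obtain ⟨z', rfl⟩ := h'
  exact ⟨z + z', by rw [cobdryZero_add]; abel⟩

theorem SameClass.cobdryOne_eq (h : SameClass a b HA HB c c') :
    cobdryOne a b HA HB c' = cobdryOne a b HA HB c := by
  obtain ⟨z, rfl⟩ := h
  rw [cobdryOne_add, cobdryOne_cobdryZero, add_zero]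

end SameClass

/-! ### Spectral expansion and the expander mixing lemma. -/

section Mixing

/-- Parseval's identity and the diagonal action of `M`, phrased with dot products only. -/
theorem exists_orthonormal_eigenvectors {V : Type*} [Fintype V] [DecidableEq V]
    {M : Matrix V V ℝ} (hM : M.IsHermitian) : ∃ U : V → V → ℝ,
      (∀ f h : V → ℝ, ∑ k, (f ⬝ᵥ U k) * (h ⬝ᵥ U k) = f ⬝ᵥ h) ∧
      ∀ (h : V → ℝ) (k : V), (M *ᵥ h) ⬝ᵥ U k = hM.eigenvalues k * (h ⬝ᵥ U k) := by
  refine ⟨fun k => ⇑(hM.eigenvectorBasis k), fun f h => ?_, fun h k => ?_⟩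
  · have := hM.eigenvectorBasis.sum_inner_mul_inner (WithLp.toLp 2 f) (WithLp.toLp 2 h)
    simp only [EuclideanSpace.inner_eq_star_dotProduct, star_trivial] at this
    rw [dotProduct_comm f h, ← this]
    refine Finset.sum_congr rfl fun k _ => ?_
    rw [dotProduct_comm f]
  · have hT : Mᵀ = M := by
      have := hM.eq
      rwa [conjTranspose_eq_transpose_of_trivial] at this
    rw [← smul_eq_mul, ← dotProduct_smul, ← hM.mulVec_eigenvectorBasis, dotProduct_mulVec,
      ← mulVec_transpose, hT]

/-- On functions orthogonal to an eigenvector whose eigenvalue exceeds `lam`, a `lam`-spectral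
expander has norm at most `lam`. -/
theorem IsSpectralExpander.dotProduct_mulVec_le {V : Type*} [Fintype V] [DecidableEq V]
    {M : Matrix V V ℝ} {lam d : ℝ} (hM : IsSpectralExpander M lam) (hl : 0 ≤ lam) {u : V → ℝ}
    (hu : M *ᵥ u = d • u) (hu0 : u ≠ 0) (hd : lam < d) {f : V → ℝ} (hf : f ⬝ᵥ u = 0)
    (h : V → ℝ) : f ⬝ᵥ (M *ᵥ h) ≤ lam * (f ⬝ᵥ f + h ⬝ᵥ h) / 2 := by
  obtain ⟨hH, hlam⟩ := hM
  obtain ⟨U, hsum, hMU⟩ := exists_orthonormal_eigenvectors hH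
  -- At most one eigenvalue exceeds `lam` in absolute value; if one does, its eigenvector must span
  -- the line of `u`, and `f` is orthogonal to it.
  have hex : ∀ k, (f ⬝ᵥ U k = 0) ∨ |hH.eigenvalues k| ≤ lam := by
    by_contra! hcon
    obtain ⟨k0, hk0, hk0'⟩ := hcon
    have hother : ∀ k, k ≠ k0 → |hH.eigenvalues k| ≤ lam := by
      intro k hk
      -- `eigenvalues` is `eigenvalues₀` reindexed by `V`; only the index that corresponds to
      -- position `0` escapes the hypothesis.
      have key : ∀ k, ¬ |hH.eigenvalues k| ≤ lam →
          ((Fintype.equivOfCardEq (Fintype.card_fin _)).symm k : Fin (Fintype.card V)).val = 0 := by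
        intro k hk
        by_contra h0
        exact hk (hlam _ h0)
      by_contra hk'
      have h1 := key k hk'
      have h2 := key k0 (not_le.mpr hk0')
      exact hk ((Fintype.equivOfCardEq (Fintype.card_fin _)).symm.injective
        (Fin.ext (h1.trans h2.symm)))
    -- All other eigenvalues are at most `lam < d`, hence different from the eigenvalue of `u`.
    have huk : ∀ k, k ≠ k0 → u ⬝ᵥ U k = 0 := by
      intro k hk
      have h1 := hMU u k
      rw [hu, smul_dotProduct, smul_eq_mul] at h1
      have h2 : (d - hH.eigenvalues k) * (u ⬝ᵥ U k) = 0 := by rw [sub_mul, h1, sub_self]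
      have h3 := (abs_le.mp (hother k hk)).2
      exact (mul_eq_zero.mp h2).resolve_left (by linarith)
    have h1 := hsum f u
    rw [Finset.sum_eq_single k0 (fun k _ hk => by rw [huk k hk, mul_zero]) (by simp), hf] at h1
    have h2 := hsum u u
    rw [Finset.sum_eq_single k0 (fun k _ hk => by rw [huk k hk, mul_zero]) (by simp)] at h2
    have h3 : u ⬝ᵥ U k0 = 0 := (mul_eq_zero.mp h1).resolve_left hk0
    rw [h3, mul_zero] at h2
    exact hu0 (dotProduct_self_eq_zero.mp h2.symm)
  rw [← hsum f (M *ᵥ h), ← hsum f f, ← hsum h h, ← Finset.sum_add_distrib, Finset.mul_sum,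
    Finset.sum_div]
  refine Finset.sum_le_sum fun k _ => ?_
  rw [hMU]
  set x := f ⬝ᵥ U k
  set y := h ⬝ᵥ U k
  rcases hex k with h0 | h0
  · rw [show x = 0 from h0]
    nlinarith [mul_nonneg hl (mul_self_nonneg y)]
  · obtain ⟨h1, h2⟩ := abs_le.mp h0
    -- With `μ` the eigenvalue, `(lam - μ)(x + y)² + (lam + μ)(x - y)² = 2 lam (x² + y²) - 4 μ x y`.
    nlinarith [mul_nonneg (sub_nonneg.mpr h2) (sq_nonneg (x + y)),
      mul_nonneg (neg_le_iff_add_nonneg.mp h1) (sq_nonneg (x - y))]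

variable {G : Type*} [Group G] [Fintype G] {n : ℕ}

theorem sum_sum_mul_left (a : Fin n → G) (h : G → ℝ) :
    ∑ g, ∑ i, h (a i * g) = n * ∑ g, h g := by
  rw [Finset.sum_comm]
  have : ∀ i, ∑ g, h (a i * g) = ∑ g, h g := fun i => Equiv.sum_comp (Equiv.mulLeft (a i)) h
  simp [this]

variable [DecidableEq G]

/-- The expander mixing lemma for a Cayley graph. -/
theorem mixing_left {a : Fin n → G} (ha : IsSymmGenSet a) {lam : ℝ} (hl : 0 ≤ lam)
    (hM : IsSpectralExpander (cayleyAdj a) lam) (f h : G → ℝ) :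
    ∑ g, ∑ i, f g * h (a i * g) ≤
      lam * (∑ g, f g ^ 2 + ∑ g, h g ^ 2) / 2 +
        n / Fintype.card G * ((∑ g, f g) * ∑ g, h g) := by
  have hN : (0 : ℝ) < Fintype.card G := by exact_mod_cast Fintype.card_pos
  have hmul : ∀ h : G → ℝ, cayleyAdj a *ᵥ h = fun g => ∑ i, h (a i * g) := by
    intro h
    funext g
    have h1 : ∀ x, cayleyAdj a g x = ∑ i, if x = a i * g then (1 : ℝ) else 0 := by
      intro x
      unfold cayleyAdj
      split_ifs with hx
      · obtain ⟨i, rfl⟩ := hx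
        rw [Finset.sum_eq_single i (fun j _ hj => ?_) (by simp)]
        · simp
        · rw [if_neg]
          intro h
          exact hj (ha.1 (mul_right_cancel h)).symm
      · rw [Finset.sum_eq_zero]
        intro i _
        rw [if_neg]
        rintro rfl
        exact hx ⟨i, rfl⟩
    simp only [mulVec, dotProduct, h1, Finset.sum_mul, ite_mul, one_mul, zero_mul]
    rw [Finset.sum_comm]
    simp
  set m : ℝ := (∑ g, f g) / Fintype.card G with hm
  -- It suffices to centre `f`: by regularity the constant `m` paired with `h` gives exactly the
  -- main term.
  set f0 : G → ℝ := fun g => f g - m with hf0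
  have hsum0 : ∑ g, f0 g = 0 := by
    simp only [hf0, Finset.sum_sub_distrib, Finset.sum_const, Finset.card_univ, nsmul_eq_mul, hm]
    field_simp
    ring
  have hsq : ∑ g, f0 g ^ 2 ≤ ∑ g, f g ^ 2 := by
    have h1 : ∀ g, f0 g ^ 2 = f g ^ 2 - 2 * m * f0 g - m ^ 2 := fun g => by simp only [hf0]; ring
    simp only [h1, Finset.sum_sub_distrib, ← Finset.mul_sum, hsum0]
    simp only [Finset.sum_const, Finset.card_univ, nsmul_eq_mul]
    nlinarith [sq_nonneg m]
  have hsplit : ∑ g, ∑ i, f g * h (a i * g) =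
      ∑ g, ∑ i, f0 g * h (a i * g) + n / Fintype.card G * ((∑ g, f g) * ∑ g, h g) := by
    have h1 : ∀ g i, f g * h (a i * g) = f0 g * h (a i * g) + m * h (a i * g) := fun g i => by
      simp only [hf0]; ring
    simp only [h1, Finset.sum_add_distrib, ← Finset.mul_sum]
    rw [sum_sum_mul_left, hm]
    ring
  have hmain : ∑ g, ∑ i, f0 g * h (a i * g) ≤ lam * (∑ g, f0 g ^ 2 + ∑ g, h g ^ 2) / 2 := by
    -- If `n ≤ lam`, the eigenvalue `n` of the constants is not separated from the rest, but then
    -- the trivial degree bound is already good enough.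
    rcases le_or_gt (n : ℝ) lam with hn | hn
    · calc ∑ g, ∑ i, f0 g * h (a i * g)
          ≤ ∑ g, ∑ i : Fin n, (f0 g ^ 2 / 2 + h (a i * g) ^ 2 / 2) := by
            refine Finset.sum_le_sum fun g _ => Finset.sum_le_sum fun i _ => ?_
            nlinarith [sq_nonneg (f0 g - h (a i * g))]
        _ = n * (∑ g, f0 g ^ 2 + ∑ g, h g ^ 2) / 2 := by
            simp only [Finset.sum_add_distrib, ← Finset.sum_div]
            rw [sum_sum_mul_left a (fun g => h g ^ 2)]
            simp only [Finset.sum_const, Finset.card_univ, nsmul_eq_mul, ← Finset.mul_sum,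
              Fintype.card_fin]
            ring
        _ ≤ _ := by
            have : 0 ≤ ∑ g, f0 g ^ 2 + ∑ g, h g ^ 2 := by positivity
            nlinarith
    · have h1 := hM.dotProduct_mulVec_le hl (u := fun _ => 1) (d := n) (f := f0)
        (by rw [hmul]; funext g; simp) (fun h => one_ne_zero (congrFun h (1 : G))) hn
        (by simpa [dotProduct] using hsum0) h
      rw [hmul] at h1
      simpa only [dotProduct, Finset.mul_sum, ← pow_two] using h1
  rw [hsplit]
  have : lam * (∑ g, f0 g ^ 2 + ∑ g, h g ^ 2) ≤ lam * (∑ g, f g ^ 2 + ∑ g, h g ^ 2) :=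
    mul_le_mul_of_nonneg_left (by linarith) hl
  linarith

/-- `cayleyAdj` uses left multiplication. Inversion of `G` exchanges left and right multiplication,
and the inverse generators are again the generators. -/
theorem mixing_right {b : Fin n → G} (hb : IsSymmGenSet b) {lam : ℝ} (hl : 0 ≤ lam)
    (hM : IsSpectralExpander (cayleyAdj b) lam) (f h : G → ℝ) :
    ∑ g, ∑ j, f g * h (g * b j) ≤
      lam * (∑ g, f g ^ 2 + ∑ g, h g ^ 2) / 2 +
        n / Fintype.card G * ((∑ g, f g) * ∑ g, h g) := by
  have inv_sum : ∀ F : G → ℝ, ∑ g, F g⁻¹ = ∑ g, F g := fun F => Equiv.sum_comp (Equiv.inv G) F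
  obtain ⟨hinj, hinv, hgen⟩ := hb
  choose τ hτ using hinv
  have hτ2 : ∀ j, τ (τ j) = j := fun j => hinj (by rw [hτ, hτ, inv_inv])
  have h1 := mixing_left ⟨hinj, fun i => ⟨τ i, hτ i⟩, hgen⟩ hl hM
    (fun g => f g⁻¹) (fun g => h g⁻¹)
  rw [inv_sum f, inv_sum h, inv_sum (fun g => f g ^ 2), inv_sum (fun g => h g ^ 2)] at h1
  convert h1 using 1
  rw [← inv_sum]
  refine Finset.sum_congr rfl fun g _ => ?_
  -- `τ` is the involution of the indices with `b (τ j) = (b j)⁻¹`.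
  rw [← Equiv.sum_comp (Equiv.mk τ τ hτ2 hτ2)]
  refine Finset.sum_congr rfl fun j _ => ?_
  simp [hτ]

variable {a b : Fin n → G} {lam : ℝ}

/-- The expander mixing lemma along the vertical edges. -/
theorem mixing_stepA (ha : IsSymmGenSet a) (hl : 0 ≤ lam)
    (hM : IsSpectralExpander (cayleyAdj a) lam) (f h : Vert G → ℝ) :
    ∑ v, ∑ i, f v * h (stepA a v i) ≤
      lam * (∑ v, f v ^ 2 + ∑ v, h v ^ 2) / 2 +
        n / Fintype.card G * ∑ q, ((∑ g, f (false, q, g)) * (∑ g, h (true, q, g)) +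
          (∑ g, f (true, q, g)) * ∑ g, h (false, q, g)) := by
  have key : ∀ q, ∑ p, ∑ g, ∑ i, f (p, q, g) * h (stepA a (p, q, g) i) ≤
      lam * (∑ p, ∑ g, f (p, q, g) ^ 2 + ∑ p, ∑ g, h (p, q, g) ^ 2) / 2 +
      n / Fintype.card G * ((∑ g, f (false, q, g)) * (∑ g, h (true, q, g)) +
          (∑ g, f (true, q, g)) * ∑ g, h (false, q, g)) := by
    intro q
    have h1 := mixing_left ha hl hM (fun g => f (false, q, g)) (fun g => h (true, q, g))
    have h2 := mixing_left ha hl hM (fun g => h (false, q, g)) (fun g => f (true, q, g))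
    -- Steps from layer `1` back to layer `0` are the forward steps with the roles of `f` and `h`
    -- exchanged.
    have h3 : ∑ g, ∑ i, f (true, q, g) * h (false, q, (a i)⁻¹ * g) =
        ∑ g, ∑ i, h (false, q, g) * f (true, q, a i * g) := by
      rw [Finset.sum_comm, Finset.sum_comm (s := Finset.univ) (t := Finset.univ)
        (f := fun g i => h (false, q, g) * f (true, q, a i * g))]
      refine Finset.sum_congr rfl fun i _ => ?_
      rw [← Equiv.sum_comp (Equiv.mulLeft (a i))]
      refine Finset.sum_congr rfl fun g _ => ?_
      simp [mul_comm]
    simp only [Fintype.sum_bool, stepA, Bool.not_true, Bool.not_false, if_true,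
      Bool.false_eq_true, if_false]
    rw [h3]
    linarith
  have e1 : ∀ F : Vert G → ℝ, ∑ v, F v = ∑ q, ∑ p, ∑ g, F (p, q, g) := fun F => by
    simp only [Fintype.sum_prod_type]
    rw [Finset.sum_comm]
  rw [e1 (fun v => ∑ i, f v * h (stepA a v i)), e1 (fun v => f v ^ 2), e1 (fun v => h v ^ 2)]
  refine (Finset.sum_le_sum fun q _ => key q).trans_eq ?_
  simp only [Finset.sum_add_distrib, ← Finset.sum_div, ← Finset.mul_sum]

/-- The expander mixing lemma along the horizontal edges. -/
theorem mixing_stepB (hb : IsSymmGenSet b) (hl : 0 ≤ lam)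
    (hM : IsSpectralExpander (cayleyAdj b) lam) (f h : Vert G → ℝ) :
    ∑ v, ∑ j, f v * h (stepB b v j) ≤
      lam * (∑ v, f v ^ 2 + ∑ v, h v ^ 2) / 2 +
        n / Fintype.card G * ∑ p, ((∑ g, f (p, false, g)) * (∑ g, h (p, true, g)) +
          (∑ g, f (p, true, g)) * ∑ g, h (p, false, g)) := by
  have key : ∀ p, ∑ q, ∑ g, ∑ j, f (p, q, g) * h (stepB b (p, q, g) j) ≤
      lam * (∑ q, ∑ g, f (p, q, g) ^ 2 + ∑ q, ∑ g, h (p, q, g) ^ 2) / 2 +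
      n / Fintype.card G * ((∑ g, f (p, false, g)) * (∑ g, h (p, true, g)) +
          (∑ g, f (p, true, g)) * ∑ g, h (p, false, g)) := by
    intro p
    have h1 := mixing_right hb hl hM (fun g => f (p, false, g)) (fun g => h (p, true, g))
    have h2 := mixing_right hb hl hM (fun g => h (p, false, g)) (fun g => f (p, true, g))
    have h3 : ∑ g, ∑ j, f (p, true, g) * h (p, false, g * (b j)⁻¹) =
        ∑ g, ∑ j, h (p, false, g) * f (p, true, g * b j) := by
      rw [Finset.sum_comm, Finset.sum_comm (s := Finset.univ) (t := Finset.univ)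
        (f := fun g j => h (p, false, g) * f (p, true, g * b j))]
      refine Finset.sum_congr rfl fun j _ => ?_
      rw [← Equiv.sum_comp (Equiv.mulRight (b j))]
      refine Finset.sum_congr rfl fun g _ => ?_
      simp [mul_comm]
    simp only [Fintype.sum_bool, stepB, Bool.not_true, Bool.not_false, if_true,
      Bool.false_eq_true, if_false]
    rw [h3]
    linarith
  have e1 : ∀ F : Vert G → ℝ, ∑ v, F v = ∑ p, ∑ q, ∑ g, F (p, q, g) := fun F => by
    simp only [Fintype.sum_prod_type]
  rw [e1 (fun v => ∑ j, f v * h (stepB b v j)), e1 (fun v => f v ^ 2), e1 (fun v => h v ^ 2)]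
  refine (Finset.sum_le_sum fun p _ => key p).trans_eq ?_
  simp only [Finset.sum_add_distrib, ← Finset.sum_div, ← Finset.mul_sum]

end Mixing

theorem sum_sq_le_sq_sum_of_nonneg {ι : Type*} [Fintype ι] {f : ι → ℝ} (hf : ∀ i, 0 ≤ f i) :
    ∑ i, f i ^ 2 ≤ (∑ i, f i) ^ 2 := by
  rw [pow_two, Finset.sum_mul]
  refine Finset.sum_le_sum fun i hi => ?_
  rw [pow_two]
  exact mul_le_mul_of_nonneg_left (Finset.single_le_sum (fun j _ => hf j) hi) (hf i)

/-! ### Active edges: degrees, weights, and pairs of parallel active edges. -/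

section Counting

variable {G : Type*} [Group G] {n ma mb : ℕ}

/-- The indicator function of the horizontal edges on which `c` does not vanish. -/
noncomputable def actH (c : XOne G n ma mb → ZMod 2) (e : HEdge G n) : ℝ :=
  if ∃ k, c (Sum.inl (e, k)) ≠ 0 then 1 else 0

/-- The indicator function of the vertical edges on which `c` does not vanish. -/
noncomputable def actV (c : XOne G n ma mb → ZMod 2) (e : VEdge G n) : ℝ :=
  if ∃ k, c (Sum.inr (e, k)) ≠ 0 then 1 else 0

/-- The number of horizontal edges at `v` on which `c` does not vanish. -/
noncomputable def degH (b : Fin n → G) (c : XOne G n ma mb → ZMod 2) (v : Vert G) : ℝ :=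
  ∑ j, actH c (edgeH b v j)

/-- The number of vertical edges at `v` on which `c` does not vanish. -/
noncomputable def degV (a : Fin n → G) (c : XOne G n ma mb → ZMod 2) (v : Vert G) : ℝ :=
  ∑ i, actV c (edgeV a v i)

variable (a b : Fin n → G) (c : XOne G n ma mb → ZMod 2)

theorem actH_nonneg (e : HEdge G n) : 0 ≤ actH c e := by
  unfold actH; split_ifs <;> norm_num

theorem actV_nonneg (e : VEdge G n) : 0 ≤ actV c e := by
  unfold actV; split_ifs <;> norm_num

theorem actH_le_one (e : HEdge G n) : actH c e ≤ 1 := by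
  unfold actH; split_ifs <;> norm_num

theorem actV_le_one (e : VEdge G n) : actV c e ≤ 1 := by
  unfold actV; split_ifs <;> norm_num

theorem actH_sq (e : HEdge G n) : actH c e ^ 2 = actH c e := by
  unfold actH; split_ifs <;> norm_num

theorem actV_sq (e : VEdge G n) : actV c e ^ 2 = actV c e := by
  unfold actV; split_ifs <;> norm_num

theorem degH_nonneg (v : Vert G) : 0 ≤ degH b c v := Finset.sum_nonneg fun _ _ => actH_nonneg c _

theorem degV_nonneg (v : Vert G) : 0 ≤ degV a c v := Finset.sum_nonneg fun _ _ => actV_nonneg c _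

theorem degH_le (v : Vert G) : degH b c v ≤ n := by
  refine (Finset.sum_le_sum fun j _ => actH_le_one c (edgeH b v j)).trans ?_
  simp

theorem degV_le (v : Vert G) : degV a c v ≤ n := by
  refine (Finset.sum_le_sum fun i _ => actV_le_one c (edgeV a v i)).trans ?_
  simp

theorem actH_eq_one_of_wordH {HA : Matrix (Fin ma) (Fin n) (ZMod 2)} {e : HEdge G n} {i : Fin n}
    (h : wordH HA c e i ≠ 0) : actH c e = 1 := by
  obtain ⟨k, -, hk⟩ := Finset.exists_ne_zero_of_sum_ne_zero h
  exact if_pos ⟨k, right_ne_zero_of_mul hk⟩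

theorem actV_eq_one_of_wordV {HB : Matrix (Fin mb) (Fin n) (ZMod 2)} {e : VEdge G n} {j : Fin n}
    (h : wordV HB c e j ≠ 0) : actV c e = 1 := by
  obtain ⟨k, -, hk⟩ := Finset.exists_ne_zero_of_sum_ne_zero h
  exact if_pos ⟨k, right_ne_zero_of_mul hk⟩

theorem actH_or_wordH_eq_zero (HA : Matrix (Fin ma) (Fin n) (ZMod 2)) (e : HEdge G n)
    (i : Fin n) : actH c e = 1 ∨ wordH HA c e i = 0 :=
  or_iff_not_imp_right.mpr (actH_eq_one_of_wordH c)

theorem actV_or_wordV_eq_zero (HB : Matrix (Fin mb) (Fin n) (ZMod 2)) (e : VEdge G n)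
    (j : Fin n) : actV c e = 1 ∨ wordV HB c e j = 0 :=
  or_iff_not_imp_right.mpr (actV_eq_one_of_wordV c)

variable [Fintype G]

/-- The number of horizontal edges on which `c` does not vanish. -/
noncomputable def weightH (c : XOne G n ma mb → ZMod 2) : ℝ := ∑ e, actH c e

/-- The number of vertical edges on which `c` does not vanish. -/
noncomputable def weightV (c : XOne G n ma mb → ZMod 2) : ℝ := ∑ e, actV c e

theorem edgeWeight_eq : (edgeWeight c : ℝ) = weightH c + weightV c := by
  simp only [edgeWeight, weightH, weightV, actH, actV, Finset.sum_boole]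
  push_cast
  rfl

theorem weightH_nonneg : 0 ≤ weightH c := Finset.sum_nonneg fun _ _ => actH_nonneg c _

theorem weightV_nonneg : 0 ≤ weightV c := Finset.sum_nonneg fun _ _ => actV_nonneg c _

/-- Every horizontal edge has exactly one endpoint with second bit `q`. -/
theorem sum_actH_edgeH (F : HEdge G n → ℝ) (q : Bool) :
    ∑ p, ∑ g, ∑ j, F (edgeH b (p, q, g) j) = ∑ e, F e := by
  simp only [Fintype.sum_prod_type]
  refine Finset.sum_congr rfl fun p _ => ?_
  rcases q with _ | _
  · simp [edgeH]
  · rw [Finset.sum_comm, Finset.sum_comm (s := Finset.univ) (t := Finset.univ)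
      (f := fun x y => F (p, x, y))]
    refine Finset.sum_congr rfl fun j _ => ?_
    exact Equiv.sum_comp (Equiv.mulRight (b j)⁻¹) fun g => F (p, g, j)

theorem sum_actV_edgeV (F : VEdge G n → ℝ) (p : Bool) :
    ∑ q, ∑ g, ∑ i, F (edgeV a (p, q, g) i) = ∑ e, F e := by
  simp only [Fintype.sum_prod_type]
  refine Finset.sum_congr rfl fun q _ => ?_
  rcases p with _ | _
  · simp [edgeV]
  · rw [Finset.sum_comm, Finset.sum_comm (s := Finset.univ) (t := Finset.univ)
      (f := fun x y => F (q, x, y))]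
    refine Finset.sum_congr rfl fun i _ => ?_
    exact Equiv.sum_comp (Equiv.mulLeft (a i)⁻¹) fun g => F (q, g, i)

theorem sum_degH (q : Bool) : ∑ p, ∑ g, degH b c (p, q, g) = weightH c :=
  sum_actH_edgeH b (actH c) q

theorem sum_degV (p : Bool) : ∑ q, ∑ g, degV a c (p, q, g) = weightV c :=
  sum_actV_edgeV a (actV c) p

theorem sum_vert (F : Vert G → ℝ) : ∑ v, F v = ∑ q, ∑ p, ∑ g, F (p, q, g) := by
  simp only [Fintype.sum_prod_type]
  rw [Finset.sum_comm]

theorem sum_vert' (F : Vert G → ℝ) : ∑ v, F v = ∑ p, ∑ q, ∑ g, F (p, q, g) := by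
  simp only [Fintype.sum_prod_type]

theorem sum_degH_vert : ∑ v, degH b c v = 2 * weightH c := by
  rw [sum_vert, Finset.sum_congr rfl fun q _ => sum_degH b c q]
  simp

theorem sum_degV_vert : ∑ v, degV a c v = 2 * weightV c := by
  rw [sum_vert', Finset.sum_congr rfl fun p _ => sum_degV a c p]
  simp

variable [DecidableEq G] {a b} {lam : ℝ}

/-- Counts pairs of active horizontal edges opposite each other in a face. Such edges share the
direction `b j`, so the mixing lemma for `A` applies to each `j` separately, with the indicator of
the active edges as both functions. -/
theorem parallelH_le (ha : IsSymmGenSet a) (hl : 0 ≤ lam)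
    (hM : IsSpectralExpander (cayleyAdj a) lam) :
    ∑ v, ∑ j, ∑ i, actH c (edgeH b v j) * actH c (edgeH b (stepA a v i) j) ≤
      2 * lam * weightH c + n / Fintype.card G * weightH c ^ 2 := by
  have hN : (0 : ℝ) < Fintype.card G := by exact_mod_cast Fintype.card_pos
  set F : Bool → Bool → Fin n → ℝ := fun p q j => ∑ g, actH c (edgeH b (p, q, g) j) with hF
  have hF0 : ∀ p q j, 0 ≤ F p q j := fun p q j => Finset.sum_nonneg fun _ _ => actH_nonneg c _
  have h1 : ∀ j, ∑ v, ∑ i, actH c (edgeH b v j) * actH c (edgeH b (stepA a v i) j) ≤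
      lam * ∑ v, actH c (edgeH b v j) +
        n / Fintype.card G * ∑ q, 2 * (F false q j * F true q j) := by
    intro j
    refine (mixing_stepA ha hl hM (fun v => actH c (edgeH b v j))
      (fun v => actH c (edgeH b v j))).trans_eq ?_
    simp only [actH_sq]
    congr 1
    · ring
    · congr 1
      refine Finset.sum_congr rfl fun q _ => ?_
      simp only [hF]
      ring
  have hsum : ∀ q, ∑ j, (F false q j + F true q j) = weightH c := by
    intro q
    rw [← sum_degH b c q]
    simp only [hF, degH, Fintype.sum_bool, Finset.sum_add_distrib]
    rw [add_comm]
    congr 1 <;> exact Finset.sum_comm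
  -- From `2xy ≤ (x + y)²/2`; the two values of `q` restore the factor lost here.
  have h2 : ∀ q, ∑ j, 2 * (F false q j * F true q j) ≤ weightH c ^ 2 / 2 := by
    intro q
    calc ∑ j, 2 * (F false q j * F true q j) ≤ ∑ j, (F false q j + F true q j) ^ 2 / 2 :=
          Finset.sum_le_sum fun j _ => by nlinarith [sq_nonneg (F false q j - F true q j)]
      _ ≤ (∑ j, (F false q j + F true q j)) ^ 2 / 2 := by
          rw [← Finset.sum_div]
          gcongr
          exact sum_sq_le_sq_sum_of_nonneg fun j => add_nonneg (hF0 _ _ _) (hF0 _ _ _)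
      _ = _ := by rw [hsum]
  calc _ = ∑ j, ∑ v, ∑ i, actH c (edgeH b v j) * actH c (edgeH b (stepA a v i) j) :=
        Finset.sum_comm
    _ ≤ ∑ j, (lam * ∑ v, actH c (edgeH b v j) +
        n / Fintype.card G * ∑ q, 2 * (F false q j * F true q j)) :=
        Finset.sum_le_sum fun j _ => h1 j
    _ = lam * (2 * weightH c) +
        n / Fintype.card G * ∑ q, ∑ j, 2 * (F false q j * F true q j) := by
        rw [Finset.sum_add_distrib, ← Finset.mul_sum, ← Finset.mul_sum, ← sum_degH_vert b c,
          Finset.sum_comm (s := (Finset.univ : Finset (Fin n))) (t := Finset.univ),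
          Finset.sum_comm (s := (Finset.univ : Finset (Fin n))) (t := Finset.univ)]
        rfl
    _ ≤ lam * (2 * weightH c) + n / Fintype.card G * ∑ q : Bool, weightH c ^ 2 / 2 := by
        gcongr with q
        exact h2 q
    _ = _ := by
        simp only [Fintype.sum_bool]
        ring

theorem parallelV_le (hb : IsSymmGenSet b) (hl : 0 ≤ lam)
    (hM : IsSpectralExpander (cayleyAdj b) lam) :
    ∑ v, ∑ i, ∑ j, actV c (edgeV a v i) * actV c (edgeV a (stepB b v j) i) ≤
      2 * lam * weightV c + n / Fintype.card G * weightV c ^ 2 := by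
  have hN : (0 : ℝ) < Fintype.card G := by exact_mod_cast Fintype.card_pos
  set F : Bool → Bool → Fin n → ℝ := fun q p i => ∑ g, actV c (edgeV a (p, q, g) i) with hF
  have hF0 : ∀ p q j, 0 ≤ F p q j := fun p q j => Finset.sum_nonneg fun _ _ => actV_nonneg c _
  have h1 : ∀ i, ∑ v, ∑ j, actV c (edgeV a v i) * actV c (edgeV a (stepB b v j) i) ≤
      lam * ∑ v, actV c (edgeV a v i) +
        n / Fintype.card G * ∑ p, 2 * (F false p i * F true p i) := by
    intro i
    refine (mixing_stepB hb hl hM (fun v => actV c (edgeV a v i))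
      (fun v => actV c (edgeV a v i))).trans_eq ?_
    simp only [actV_sq]
    congr 1
    · ring
    · congr 1
      refine Finset.sum_congr rfl fun q _ => ?_
      simp only [hF]
      ring
  have hsum : ∀ p, ∑ i, (F false p i + F true p i) = weightV c := by
    intro p
    rw [← sum_degV a c p]
    simp only [hF, degV, Fintype.sum_bool, Finset.sum_add_distrib]
    rw [add_comm]
    congr 1 <;> exact Finset.sum_comm
  have h2 : ∀ p, ∑ i, 2 * (F false p i * F true p i) ≤ weightV c ^ 2 / 2 := by
    intro p
    calc ∑ i, 2 * (F false p i * F true p i) ≤ ∑ i, (F false p i + F true p i) ^ 2 / 2 :=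
          Finset.sum_le_sum fun j _ => by nlinarith [sq_nonneg (F false p j - F true p j)]
      _ ≤ (∑ i, (F false p i + F true p i)) ^ 2 / 2 := by
          rw [← Finset.sum_div]
          gcongr
          exact sum_sq_le_sq_sum_of_nonneg fun j => add_nonneg (hF0 _ _ _) (hF0 _ _ _)
      _ = _ := by rw [hsum]
  calc _ = ∑ i, ∑ v, ∑ j, actV c (edgeV a v i) * actV c (edgeV a (stepB b v j) i) :=
        Finset.sum_comm
    _ ≤ ∑ i, (lam * ∑ v, actV c (edgeV a v i) +
        n / Fintype.card G * ∑ p, 2 * (F false p i * F true p i)) :=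
        Finset.sum_le_sum fun j _ => h1 j
    _ = lam * (2 * weightV c) +
        n / Fintype.card G * ∑ p, ∑ i, 2 * (F false p i * F true p i) := by
        rw [Finset.sum_add_distrib, ← Finset.mul_sum, ← Finset.mul_sum, ← sum_degV_vert a c,
          Finset.sum_comm (s := (Finset.univ : Finset (Fin n))) (t := Finset.univ),
          Finset.sum_comm (s := (Finset.univ : Finset (Fin n))) (t := Finset.univ)]
        rfl
    _ ≤ lam * (2 * weightV c) + n / Fintype.card G * ∑ p : Bool, weightV c ^ 2 / 2 := by
        gcongr with q
        exact h2 q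
    _ = _ := by
        simp only [Fintype.sum_bool]
        ring

end Counting

/-! ### Local chains at a vertex, and flips as a local condition. -/

section LocalChain

/-- Values on the `2 n` edges at a vertex. -/
abbrev LocalChain (n ma mb : ℕ) := (Fin n → Fin ma → ZMod 2) × (Fin n → Fin mb → ZMod 2)

variable {G : Type*} [Group G] [DecidableEq G] {n ma mb : ℕ}

/-- The coboundary of a local chain on the faces at its vertex. -/
def localSyndrome (HA : Matrix (Fin ma) (Fin n) (ZMod 2)) (HB : Matrix (Fin mb) (Fin n) (ZMod 2))
    (x : LocalChain n ma mb) (i j : Fin n) : ZMod 2 :=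
  ∑ k, HA k i * x.1 j k + ∑ k, HB k j * x.2 i k

variable (a b : Fin n → G)

/-- The local chain `x` placed at the vertex `v`. -/
def embed (v : Vert G) (x : LocalChain n ma mb) : XOne G n ma mb → ZMod 2 :=
  Sum.elim (fun y => if edgeH b v y.1.2.2 = y.1 then x.1 y.1.2.2 y.2 else 0)
    (fun y => if edgeV a v y.1.2.2 = y.1 then x.2 y.1.2.2 y.2 else 0)

/-- The values of `c` on the edges at `v`. -/
def restrictAt (v : Vert G) (c : XOne G n ma mb → ZMod 2) : LocalChain n ma mb :=
  (fun j k => c (Sum.inl (edgeH b v j, k)), fun i k => c (Sum.inr (edgeV a v i, k)))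

theorem supportedAt_embed (v : Vert G) (x : LocalChain n ma mb) :
    SupportedAt a b v (embed a b v x) := by
  refine ⟨fun e k h => ?_, fun e k h => ?_⟩
  · by_contra hcon
    exact h (if_neg fun h' => hcon ⟨_, h'⟩)
  · by_contra hcon
    exact h (if_neg fun h' => hcon ⟨_, h'⟩)

variable {a b} in
-- Reduces the flips at a vertex to `LocalChain`, a finite type which does not depend on `G`; the
-- program can therefore try all of them.
theorem SupportedAt.eq_embed {v : Vert G} {c : XOne G n ma mb → ZMod 2}
    (h : SupportedAt a b v c) : c = embed a b v (restrictAt a b v c) := by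
  funext y
  rcases y with ⟨e, k⟩ | ⟨e, k⟩
  · simp only [embed, Sum.elim_inl, restrictAt]
    split_ifs with he
    · rw [he]
    · by_contra hc
      obtain ⟨j, rfl⟩ := h.1 e k hc
      exact he rfl
  · simp only [embed, Sum.elim_inr, restrictAt]
    split_ifs with he
    · rw [he]
    · by_contra hc
      obtain ⟨j, rfl⟩ := h.2 e k hc
      exact he rfl

variable (HA : Matrix (Fin ma) (Fin n) (ZMod 2)) (HB : Matrix (Fin mb) (Fin n) (ZMod 2))

theorem localSyndrome_restrictAt (c : XOne G n ma mb → ZMod 2) (v : Vert G) (i j : Fin n) :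
    localSyndrome HA HB (restrictAt a b v c) i j = localView a b HA HB c v i j := rfl

theorem wordH_embed (v : Vert G) (x : LocalChain n ma mb) (e : HEdge G n) (i : Fin n) :
    wordH HA (embed a b v x) e i =
      if edgeH b v e.2.2 = e then ∑ k, HA k i * x.1 e.2.2 k else 0 := by
  simp only [wordH, embed, Sum.elim_inl]
  split_ifs <;> simp

theorem wordV_embed (v : Vert G) (x : LocalChain n ma mb) (e : VEdge G n) (j : Fin n) :
    wordV HB (embed a b v x) e j =
      if edgeV a v e.2.2 = e then ∑ k, HB k j * x.2 e.2.2 k else 0 := by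
  simp only [wordV, embed, Sum.elim_inr]
  split_ifs <;> simp

variable [Fintype G]

theorem cobdryOne_embed (v : Vert G) (x : LocalChain n ma mb) (f : Face G n) :
    cobdryOne a b HA HB (embed a b v x) f =
      if faceAt a b v f.2.1 f.2.2 = f then localSyndrome HA HB x f.2.1 f.2.2 else 0 := by
  -- Every face is viewed from its corner `u` in the same layer as `v`; it is a face at `v` exactly
  -- if `u = v`.
  obtain ⟨u, i, j, hu1, hu2, rfl⟩ : ∃ u i j, u.1 = v.1 ∧ u.2.1 = v.2.1 ∧ f = faceAt a b u i j :=
    ⟨corner a b f v.1 v.2.1, f.2.1, f.2.2, rfl, rfl, (faceAt_corner a b f _ _).symm⟩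
  rw [cobdryOne_faceAt]
  simp only [wordH_embed, wordV_embed]
  obtain ⟨p, q, g⟩ := v
  obtain ⟨p', q', g'⟩ := u
  obtain rfl : p' = p := hu1
  obtain rfl : q' = q := hu2
  simp only [localSyndrome]
  rcases p' with _ | _ <;> rcases q' with _ | _ <;> by_cases hg : g = g' <;>
    simp [edgeH, edgeV, stepA, stepB, faceAt, hg]

theorem cobdryOne_embed_faceAt (v : Vert G) (x : LocalChain n ma mb) (i j : Fin n) :
    cobdryOne a b HA HB (embed a b v x) (faceAt a b v i j) = localSyndrome HA HB x i j := by
  rw [cobdryOne_embed]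
  exact if_pos rfl

theorem sum_faces_at {M : Type*} [AddCommMonoid M] (v : Vert G) (F : Face G n → M)
    (hF : ∀ f, faceAt a b v f.2.1 f.2.2 ≠ f → F f = 0) :
    ∑ f, F f = ∑ i, ∑ j, F (faceAt a b v i j) := by
  simp only [Fintype.sum_prod_type]
  rw [Finset.sum_comm]
  refine Finset.sum_congr rfl fun i _ => ?_
  rw [Finset.sum_comm]
  refine Finset.sum_congr rfl fun j _ => ?_
  rw [Finset.sum_eq_single (faceAt a b v i j).1 (fun g _ hg => ?_) (by simp)]
  · rfl
  · refine hF _ fun h => hg ?_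
    exact (congrArg Prod.fst h).symm

theorem hammingNorm_eq_sum_val {X : Type*} [Fintype X] (s : X → ZMod 2) :
    hammingNorm s = ∑ f, (s f).val := by
  rw [hammingNorm, Finset.card_filter]
  refine Finset.sum_congr rfl fun f _ => ?_
  generalize s f = x
  revert x
  decide

/-- The overlap of two supports is counted twice on the right and cancels on the left; stated
without subtraction to stay in the natural numbers. -/
theorem hammingNorm_add_two_mul {X : Type*} [Fintype X] (s t : X → ZMod 2) :
    hammingNorm (s + t) + 2 * ∑ f, (s f).val * (t f).val =
      hammingNorm s + ∑ f, (t f).val := by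
  simp only [hammingNorm_eq_sum_val, Finset.mul_sum, ← Finset.sum_add_distrib]
  refine Finset.sum_congr rfl fun f _ => ?_
  have : ∀ x y : ZMod 2, (x + y).val + 2 * (x.val * y.val) = x.val + y.val := by decide
  exact this (s f) (t f)

/-- The local chain `x` at `v` lowers the weight of the syndrome `s`. -/
def Lowers (s : Face G n → ZMod 2) (v : Vert G) (x : LocalChain n ma mb) : Prop :=
  ∑ i, ∑ j, (localSyndrome HA HB x i j).val <
    2 * ∑ i, ∑ j, (s (faceAt a b v i j)).val * (localSyndrome HA HB x i j).val

theorem sum_cobdryOne_embed (v : Vert G) (x : LocalChain n ma mb) :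
    ∑ f, (cobdryOne a b HA HB (embed a b v x) f).val =
      ∑ i, ∑ j, (localSyndrome HA HB x i j).val := by
  rw [sum_faces_at a b v]
  · simp only [cobdryOne_embed_faceAt]
  · intro f hf
    rw [cobdryOne_embed, if_neg hf]
    rfl

/-- Makes the global weight comparison a count over the faces at one vertex, which is the test that
the program performs. -/
theorem hammingNorm_add_embed_lt_iff (s : Face G n → ZMod 2) (v : Vert G)
    (x : LocalChain n ma mb) :
    hammingNorm (s + cobdryOne a b HA HB (embed a b v x)) < hammingNorm s ↔
      Lowers a b HA HB s v x := by
  have h1 := hammingNorm_add_two_mul s (cobdryOne a b HA HB (embed a b v x))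
  have h2 := sum_cobdryOne_embed a b HA HB v x
  have h3 : ∑ f, (s f).val * (cobdryOne a b HA HB (embed a b v x) f).val =
      ∑ i, ∑ j, (s (faceAt a b v i j)).val * (localSyndrome HA HB x i j).val := by
    rw [sum_faces_at a b v]
    · simp only [cobdryOne_embed_faceAt]
    · intro f hf
      rw [cobdryOne_embed, if_neg hf, ZMod.val_zero, mul_zero]
  unfold Lowers
  omega

theorem exists_isFlip_iff (s : Face G n → ZMod 2) :
    (∃ e, IsFlip a b HA HB s e) ↔ ∃ v x, Lowers a b HA HB s v x := by
  constructor
  · rintro ⟨e, ⟨v, hv⟩, he⟩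
    rw [hv.eq_embed, hammingNorm_add_embed_lt_iff] at he
    exact ⟨v, _, he⟩
  · rintro ⟨v, x, h⟩
    exact ⟨_, ⟨v, supportedAt_embed a b v x⟩, (hammingNorm_add_embed_lt_iff a b HA HB s v x).mpr h⟩

end LocalChain

/-! ### Cancellation on the faces outside the syndrome. -/

section Off

/-- The real number `0` or `1` corresponding to a bit. -/
def bit (x : ZMod 2) : ℝ := x.val

theorem bit_zero : bit 0 = 0 := by simp [bit]

theorem bit_one : bit 1 = 1 := by simp [bit, ZMod.val_one]

theorem zmodTwo_cases (x : ZMod 2) : x = 0 ∨ x = 1 := by revert x; decide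

theorem bit_nonneg (x : ZMod 2) : 0 ≤ bit x := Nat.cast_nonneg _

theorem bit_le_one (x : ZMod 2) : bit x ≤ 1 := by
  rcases zmodTwo_cases x with rfl | rfl <;> simp [bit_zero, bit_one]

theorem hammingNorm_eq_sum_bit {X : Type*} [Fintype X] (s : X → ZMod 2) :
    (hammingNorm s : ℝ) = ∑ f, bit (s f) := by
  rw [hammingNorm_eq_sum_val]
  push_cast
  rfl

variable {G : Type*} [Group G] [DecidableEq G] [Fintype G] {n ma mb : ℕ} (a b : Fin n → G)
  (HA : Matrix (Fin ma) (Fin n) (ZMod 2)) (HB : Matrix (Fin mb) (Fin n) (ZMod 2))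
  (c : XOne G n ma mb → ZMod 2)

/-- The number of faces outside the support of `δ¹ c` on which the local view at `v` is nonzero. -/
noncomputable def offView (v : Vert G) : ℝ :=
  ∑ i, ∑ j, bit (localView a b HA HB c v i j) *
    (1 - bit (cobdryOne a b HA HB c (faceAt a b v i j)))

/-- The number of faces outside the support of `δ¹ c` on which the codeword of `c` at the
horizontal edge in direction `b j` is nonzero. -/
noncomputable def offH (v : Vert G) (j : Fin n) : ℝ :=
  ∑ i, bit (wordH HA c (edgeH b v j) i) * (1 - bit (cobdryOne a b HA HB c (faceAt a b v i j)))

/-- The number of faces outside the support of `δ¹ c` on which the codeword of `c` at the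
vertical edge in direction `a i` is nonzero. -/
noncomputable def offV (v : Vert G) (i : Fin n) : ℝ :=
  ∑ j, bit (wordV HB c (edgeV a v i) j) * (1 - bit (cobdryOne a b HA HB c (faceAt a b v i j)))

/-- Outside the syndrome the four bits cancel. If the two edges at `v` contribute a nonzero sum, one
of the two far edges must be active, and far edges are counted by the degrees of the neighbours of
`v`. -/
theorem offView_le (v : Vert G) :
    offView a b HA HB c v ≤ ∑ i, degH b c (stepA a v i) + ∑ j, degV a c (stepB b v j) := by
  have h1 : ∑ j, degV a c (stepB b v j) = ∑ i, ∑ j, actV c (edgeV a (stepB b v j) i) :=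
    Finset.sum_comm
  rw [h1, ← Finset.sum_add_distrib]
  refine Finset.sum_le_sum fun i _ => ?_
  rw [degH, ← Finset.sum_add_distrib]
  refine Finset.sum_le_sum fun j _ => ?_
  rw [cobdryOne_faceAt]
  have hL : localView a b HA HB c v i j =
    wordH HA c (edgeH b v j) i + wordV HB c (edgeV a v i) j := rfl
  rw [hL]
  have n1 := actH_nonneg c (edgeH b (stepA a v i) j)
  have n2 := actV_nonneg c (edgeV a (stepB b v j) i)
  have t1 := actH_or_wordH_eq_zero c HA (edgeH b (stepA a v i) j) i
  have t2 := actV_or_wordV_eq_zero c HB (edgeV a (stepB b v j) i) j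
  have key : ∀ x y : ZMod 2, bit x * (1 - bit y) ≤ 1 := fun x y => by
    nlinarith [bit_nonneg x, bit_le_one x, bit_nonneg y, bit_le_one y]
  rcases t1 with t1 | t1
  · rw [t1]
    exact (key _ _).trans (by linarith)
  rcases t2 with t2 | t2
  · rw [t2]
    exact (key _ _).trans (by linarith)
  rw [t1, t2, add_zero, add_zero]
  rcases zmodTwo_cases (wordH HA c (edgeH b v j) i + wordV HB c (edgeV a v i) j) with h | h <;>
    rw [h] <;> simp only [bit_zero, bit_one] <;> linarith

/-- A nonzero bit of one edge can only be cancelled by one of the other three edges: the parallel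
one, the vertical one at `v`, or the vertical one at the other end. -/
theorem offH_le (v : Vert G) (j : Fin n) :
    offH a b HA HB c v j ≤ ∑ i, (actH c (edgeH b v j) * actH c (edgeH b (stepA a v i) j) +
      actH c (edgeH b v j) * actV c (edgeV a v i) +
      actH c (edgeH b v j) * actV c (edgeV a (stepB b v j) i)) := by
  refine Finset.sum_le_sum fun i _ => ?_
  rw [cobdryOne_faceAt]
  have n1 := actH_nonneg c (edgeH b (stepA a v i) j)
  have n2 := actV_nonneg c (edgeV a (stepB b v j) i)
  have n3 := actV_nonneg c (edgeV a v i)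
  have n4 := actH_nonneg c (edgeH b v j)
  have hR : 0 ≤ actH c (edgeH b v j) * actH c (edgeH b (stepA a v i) j) +
      actH c (edgeH b v j) * actV c (edgeV a v i) +
      actH c (edgeH b v j) * actV c (edgeV a (stepB b v j) i) := by positivity
  rcases zmodTwo_cases (wordH HA c (edgeH b v j) i) with h | h
  · rw [h, bit_zero, zero_mul]
    exact hR
  have h4 : actH c (edgeH b v j) = 1 :=
    actH_eq_one_of_wordH (HA := HA) (i := i) c (by rw [h]; exact one_ne_zero)
  rw [h4, h, bit_one]
  simp only [one_mul]
  have key : ∀ y : ZMod 2, 1 - bit y ≤ 1 := fun y => by linarith [bit_nonneg y]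
  rcases actH_or_wordH_eq_zero c HA (edgeH b (stepA a v i) j) i with t1 | t1
  · rw [t1]
    exact (key _).trans (by linarith)
  rcases actV_or_wordV_eq_zero c HB (edgeV a (stepB b v j) i) j with t2 | t2
  · rw [t2]
    exact (key _).trans (by linarith)
  rcases actV_or_wordV_eq_zero c HB (edgeV a v i) j with t3 | t3
  · rw [t3]
    exact (key _).trans (by linarith)
  rw [t1, t2, t3, add_zero, add_zero, add_zero, bit_one]
  linarith

theorem offV_le (v : Vert G) (i : Fin n) :
    offV a b HA HB c v i ≤ ∑ j, (actV c (edgeV a v i) * actV c (edgeV a (stepB b v j) i) +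
      actV c (edgeV a v i) * actH c (edgeH b v j) +
      actV c (edgeV a v i) * actH c (edgeH b (stepA a v i) j)) := by
  refine Finset.sum_le_sum fun j _ => ?_
  rw [cobdryOne_faceAt]
  have n1 := actH_nonneg c (edgeH b (stepA a v i) j)
  have n2 := actV_nonneg c (edgeV a (stepB b v j) i)
  have n3 := actV_nonneg c (edgeV a v i)
  have n4 := actH_nonneg c (edgeH b v j)
  have hR : 0 ≤ actV c (edgeV a v i) * actV c (edgeV a (stepB b v j) i) +
      actV c (edgeV a v i) * actH c (edgeH b v j) +
      actV c (edgeV a v i) * actH c (edgeH b (stepA a v i) j) := by positivity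
  rcases zmodTwo_cases (wordV HB c (edgeV a v i) j) with h | h
  · rw [h, bit_zero, zero_mul]
    exact hR
  have h4 : actV c (edgeV a v i) = 1 :=
    actV_eq_one_of_wordV (HB := HB) (j := j) c (by rw [h]; exact one_ne_zero)
  rw [h4, h, bit_one]
  simp only [one_mul]
  have key : ∀ y : ZMod 2, 1 - bit y ≤ 1 := fun y => by linarith [bit_nonneg y]
  rcases actV_or_wordV_eq_zero c HB (edgeV a (stepB b v j) i) j with t2 | t2
  · rw [t2]
    exact (key _).trans (by linarith)
  rcases actH_or_wordH_eq_zero c HA (edgeH b (stepA a v i) j) i with t1 | t1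
  · rw [t1]
    exact (key _).trans (by linarith)
  rcases actH_or_wordH_eq_zero c HA (edgeH b v j) i with t3 | t3
  · rw [t3]
    exact (key _).trans (by linarith)
  rw [t1, t2, t3, zero_add, zero_add, add_zero, bit_one]
  linarith

variable {a b} {lam : ℝ}

/-- The weight `deg v` turns the sum of degrees of neighbours into a quadratic form, to which the
mixing lemmas in both directions apply. -/
theorem sum_deg_mul_offView_le (ha : IsSymmGenSet a) (hb : IsSymmGenSet b) (hl : 0 ≤ lam)
    (hMa : IsSpectralExpander (cayleyAdj a) lam) (hMb : IsSpectralExpander (cayleyAdj b) lam) :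
    ∑ v, (degH b c v + degV a c v) * offView a b HA HB c v ≤
      5 * lam * n * (edgeWeight c : ℝ) + 2 * n / Fintype.card G * (edgeWeight c : ℝ) ^ 2 := by
  have hN : (0 : ℝ) < Fintype.card G := by exact_mod_cast Fintype.card_pos
  set D : Vert G → ℝ := fun v => degH b c v + degV a c v with hD
  have hH := degH_nonneg b c
  have hV := degV_nonneg a c
  have hD0 : ∀ v, 0 ≤ D v := fun v => add_nonneg (hH v) (hV v)
  have hDsum : ∑ v, D v = 2 * (edgeWeight c : ℝ) := by
    simp only [hD, Finset.sum_add_distrib, sum_degH_vert, sum_degV_vert, edgeWeight_eq]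
    ring
  have hw1 := weightH_nonneg c
  have hw2 := weightV_nonneg c
  -- An edge has at most one endpoint in `V_{pq}`.
  have hDpart : ∀ p q, ∑ g, D (p, q, g) ≤ edgeWeight c := by
    intro p q
    simp only [hD, Finset.sum_add_distrib, edgeWeight_eq]
    have h1 := sum_degH b c q
    have h2 := sum_degV a c p
    have h3 := Finset.single_le_sum (s := Finset.univ)
      (f := fun p => ∑ g, degH b c (p, q, g))
      (fun p _ => Finset.sum_nonneg fun g _ => hH (p, q, g)) (Finset.mem_univ p)
    have h4 := Finset.single_le_sum (s := Finset.univ)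
      (f := fun q => ∑ g, degV a c (p, q, g))
      (fun q _ => Finset.sum_nonneg fun g _ => hV (p, q, g)) (Finset.mem_univ q)
    linarith
  have hsq : ∑ v, D v ^ 2 ≤ 2 * n * (2 * (edgeWeight c : ℝ)) := by
    rw [← hDsum, Finset.mul_sum]
    refine Finset.sum_le_sum fun v _ => ?_
    have : D v ≤ 2 * n := by
      have := degH_le b c v
      have := degV_le a c v
      simp only [hD]
      linarith
    nlinarith [hD0 v]
  have hsqH : ∑ v, degH b c v ^ 2 ≤ n * (2 * weightH c) := by
    rw [← sum_degH_vert b c, Finset.mul_sum]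
    refine Finset.sum_le_sum fun v _ => ?_
    nlinarith [hH v, degH_le b c v]
  have hsqV : ∑ v, degV a c v ^ 2 ≤ n * (2 * weightV c) := by
    rw [← sum_degV_vert a c, Finset.mul_sum]
    refine Finset.sum_le_sum fun v _ => ?_
    nlinarith [hV v, degV_le a c v]
  have hA := mixing_stepA ha hl hMa D (degH b c)
  have hB := mixing_stepB hb hl hMb D (degV a c)
  have hA2 : ∑ q, ((∑ g, D (false, q, g)) * (∑ g, degH b c (true, q, g)) +
      (∑ g, D (true, q, g)) * ∑ g, degH b c (false, q, g)) ≤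
      (edgeWeight c : ℝ) * (2 * weightH c) := by
    rw [← sum_degH_vert b c, sum_vert, Finset.mul_sum]
    refine Finset.sum_le_sum fun q _ => ?_
    rw [Fintype.sum_bool, mul_add]
    refine add_le_add ?_ ?_ <;>
      exact mul_le_mul_of_nonneg_right (hDpart _ _) (Finset.sum_nonneg fun g _ => hH _)
  have hB2 : ∑ p, ((∑ g, D (p, false, g)) * (∑ g, degV a c (p, true, g)) +
      (∑ g, D (p, true, g)) * ∑ g, degV a c (p, false, g)) ≤
      (edgeWeight c : ℝ) * (2 * weightV c) := by
    rw [← sum_degV_vert a c, sum_vert', Finset.mul_sum]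
    refine Finset.sum_le_sum fun q _ => ?_
    rw [Fintype.sum_bool, mul_add]
    refine add_le_add ?_ ?_ <;>
      exact mul_le_mul_of_nonneg_right (hDpart _ _) (Finset.sum_nonneg fun g _ => hV _)
  have hstart : ∑ v, D v * offView a b HA HB c v ≤
      ∑ v, ∑ i, D v * degH b c (stepA a v i) + ∑ v, ∑ j, D v * degV a c (stepB b v j) := by
    rw [← Finset.sum_add_distrib]
    refine Finset.sum_le_sum fun v _ => ?_
    rw [← Finset.mul_sum, ← Finset.mul_sum, ← mul_add]
    exact mul_le_mul_of_nonneg_left (offView_le a b HA HB c v) (hD0 v)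
  have hn0 : (0 : ℝ) ≤ n / Fintype.card G := by positivity
  have m1 := mul_le_mul_of_nonneg_left hA2 hn0
  have m2 := mul_le_mul_of_nonneg_left hB2 hn0
  -- The constant `5`: `D²` occurs with `lam/2` in both mixing bounds, which costs `4 lam n` per
  -- active edge, and `degH²`, `degV²` together cost `lam n` more.
  have m3 := mul_le_mul_of_nonneg_left hsq hl
  have m4 := mul_le_mul_of_nonneg_left hsqH hl
  have m5 := mul_le_mul_of_nonneg_left hsqV hl
  have hW := edgeWeight_eq c
  have e1 : n / Fintype.card G * ((edgeWeight c : ℝ) * (2 * weightH c)) +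
      n / Fintype.card G * ((edgeWeight c : ℝ) * (2 * weightV c)) =
      2 * n / Fintype.card G * (edgeWeight c : ℝ) ^ 2 := by
    rw [hW]
    ring
  have e2 : lam * (n * (2 * weightH c)) + lam * (n * (2 * weightV c)) =
      2 * lam * n * (edgeWeight c : ℝ) := by
    rw [hW]
    ring
  change ∑ v, D v * offView a b HA HB c v ≤ _
  linarith

/-- Parallel pairs are bounded by expansion. The four kinds of pairs of a horizontal and a vertical
edge each contribute `∑ degH degV`, absorbed into the sum of squared degrees. -/
theorem sum_off_le (ha : IsSymmGenSet a) (hb : IsSymmGenSet b) (hl : 0 ≤ lam)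
    (hMa : IsSpectralExpander (cayleyAdj a) lam) (hMb : IsSpectralExpander (cayleyAdj b) lam) :
    ∑ v, (∑ j, offH a b HA HB c v j + ∑ i, offV a b HA HB c v i) ≤
      2 * lam * (edgeWeight c : ℝ) + n / Fintype.card G * (edgeWeight c : ℝ) ^ 2 +
        ∑ v, (degH b c v + degV a c v) ^ 2 := by
  have hN : (0 : ℝ) < Fintype.card G := by exact_mod_cast Fintype.card_pos
  have adj : ∀ v, ∑ j, ∑ i, actH c (edgeH b v j) * actV c (edgeV a v i) =
      degH b c v * degV a c v := fun v => (Finset.sum_mul_sum _ _ _ _).symm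
  have adj' : ∀ v, ∑ i, ∑ j, actV c (edgeV a v i) * actH c (edgeH b v j) =
      degH b c v * degV a c v := fun v => by
    rw [mul_comm]; exact (Finset.sum_mul_sum _ _ _ _).symm
  have far : ∑ v, ∑ j, ∑ i, actH c (edgeH b v j) * actV c (edgeV a (stepB b v j) i) =
      ∑ v, degH b c v * degV a c v := by
    simp only [← adj]
    rw [Finset.sum_comm, Finset.sum_comm (s := (Finset.univ : Finset (Vert G)))
      (t := (Finset.univ : Finset (Fin n)))]
    refine Finset.sum_congr rfl fun j _ => ?_
    -- Moving to the other end of the horizontal edge turns a pair meeting there into a pair meeting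
    -- at the current vertex.
    let σ : Vert G ≃ Vert G :=
      ⟨fun v => stepB b v j, fun v => stepB b v j, fun v => stepB_stepB b v j,
        fun v => stepB_stepB b v j⟩
    rw [← Equiv.sum_comp σ]
    simp [σ]
  have far' : ∑ v, ∑ i, ∑ j, actV c (edgeV a v i) * actH c (edgeH b (stepA a v i) j) =
      ∑ v, degH b c v * degV a c v := by
    simp only [← adj']
    rw [Finset.sum_comm, Finset.sum_comm (s := (Finset.univ : Finset (Vert G)))
      (t := (Finset.univ : Finset (Fin n)))]
    refine Finset.sum_congr rfl fun i _ => ?_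
    let σ : Vert G ≃ Vert G :=
      ⟨fun v => stepA a v i, fun v => stepA a v i, fun v => stepA_stepA a v i,
        fun v => stepA_stepA a v i⟩
    rw [← Equiv.sum_comp σ]
    simp [σ]
  have h1 : ∑ v, ∑ j, offH a b HA HB c v j ≤
      2 * lam * weightH c + n / Fintype.card G * weightH c ^ 2 +
        2 * ∑ v, degH b c v * degV a c v := by
    refine (Finset.sum_le_sum fun v _ => Finset.sum_le_sum fun j _ =>
      offH_le a b HA HB c v j).trans ?_
    simp only [Finset.sum_add_distrib]
    rw [far]
    simp only [adj]
    linarith [parallelH_le (b := b) c ha hl hMa]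
  have h2 : ∑ v, ∑ i, offV a b HA HB c v i ≤
      2 * lam * weightV c + n / Fintype.card G * weightV c ^ 2 +
        2 * ∑ v, degH b c v * degV a c v := by
    refine (Finset.sum_le_sum fun v _ => Finset.sum_le_sum fun j _ =>
      offV_le a b HA HB c v j).trans ?_
    simp only [Finset.sum_add_distrib]
    rw [far']
    simp only [adj']
    linarith [parallelV_le (a := a) c hb hl hMb]
  have h3 : 4 * ∑ v, degH b c v * degV a c v ≤ ∑ v, (degH b c v + degV a c v) ^ 2 := by
    rw [Finset.mul_sum]
    exact Finset.sum_le_sum fun v _ => by nlinarith [sq_nonneg (degH b c v - degV a c v)]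
  have h4 : n / Fintype.card G * weightH c ^ 2 + n / Fintype.card G * weightV c ^ 2 ≤
      n / Fintype.card G * (weightH c + weightV c) ^ 2 := by
    rw [← mul_add]
    refine mul_le_mul_of_nonneg_left ?_ (by positivity)
    nlinarith [mul_nonneg (weightH_nonneg c) (weightV_nonneg c)]
  rw [Finset.sum_add_distrib, edgeWeight_eq]
  linarith

end Off

/-! ### The dual of `ker H` is the row space of `H`. -/

section Dual

variable {m n : ℕ} {H : Matrix (Fin m) (Fin n) (ZMod 2)}

theorem exists_right_inverse (hH : Function.Surjective H.mulVec) :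
    ∃ R : Matrix (Fin n) (Fin m) (ZMod 2), H * R = 1 :=
  Matrix.mulVec_surjective_iff_exists_right_inverse.mp hH

theorem transpose_mulVec_mem_dual (u : Fin m → ZMod 2) : Hᵀ *ᵥ u ∈ dual (code H) := by
  intro y hy
  have hy' : H *ᵥ y = 0 := by simpa [code] using hy
  rw [mulVec_transpose, ← dotProduct_mulVec, hy', dotProduct_zero]

theorem eq_of_mem_dual {R : Matrix (Fin n) (Fin m) (ZMod 2)} (hR : H * R = 1)
    {y : Fin n → ZMod 2} (hy : y ∈ dual (code H)) : Hᵀ *ᵥ (Rᵀ *ᵥ y) = y := by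
  have key : ∀ x, y ⬝ᵥ x = (Hᵀ *ᵥ (Rᵀ *ᵥ y)) ⬝ᵥ x := by
    intro x
    -- `R H` is a projection along the code, so `y` only sees the part `R H x` of `x`.
    have hx : x - R *ᵥ (H *ᵥ x) ∈ code H := by
      simp [code, mulVec_sub, mulVec_mulVec, ← Matrix.mul_assoc, hR]
    have h0 := hy _ hx
    rw [dotProduct_sub, sub_eq_zero] at h0
    rw [h0, mulVec_transpose, ← dotProduct_mulVec, mulVec_transpose, ← dotProduct_mulVec]
  funext i
  have := key (Pi.single i 1)
  simpa using this.symm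

end Dual

/-! ### Robustness, minimal representatives, and weights of codewords. -/

section Robust

variable {G : Type*} [Group G] [DecidableEq G] [Fintype G] {n ma mb : ℕ} {a b : Fin n → G}
  {HA : Matrix (Fin ma) (Fin n) (ZMod 2)} {HB : Matrix (Fin mb) (Fin n) (ZMod 2)}

theorem wordH_mem_dual (c : XOne G n ma mb → ZMod 2) (e : HEdge G n) :
    wordH HA c e ∈ dual (code HA) := by
  have : wordH HA c e = HAᵀ *ᵥ fun k => c (Sum.inl (e, k)) := rfl
  rw [this]
  exact transpose_mulVec_mem_dual _

theorem wordV_mem_dual (c : XOne G n ma mb → ZMod 2) (e : VEdge G n) :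
    wordV HB c e ∈ dual (code HB) := by
  have : wordV HB c e = HBᵀ *ᵥ fun k => c (Sum.inr (e, k)) := rfl
  rw [this]
  exact transpose_mulVec_mem_dual _

/-- Surjectivity of `HA` makes its transpose injective, so an active edge carries a nonzero
codeword. -/
theorem wordH_ne_zero (hA : Function.Surjective HA.mulVec) {c : XOne G n ma mb → ZMod 2}
    {e : HEdge G n} (h : ∃ k, c (Sum.inl (e, k)) ≠ 0) : ∃ i, wordH HA c e i ≠ 0 := by
  by_contra! hcon
  obtain ⟨R, hR⟩ := exists_right_inverse hA
  obtain ⟨k, hk⟩ := h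
  have h1 : HAᵀ *ᵥ (fun k => c (Sum.inl (e, k))) = 0 := funext hcon
  have h2 : Rᵀ *ᵥ (HAᵀ *ᵥ fun k => c (Sum.inl (e, k))) = fun k => c (Sum.inl (e, k)) := by
    rw [mulVec_mulVec, ← transpose_mul, hR, transpose_one, one_mulVec]
  rw [h1, mulVec_zero] at h2
  exact hk (congrFun h2 k).symm

theorem wordV_ne_zero (hB : Function.Surjective HB.mulVec) {c : XOne G n ma mb → ZMod 2}
    {e : VEdge G n} (h : ∃ k, c (Sum.inr (e, k)) ≠ 0) : ∃ j, wordV HB c e j ≠ 0 := by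
  by_contra! hcon
  obtain ⟨R, hR⟩ := exists_right_inverse hB
  obtain ⟨k, hk⟩ := h
  have h1 : HBᵀ *ᵥ (fun k => c (Sum.inr (e, k))) = 0 := funext hcon
  have h2 : Rᵀ *ᵥ (HBᵀ *ᵥ fun k => c (Sum.inr (e, k))) = fun k => c (Sum.inr (e, k)) := by
    rw [mulVec_mulVec, ← transpose_mul, hR, transpose_one, one_mulVec]
  rw [h1, mulVec_zero] at h2
  exact hk (congrFun h2 k).symm

theorem stepB_ne (v : Vert G) (j : Fin n) : stepB b v j ≠ v := fun h => by
  simpa [stepB] using congrArg (fun v => v.2.1) h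

theorem stepA_ne (v : Vert G) (i : Fin n) : stepA a v i ≠ v := fun h => by
  simpa [stepA] using congrArg (fun v => v.1) h

/-- The number of edges at `v` on which `c` does not vanish. -/
noncomputable def degAt (a b : Fin n → G) (c : XOne G n ma mb → ZMod 2) (v : Vert G) : ℝ :=
  degH b c v + degV a c v

/-- A change confined to the edges at `v` alters the total weight exactly as it alters the degree at
`v`. -/
theorem weight_add_degAt {c c' : XOne G n ma mb → ZMod 2} {v : Vert G}
    (hH : ∀ e k, (∀ j, edgeH b v j ≠ e) → c' (Sum.inl (e, k)) = c (Sum.inl (e, k)))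
    (hV : ∀ e k, (∀ i, edgeV a v i ≠ e) → c' (Sum.inr (e, k)) = c (Sum.inr (e, k))) :
    (edgeWeight c' : ℝ) + degAt a b c v = edgeWeight c + degAt a b c' v := by
  have h1 := Fintype.sum_of_injective (edgeH b v) (edgeH_injective b v)
    (fun j => actH c' (edgeH b v j) - actH c (edgeH b v j)) (fun e => actH c' e - actH c e)
    (fun e he => by
      have := fun k => hH e k (fun j hj => he ⟨j, hj⟩)
      simp [actH, this]) (fun _ => rfl)
  have h2 := Fintype.sum_of_injective (edgeV a v) (edgeV_injective a v)
    (fun j => actV c' (edgeV a v j) - actV c (edgeV a v j)) (fun e => actV c' e - actV c e)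
    (fun e he => by
      have := fun k => hV e k (fun j hj => he ⟨j, hj⟩)
      simp [actV, this]) (fun _ => rfl)
  simp only [Finset.sum_sub_distrib] at h1 h2
  simp only [edgeWeight_eq, degAt, degH, degV, weightH, weightV]
  linarith

/-- Robustness: modulo a coboundary at `v`, the edges at `v` on which `c` does not vanish are
few compared to the weight of the local view. -/
theorem exists_sameClass_degAt_le {d : ℝ} (hd : 0 ≤ d) (hA : Function.Surjective HA.mulVec)
    (hB : Function.Surjective HB.mulVec)
    (hrob : IsRobust (dual (code HA)) (dual (code HB)) d) (c : XOne G n ma mb → ZMod 2)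
    (v : Vert G) :
    ∃ c', SameClass a b HA HB c c' ∧
      (∀ e k, (∀ j, edgeH b v j ≠ e) → c' (Sum.inl (e, k)) = c (Sum.inl (e, k))) ∧
      (∀ e k, (∀ i, edgeV a v i ≠ e) → c' (Sum.inr (e, k)) = c (Sum.inr (e, k))) ∧
      d * degAt a b c' v ≤ ∑ i, ∑ j, bit (localView a b HA HB c v i j) := by
  obtain ⟨RA, hRA⟩ := exists_right_inverse hA
  obtain ⟨RB, hRB⟩ := exists_right_inverse hB
  set xa : Matrix (Fin n) (Fin n) (ZMod 2) := fun i j => wordH HA c (edgeH b v j) i with hxa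
  set xb : Matrix (Fin n) (Fin n) (ZMod 2) := fun i j => wordV HB c (edgeV a v i) j with hxb
  have hxaC : ColsIn (dual (code HA)) xa := fun j => wordH_mem_dual c _
  have hxbC : RowsIn (dual (code HB)) xb := fun i => wordV_mem_dual c _
  obtain ⟨ca, cb, hca, hcb, hsum, hle⟩ := hrob (xa + xb) ⟨xa, xb, hxaC, hxbC, rfl⟩
  -- `D` measures how the decomposition from robustness differs from the one given by `c`. Since
  -- also `D = cb - xb`, its columns lie in the first and its rows in the second dual code, so it is
  -- a tensor codeword.
  set D := xa - ca with hD
  have hD' : D = cb - xb := by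
    rw [hD, sub_eq_sub_iff_add_eq_add, hsum, add_comm]
  have hDA : HAᵀ * (RAᵀ * D) = D := by
    ext i j
    have h1 : (fun i => D i j) ∈ dual (code HA) := Submodule.sub_mem _ (hxaC j) (hca j)
    exact congrFun (eq_of_mem_dual hRA h1) i
  have hDB : D * RB * HB = D := by
    ext i j
    have h1 : (fun j => D i j) ∈ dual (code HB) := by
      rw [hD']
      exact Submodule.sub_mem _ (hcb i) (hxbC i)
    have h2 := congrFun (eq_of_mem_dual hRB h1) j
    rw [mulVec_transpose, mulVec_transpose] at h2
    exact h2
  -- `Z` holds the coordinates of `D` with respect to the rows of `HA` and `HB`. Placed at `v`, it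
  -- is a chain on the vertices whose coboundary replaces the codewords `xa`, `xb` at `v` by `ca`,
  -- `cb`.
  set Z : Matrix (Fin ma) (Fin mb) (ZMod 2) := RAᵀ * D * RB with hZ
  have hZD : HAᵀ * Z * HB = D := by
    rw [hZ, Matrix.mul_assoc, Matrix.mul_assoc, Matrix.mul_assoc, ← Matrix.mul_assoc D, hDB, hDA]
  set z : XZero G ma mb → ZMod 2 := fun w => if w.1 = v then Z w.2.1 w.2.2 else 0 with hz
  set c' := c + cobdryZero a b HA HB z with hc'
  have hzH : ∀ j k, cobdryZero a b HA HB z (Sum.inl (edgeH b v j, k)) = (Z * HB) k j := by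
    intro j k
    rw [cobdryZero_edgeH]
    simp only [hz, stepB_ne, if_true, if_false, add_zero, Matrix.mul_apply, mul_comm]
  have hzV : ∀ i k, cobdryZero a b HA HB z (Sum.inr (edgeV a v i, k)) = (HAᵀ * Z) i k := by
    intro i k
    rw [cobdryZero_edgeV]
    simp only [hz, stepA_ne, if_true, if_false, add_zero, Matrix.mul_apply, transpose_apply]
  have hwH : ∀ i j, wordH HA c' (edgeH b v j) i = ca i j := by
    intro i j
    have h1 : wordH HA (cobdryZero a b HA HB z) (edgeH b v j) i = D i j := by
      simp only [wordH, hzH]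
      rw [← hZD, Matrix.mul_assoc HAᵀ Z HB]
      rfl
    rw [hc', wordH_add, h1]
    change xa i j + D i j = _
    rw [hD, Matrix.sub_apply, ← CharTwo.sub_eq_add]
    ring
  have hwV : ∀ i j, wordV HB c' (edgeV a v i) j = cb i j := by
    intro i j
    have h1 : wordV HB (cobdryZero a b HA HB z) (edgeV a v i) j = D i j := by
      simp only [wordV, hzV]
      rw [← hZD, Matrix.mul_apply]
      exact Finset.sum_congr rfl fun k _ => mul_comm _ _
    rw [hc', wordV_add, h1]
    change xb i j + D i j = _
    rw [hD', Matrix.sub_apply]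
    ring
  refine ⟨c', ⟨z, rfl⟩, fun e k he => ?_, fun e k he => ?_, ?_⟩
  · obtain ⟨u, j, rfl⟩ : ∃ u j, e = edgeH b u j := ⟨(e.1, false, e.2.1), e.2.2, by simp [edgeH]⟩
    have h1 : u ≠ v := fun h => he j (by rw [h])
    have h2 : stepB b u j ≠ v := fun h => he j (by rw [← h, edgeH_stepB])
    rw [hc', Pi.add_apply, cobdryZero_edgeH]
    simp [hz, h1, h2]
  · obtain ⟨u, j, rfl⟩ : ∃ u j, e = edgeV a u j := ⟨(false, e.1, e.2.1), e.2.2, by simp [edgeV]⟩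
    have h1 : u ≠ v := fun h => he j (by rw [h])
    have h2 : stepA a u j ≠ v := fun h => he j (by rw [← h, edgeV_stepA])
    rw [hc', Pi.add_apply, cobdryZero_edgeV]
    simp [hz, h1, h2]
  · have e1 : (entryWeight (xa + xb) : ℝ) = ∑ i, ∑ j, bit (localView a b HA HB c v i j) := by
      have := hammingNorm_eq_sum_bit fun p : Fin n × Fin n => localView a b HA HB c v p.1 p.2
      rw [Fintype.sum_prod_type] at this
      rw [← this]
      rfl
    rw [← e1]
    refine le_trans (mul_le_mul_of_nonneg_left ?_ hd) hle
    refine add_le_add ?_ ?_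
    · simp only [colWeight, degH, Finset.card_filter]
      push_cast
      refine Finset.sum_le_sum fun j _ => ?_
      unfold actH
      split_ifs with h1 h2 h2
      · exact le_rfl
      · obtain ⟨i, hi⟩ := wordH_ne_zero hA h1
        exact absurd ⟨i, by rwa [hwH] at hi⟩ h2
      · exact zero_le_one
      · exact le_rfl
    · simp only [rowWeight, colWeight, degV, Finset.card_filter]
      push_cast
      refine Finset.sum_le_sum fun i _ => ?_
      unfold actV
      split_ifs with h1 h2 h2
      · exact le_rfl
      · obtain ⟨j, hj⟩ := wordV_ne_zero hB h1
        exact absurd ⟨j, by rwa [hwV] at hj⟩ h2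
      · exact zero_le_one
      · exact le_rfl

variable (a b HA HB) in
/-- `c` has the least possible edge weight in its class. -/
def IsMinimal (c : XOne G n ma mb → ZMod 2) : Prop :=
  ∀ c', SameClass a b HA HB c c' → edgeWeight c ≤ edgeWeight c'

theorem exists_isMinimal (c : XOne G n ma mb → ZMod 2) :
    ∃ c', SameClass a b HA HB c c' ∧ IsMinimal a b HA HB c' := by
  obtain ⟨c', h1, h2⟩ := (measure (edgeWeight : (XOne G n ma mb → ZMod 2) → ℕ)).wf.has_min
    {c' | SameClass a b HA HB c c'} ⟨c, SameClass.refl c⟩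
  exact ⟨c', h1, fun c'' h => not_lt.mp (h2 c'' (SameClass.trans h1 h))⟩

/-- The representative supplied by robustness differs from `c` only at `v`, so minimality prevents
it from having a smaller degree there. -/
theorem IsMinimal.degAt_le {d : ℝ} (hd : 0 ≤ d) (hA : Function.Surjective HA.mulVec)
    (hB : Function.Surjective HB.mulVec)
    (hrob : IsRobust (dual (code HA)) (dual (code HB)) d) {c : XOne G n ma mb → ZMod 2}
    (hc : IsMinimal a b HA HB c) (v : Vert G) :
    d * degAt a b c v ≤ ∑ i, ∑ j, bit (localView a b HA HB c v i j) := by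
  obtain ⟨c', h1, h2, h3, h4⟩ := exists_sameClass_degAt_le (a := a) (b := b) hd hA hB hrob c v
  have h5 := weight_add_degAt h2 h3
  have h6 : (edgeWeight c : ℝ) ≤ edgeWeight c' := by exact_mod_cast hc c' h1
  exact (mul_le_mul_of_nonneg_left (by linarith) hd).trans h4

/-- For a chain supported at `v`, the local view at `v` is its whole coboundary and the degree at
`v` its whole weight. This limits the damage which a single flip can do modulo `B¹`. -/
theorem SupportedAt.exists_sameClass_weight_le {d : ℝ} (hd : 0 ≤ d)
    (hA : Function.Surjective HA.mulVec) (hB : Function.Surjective HB.mulVec)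
    (hrob : IsRobust (dual (code HA)) (dual (code HB)) d) {e : XOne G n ma mb → ZMod 2}
    {v : Vert G} (he : SupportedAt a b v e) :
    ∃ e', SameClass a b HA HB e e' ∧
      d * edgeWeight e' ≤ hammingNorm (cobdryOne a b HA HB e) := by
  obtain ⟨e', h1, h2, h3, h4⟩ := exists_sameClass_degAt_le (a := a) (b := b) hd hA hB hrob e v
  refine ⟨e', h1, ?_⟩
  have h0 : (edgeWeight (0 : XOne G n ma mb → ZMod 2) : ℝ) + degAt a b e v =
      edgeWeight e + degAt a b (0 : XOne G n ma mb → ZMod 2) v := by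
    refine weight_add_degAt (fun f k hf => ?_) (fun f k hf => ?_)
    · by_contra hk
      obtain ⟨j, hj⟩ := he.1 f k (Ne.symm hk)
      exact hf j hj
    · by_contra hk
      obtain ⟨j, hj⟩ := he.2 f k (Ne.symm hk)
      exact hf j hj
  have hz1 : (edgeWeight (0 : XOne G n ma mb → ZMod 2) : ℝ) = 0 := by simp [edgeWeight]
  have hz2 : degAt a b (0 : XOne G n ma mb → ZMod 2) v = 0 := by
    simp [degAt, degH, degV, actH, actV]
  have h5 := weight_add_degAt h2 h3
  have h6 : (edgeWeight e' : ℝ) = degAt a b e' v := by linarith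
  have h7 : (hammingNorm (cobdryOne a b HA HB e) : ℝ) =
      ∑ i, ∑ j, bit (localView a b HA HB e v i j) := by
    rw [hammingNorm_eq_sum_val, he.eq_embed, sum_cobdryOne_embed, ← he.eq_embed]
    push_cast
    rfl
  rw [h6, h7]
  exact h4

theorem le_sum_bit_wordH {d : ℝ} (hA : Function.Surjective HA.mulVec)
    (hdist : HasDistance (dual (code HA)) d) (c : XOne G n ma mb → ZMod 2) (e : HEdge G n) :
    d * actH c e ≤ ∑ i, bit (wordH HA c e i) := by
  unfold actH
  split_ifs with h
  · obtain ⟨i, hi⟩ := wordH_ne_zero hA h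
    rw [mul_one, ← hammingNorm_eq_sum_bit]
    exact hdist _ (wordH_mem_dual c e) fun h0 => hi (congrFun h0 i)
  · rw [mul_zero]
    exact Finset.sum_nonneg fun i _ => bit_nonneg _

theorem le_sum_bit_wordV {d : ℝ} (hB : Function.Surjective HB.mulVec)
    (hdist : HasDistance (dual (code HB)) d) (c : XOne G n ma mb → ZMod 2) (e : VEdge G n) :
    d * actV c e ≤ ∑ j, bit (wordV HB c e j) := by
  unfold actV
  split_ifs with h
  · obtain ⟨i, hi⟩ := wordV_ne_zero hB h
    rw [mul_one, ← hammingNorm_eq_sum_bit]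
    exact hdist _ (wordV_mem_dual c e) fun h0 => hi (congrFun h0 i)
  · rw [mul_zero]
    exact Finset.sum_nonneg fun i _ => bit_nonneg _

theorem sum_bit_faceAt (s : Face G n → ZMod 2) :
    ∑ v, ∑ i, ∑ j, bit (s (faceAt a b v i j)) = 4 * (hammingNorm s : ℝ) := by
  have key : ∀ p q, ∑ g, ∑ i, ∑ j, bit (s (faceAt a b (p, q, g) i j)) = ∑ f, bit (s f) := by
    intro p q
    simp only [Fintype.sum_prod_type]
    rw [Finset.sum_comm, Finset.sum_comm (s := Finset.univ) (t := Finset.univ)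
      (f := fun g i => ∑ j, bit (s (g, i, j)))]
    refine Finset.sum_congr rfl fun i _ => ?_
    rw [Finset.sum_comm, Finset.sum_comm (s := Finset.univ) (t := Finset.univ)
      (f := fun g j => bit (s (g, i, j)))]
    refine Finset.sum_congr rfl fun j _ => ?_
    let σ : G ≃ G := ((Equiv.mulRight (if q then (b j)⁻¹ else 1)).trans
      (Equiv.mulLeft (if p then (a i)⁻¹ else 1)))
    rw [← Equiv.sum_comp σ fun g => bit (s (g, i, j))]
    refine Finset.sum_congr rfl fun g _ => ?_
    rcases p with _ | _ <;> rcases q with _ | _ <;> simp [σ, faceAt]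
  rw [hammingNorm_eq_sum_bit, sum_vert']
  simp only [key, Fintype.sum_bool]
  ring

end Robust

/-! ### The two inequalities for minimal cochains. -/

section Decoding

variable {G : Type*} [Group G] [DecidableEq G] [Fintype G] {n ma mb : ℕ} {a b : Fin n → G}
  {HA : Matrix (Fin ma) (Fin n) (ZMod 2)} {HB : Matrix (Fin mb) (Fin n) (ZMod 2)}

theorem sum_degAt (c : XOne G n ma mb → ZMod 2) : ∑ v, degAt a b c v = 2 * edgeWeight c := by
  simp only [degAt, Finset.sum_add_distrib, sum_degH_vert, sum_degV_vert, edgeWeight_eq]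
  ring

theorem degAt_nonneg (c : XOne G n ma mb → ZMod 2) (v : Vert G) : 0 ≤ degAt a b c v :=
  add_nonneg (degH_nonneg b c v) (degV_nonneg a c v)

theorem degAt_le_two_mul (c : XOne G n ma mb → ZMod 2) (v : Vert G) : degAt a b c v ≤ 2 * n := by
  have := degH_le b c v
  have := degV_le a c v
  unfold degAt
  linarith

theorem bit_mul_one_sub_ge (x y : ZMod 2) : bit x - bit y ≤ bit x * (1 - bit y) := by
  nlinarith [bit_nonneg y, bit_le_one x]

theorem offH_ge {d : ℝ} (hA : Function.Surjective HA.mulVec)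
    (hdist : HasDistance (dual (code HA)) d) (c : XOne G n ma mb → ZMod 2) (v : Vert G)
    (j : Fin n) : d * actH c (edgeH b v j) -
      ∑ i, bit (cobdryOne a b HA HB c (faceAt a b v i j)) ≤ offH a b HA HB c v j := by
  have h1 := le_sum_bit_wordH hA hdist c (edgeH b v j)
  refine (sub_le_sub_right h1 _).trans ?_
  rw [← Finset.sum_sub_distrib]
  exact Finset.sum_le_sum fun i _ => bit_mul_one_sub_ge _ _

theorem offV_ge {d : ℝ} (hB : Function.Surjective HB.mulVec)
    (hdist : HasDistance (dual (code HB)) d) (c : XOne G n ma mb → ZMod 2) (v : Vert G)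
    (i : Fin n) : d * actV c (edgeV a v i) -
      ∑ j, bit (cobdryOne a b HA HB c (faceAt a b v i j)) ≤ offV a b HA HB c v i := by
  have h1 := le_sum_bit_wordV hB hdist c (edgeV a v i)
  refine (sub_le_sub_right h1 _).trans ?_
  rw [← Finset.sum_sub_distrib]
  exact Finset.sum_le_sum fun i _ => bit_mul_one_sub_ge _ _

theorem sum_act (c : XOne G n ma mb → ZMod 2) :
    ∑ v, (∑ j, actH c (edgeH b v j) + ∑ i, actV c (edgeV a v i)) = 2 * edgeWeight c :=
  sum_degAt c

/-- Discarding the syndrome faces costs `8` per face: it is seen from four corners, from each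
through one horizontal and one vertical edge. -/
theorem sum_off_ge {d : ℝ} (hA : Function.Surjective HA.mulVec)
    (hB : Function.Surjective HB.mulVec) (hdA : HasDistance (dual (code HA)) d)
    (hdB : HasDistance (dual (code HB)) d) (c : XOne G n ma mb → ZMod 2) :
    2 * d * edgeWeight c - 8 * hammingNorm (cobdryOne a b HA HB c) ≤
      ∑ v, (∑ j, offH a b HA HB c v j + ∑ i, offV a b HA HB c v i) := by
  have h4 := sum_bit_faceAt (a := a) (b := b) (cobdryOne a b HA HB c)
  calc _ = d * (2 * edgeWeight c) - 2 * (4 * hammingNorm (cobdryOne a b HA HB c)) := by ring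
    _ = ∑ v, ((∑ j, (d * actH c (edgeH b v j) -
          ∑ i, bit (cobdryOne a b HA HB c (faceAt a b v i j)))) +
          ∑ i, (d * actV c (edgeV a v i) -
          ∑ j, bit (cobdryOne a b HA HB c (faceAt a b v i j)))) := by
      rw [← sum_act (a := a) (b := b) c, ← h4, Finset.mul_sum, Finset.mul_sum,
        ← Finset.sum_sub_distrib]
      refine Finset.sum_congr rfl fun v _ => ?_
      rw [Finset.sum_sub_distrib, Finset.sum_sub_distrib, ← Finset.mul_sum, ← Finset.mul_sum,
        Finset.sum_comm (f := fun j i => bit (cobdryOne a b HA HB c (faceAt a b v i j)))]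
      ring
    _ ≤ _ := Finset.sum_le_sum fun v _ => add_le_add
      (Finset.sum_le_sum fun j _ => offH_ge hA hdA c v j)
      (Finset.sum_le_sum fun i _ => offV_ge hB hdB c v i)

/-- Small minimal cochains have a large coboundary. -/
theorem IsMinimal.expansion {d₁ d₂ lam : ℝ} (h2 : 0 ≤ d₂) (hl : 0 ≤ lam)
    (ha : IsSymmGenSet a) (hb : IsSymmGenSet b)
    (hMa : IsSpectralExpander (cayleyAdj a) lam) (hMb : IsSpectralExpander (cayleyAdj b) lam)
    (hA : Function.Surjective HA.mulVec) (hB : Function.Surjective HB.mulVec)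
    (hdA : HasDistance (dual (code HA)) d₁) (hdB : HasDistance (dual (code HB)) d₁)
    (hrob : IsRobust (dual (code HA)) (dual (code HB)) d₂) {c : XOne G n ma mb → ZMod 2}
    (hc : IsMinimal a b HA HB c) :
    (d₁ * d₂ - lam * d₂ - 8 * lam * n) * edgeWeight c -
      (n * d₂ / 2 + 2 * n) * (edgeWeight c ^ 2 / Fintype.card G) ≤
      (4 * d₂ + 4 * n) * hammingNorm (cobdryOne a b HA HB c) := by
  have hN : (0 : ℝ) < Fintype.card G := by exact_mod_cast Fintype.card_pos
  have k1 := sum_off_ge hA hB hdA hdB (a := a) (b := b) c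
  have k2 := sum_off_le HA HB c ha hb hl hMa hMb
  have k3 := sum_deg_mul_offView_le HA HB c ha hb hl hMa hMb
  -- The factor `8 n` is the maximal degree `2 n` times the four corners of a syndrome face.
  have k4 : d₂ * ∑ v, degAt a b c v ^ 2 - 8 * n * hammingNorm (cobdryOne a b HA HB c) ≤
      ∑ v, degAt a b c v * offView a b HA HB c v := by
    have h4 := sum_bit_faceAt (a := a) (b := b) (cobdryOne a b HA HB c)
    calc _ = d₂ * ∑ v, degAt a b c v ^ 2 -
          2 * n * (4 * hammingNorm (cobdryOne a b HA HB c)) := by ring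
      _ = ∑ v, (d₂ * degAt a b c v ^ 2 -
          2 * n * ∑ i, ∑ j, bit (cobdryOne a b HA HB c (faceAt a b v i j))) := by
        rw [Finset.sum_sub_distrib, ← Finset.mul_sum, ← Finset.mul_sum, h4]
      _ ≤ _ := by
        refine Finset.sum_le_sum fun v _ => ?_
        have h5 := hc.degAt_le h2 hA hB hrob v
        have h6 : d₂ * degAt a b c v -
            ∑ i, ∑ j, bit (cobdryOne a b HA HB c (faceAt a b v i j)) ≤
            offView a b HA HB c v := by
          refine (sub_le_sub_right h5 _).trans ?_
          rw [← Finset.sum_sub_distrib]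
          refine Finset.sum_le_sum fun i _ => ?_
          rw [← Finset.sum_sub_distrib]
          exact Finset.sum_le_sum fun j _ => bit_mul_one_sub_ge _ _
        have h7 : 0 ≤ ∑ i, ∑ j, bit (cobdryOne a b HA HB c (faceAt a b v i j)) :=
          Finset.sum_nonneg fun i _ => Finset.sum_nonneg fun j _ => bit_nonneg _
        have h8 := mul_le_mul_of_nonneg_left h6 (degAt_nonneg (a := a) (b := b) c v)
        have h9 := mul_le_mul_of_nonneg_right (degAt_le_two_mul (a := a) (b := b) c v) h7
        linarith
  change ∑ v, degAt a b c v * offView a b HA HB c v ≤ _ at k3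
  change _ ≤ _ + ∑ v, degAt a b c v ^ 2 at k2
  -- Multiplied by `d₂`, the bound on the edges contains `d₂ ∑ deg²`, which `k3` and `k4` bound; the
  -- closing `linarith` eliminates it.
  have k5 := mul_le_mul_of_nonneg_left (k1.trans k2) h2
  have hW : (0 : ℝ) ≤ edgeWeight c := Nat.cast_nonneg _
  have hS : (0 : ℝ) ≤ hammingNorm (cobdryOne a b HA HB c) := Nat.cast_nonneg _
  set Y : ℝ := (edgeWeight c : ℝ) ^ 2 / Fintype.card G with hY
  have hY0 : 0 ≤ Y := by positivity
  have e1 : (n : ℝ) / Fintype.card G * (edgeWeight c : ℝ) ^ 2 = n * Y := by rw [hY]; ring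
  have e2 : 2 * (n : ℝ) / Fintype.card G * (edgeWeight c : ℝ) ^ 2 = 2 * n * Y := by rw [hY]; ring
  rw [e1] at k5
  rw [e2] at k3
  have p1 : 0 ≤ lam * n * edgeWeight c := by positivity
  have p2 : 0 ≤ n * Y := by positivity
  linarith

/-- A flip that does not help has at most half of its coboundary inside the syndrome. -/
theorem half_le_of_not_lowers {s : Face G n → ZMod 2} {v : Vert G} {x : LocalChain n ma mb}
    (h : ¬ Lowers a b HA HB s v x) :
    (∑ i, ∑ j, bit (localSyndrome HA HB x i j)) / 2 ≤
      ∑ i, ∑ j, bit (localSyndrome HA HB x i j) * (1 - bit (s (faceAt a b v i j))) := by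
  have h1 := not_lt.mp h
  have h2 : 2 * ∑ i, ∑ j, bit (s (faceAt a b v i j)) * bit (localSyndrome HA HB x i j) ≤
      ∑ i, ∑ j, bit (localSyndrome HA HB x i j) := by
    simp only [bit]
    exact_mod_cast h1
  have h3 : ∑ i, ∑ j, bit (localSyndrome HA HB x i j) * (1 - bit (s (faceAt a b v i j))) =
      ∑ i, ∑ j, bit (localSyndrome HA HB x i j) -
        ∑ i, ∑ j, bit (s (faceAt a b v i j)) * bit (localSyndrome HA HB x i j) := by
    simp only [← Finset.sum_sub_distrib]
    exact Finset.sum_congr rfl fun i _ => Finset.sum_congr rfl fun j _ => by ring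
  linarith

/-- Tests the hypothesis on the flip which removes `c` from the single edge in direction `j`. -/
theorem offH_ge_of_not_lowers {d : ℝ} (hA : Function.Surjective HA.mulVec)
    (hdist : HasDistance (dual (code HA)) d) (c : XOne G n ma mb → ZMod 2) (v : Vert G)
    (j : Fin n) (h : ∀ x, ¬ Lowers a b HA HB (cobdryOne a b HA HB c) v x) :
    d / 2 * actH c (edgeH b v j) ≤ offH a b HA HB c v j := by
  have h1 := le_sum_bit_wordH hA hdist c (edgeH b v j)
  have h2 := half_le_of_not_lowers
    (h (fun j' k => if j' = j then c (Sum.inl (edgeH b v j', k)) else 0, 0))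
  have h3 : ∀ i j', localSyndrome HA HB
      (fun j' k => if j' = j then c (Sum.inl (edgeH b v j', k)) else 0, 0) i j' =
      if j' = j then wordH HA c (edgeH b v j) i else 0 := by
    intro i j'
    unfold localSyndrome wordH
    split_ifs with hj
    · subst hj
      simp
    · simp [hj]
  simp only [h3, apply_ite bit, bit_zero, ite_mul, zero_mul, Finset.sum_ite_eq',
    Finset.mem_univ, if_true] at h2
  unfold offH
  linarith

theorem offV_ge_of_not_lowers {d : ℝ} (hB : Function.Surjective HB.mulVec)
    (hdist : HasDistance (dual (code HB)) d) (c : XOne G n ma mb → ZMod 2) (v : Vert G)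
    (i : Fin n) (h : ∀ x, ¬ Lowers a b HA HB (cobdryOne a b HA HB c) v x) :
    d / 2 * actV c (edgeV a v i) ≤ offV a b HA HB c v i := by
  have h1 := le_sum_bit_wordV hB hdist c (edgeV a v i)
  have h2 := half_le_of_not_lowers
    (h (0, fun i' k => if i' = i then c (Sum.inr (edgeV a v i', k)) else 0))
  have h3 : ∀ i' j, localSyndrome HA HB
      (0, fun i' k => if i' = i then c (Sum.inr (edgeV a v i', k)) else 0) i' j =
      if i' = i then wordV HB c (edgeV a v i) j else 0 := by
    intro i' j
    unfold localSyndrome wordV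
    split_ifs with hj
    · subst hj
      simp
    · simp [hj]
  simp only [h3, apply_ite bit, bit_zero, ite_mul, zero_mul, Finset.sum_ite_irrel,
    Finset.sum_const_zero, Finset.sum_ite_eq', Finset.mem_univ, if_true] at h2
  unfold offV
  linarith

/-- Small nonzero minimal cochains admit a flip. -/
theorem IsMinimal.weight_le_of_not_lowers {d₁ d₂ lam : ℝ} (h2 : 0 ≤ d₂) (hl : 0 ≤ lam)
    (ha : IsSymmGenSet a) (hb : IsSymmGenSet b)
    (hMa : IsSpectralExpander (cayleyAdj a) lam) (hMb : IsSpectralExpander (cayleyAdj b) lam)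
    (hA : Function.Surjective HA.mulVec) (hB : Function.Surjective HB.mulVec)
    (hdA : HasDistance (dual (code HA)) d₁) (hdB : HasDistance (dual (code HB)) d₁)
    (hrob : IsRobust (dual (code HA)) (dual (code HB)) d₂) {c : XOne G n ma mb → ZMod 2}
    (hc : IsMinimal a b HA HB c)
    (hno : ∀ v x, ¬ Lowers a b HA HB (cobdryOne a b HA HB c) v x) :
    (d₁ * d₂ / 4 - lam * d₂ / 2 - 8 * lam * n) * edgeWeight c ≤
      (n * d₂ / 4 + 2 * n) * (edgeWeight c ^ 2 / Fintype.card G) := by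
  have hN : (0 : ℝ) < Fintype.card G := by exact_mod_cast Fintype.card_pos
  have k1 : d₁ * edgeWeight c ≤
      ∑ v, (∑ j, offH a b HA HB c v j + ∑ i, offV a b HA HB c v i) := by
    calc d₁ * edgeWeight c = d₁ / 2 * (2 * edgeWeight c) := by ring
      _ = ∑ v, (∑ j, d₁ / 2 * actH c (edgeH b v j) + ∑ i, d₁ / 2 * actV c (edgeV a v i)) := by
        rw [← sum_act (a := a) (b := b) c, Finset.mul_sum]
        simp only [mul_add, Finset.mul_sum]
      _ ≤ _ := Finset.sum_le_sum fun v _ => add_le_add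
        (Finset.sum_le_sum fun j _ => offH_ge_of_not_lowers hA hdA c v j (hno v))
        (Finset.sum_le_sum fun i _ => offV_ge_of_not_lowers hB hdB c v i (hno v))
  have k2 := sum_off_le HA HB c ha hb hl hMa hMb
  have k3 := sum_deg_mul_offView_le HA HB c ha hb hl hMa hMb
  have k4 : d₂ / 2 * ∑ v, degAt a b c v ^ 2 ≤ ∑ v, degAt a b c v * offView a b HA HB c v := by
    rw [Finset.mul_sum]
    refine Finset.sum_le_sum fun v _ => ?_
    have h5 := hc.degAt_le h2 hA hB hrob v
    -- The flip tested here removes `c` from all edges at `v` at once; its coboundary at `v` is the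
    -- local view.
    have h6 := half_le_of_not_lowers (hno v (restrictAt a b v c))
    simp only [localSyndrome_restrictAt] at h6
    change _ ≤ offView a b HA HB c v at h6
    have h7 : d₂ / 2 * degAt a b c v ≤ offView a b HA HB c v := by linarith
    have h8 := mul_le_mul_of_nonneg_left h7 (degAt_nonneg (a := a) (b := b) c v)
    linarith
  change ∑ v, degAt a b c v * offView a b HA HB c v ≤ _ at k3
  change _ ≤ _ + ∑ v, degAt a b c v ^ 2 at k2
  have k5 := mul_le_mul_of_nonneg_left (k1.trans k2) h2
  have hW : (0 : ℝ) ≤ edgeWeight c := Nat.cast_nonneg _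
  set Y : ℝ := (edgeWeight c : ℝ) ^ 2 / Fintype.card G with hY
  have hY0 : 0 ≤ Y := by positivity
  have e1 : (n : ℝ) / Fintype.card G * (edgeWeight c : ℝ) ^ 2 = n * Y := by rw [hY]; ring
  have e2 : 2 * (n : ℝ) / Fintype.card G * (edgeWeight c : ℝ) ^ 2 = 2 * n * Y := by rw [hY]; ring
  rw [e1] at k5
  rw [e2] at k3
  have p1 : 0 ≤ lam * n * edgeWeight c := by positivity
  have p2 : 0 ≤ n * Y := by positivity
  linarith

theorem edgeWeight_add_le (c c' : XOne G n ma mb → ZMod 2) :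
    edgeWeight (c + c') ≤ edgeWeight c + edgeWeight c' := by
  have h1 : ∀ e : HEdge G n, actH (c + c') e ≤ actH c e + actH c' e := by
    intro e
    by_cases h : ∃ k, c (Sum.inl (e, k)) ≠ 0
    · have : actH c e = 1 := if_pos h
      linarith [actH_le_one (c + c') e, actH_nonneg c' e]
    · have : actH (c + c') e = actH c' e := by
        push Not at h
        simp [actH, h]
      linarith [actH_nonneg c e]
  have h2 : ∀ e : VEdge G n, actV (c + c') e ≤ actV c e + actV c' e := by
    intro e
    by_cases h : ∃ k, c (Sum.inr (e, k)) ≠ 0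
    · have : actV c e = 1 := if_pos h
      linarith [actV_le_one (c + c') e, actV_nonneg c' e]
    · have : actV (c + c') e = actV c' e := by
        push Not at h
        simp [actV, h]
      linarith [actV_nonneg c e]
  have h3 : (edgeWeight (c + c') : ℝ) ≤ edgeWeight c + edgeWeight c' := by
    simp only [edgeWeight_eq, weightH, weightV]
    have h4 := Finset.sum_le_sum fun e (_ : e ∈ Finset.univ) => h1 e
    have h5 := Finset.sum_le_sum fun e (_ : e ∈ Finset.univ) => h2 e
    rw [Finset.sum_add_distrib] at h4 h5
    linarith
  exact_mod_cast h3

theorem eq_zero_of_edgeWeight {c : XOne G n ma mb → ZMod 2} (h : edgeWeight c = 0) : c = 0 := by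
  simp only [edgeWeight, Nat.add_eq_zero_iff, Finset.card_eq_zero,
    Finset.filter_eq_empty_iff, Finset.mem_univ, true_implies, not_exists, not_not] at h
  funext x
  rcases x with ⟨e, k⟩ | ⟨e, k⟩
  · exact h.1 k
  · exact h.2 k

/-- Every syndrome face has an active edge, and an edge lies on `n` faces. Both sides are counted
with multiplicity four, from all corners. -/
theorem hammingNorm_cobdryOne_le (c : XOne G n ma mb → ZMod 2) :
    (hammingNorm (cobdryOne a b HA HB c) : ℝ) ≤ n * edgeWeight c := by
  have h1 : ∀ v i j, bit (cobdryOne a b HA HB c (faceAt a b v i j)) ≤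
      actH c (edgeH b v j) + actH c (edgeH b (stepA a v i) j) +
        (actV c (edgeV a v i) + actV c (edgeV a (stepB b v j) i)) := by
    intro v i j
    rw [cobdryOne_faceAt]
    have b1 := bit_le_one (wordH HA c (edgeH b v j) i + wordH HA c (edgeH b (stepA a v i) j) i +
        (wordV HB c (edgeV a v i) j + wordV HB c (edgeV a (stepB b v j) i) j))
    have n1 := actH_nonneg c (edgeH b (stepA a v i) j)
    have n2 := actV_nonneg c (edgeV a (stepB b v j) i)
    have n3 := actV_nonneg c (edgeV a v i)
    have n4 := actH_nonneg c (edgeH b v j)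
    rcases actH_or_wordH_eq_zero c HA (edgeH b (stepA a v i) j) i with t1 | t1
    · linarith
    rcases actV_or_wordV_eq_zero c HB (edgeV a (stepB b v j) i) j with t2 | t2
    · linarith
    rcases actV_or_wordV_eq_zero c HB (edgeV a v i) j with t3 | t3
    · linarith
    rcases actH_or_wordH_eq_zero c HA (edgeH b v j) i with t4 | t4
    · linarith
    rw [t1, t2, t3, t4]
    simp only [add_zero, bit_zero]
    linarith
  have hmovA : ∀ F : Vert G → ℝ, ∀ i, ∑ v, F (stepA a v i) = ∑ v, F v := fun F i =>
    Equiv.sum_comp (⟨fun v => stepA a v i, fun v => stepA a v i, fun v => stepA_stepA a v i,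
      fun v => stepA_stepA a v i⟩ : Vert G ≃ Vert G) F
  have hmovB : ∀ F : Vert G → ℝ, ∀ j, ∑ v, F (stepB b v j) = ∑ v, F v := fun F j =>
    Equiv.sum_comp (⟨fun v => stepB b v j, fun v => stepB b v j, fun v => stepB_stepB b v j,
      fun v => stepB_stepB b v j⟩ : Vert G ≃ Vert G) F
  have h2 := sum_bit_faceAt (a := a) (b := b) (cobdryOne a b HA HB c)
  have h3 : ∑ v, ∑ i, ∑ j, bit (cobdryOne a b HA HB c (faceAt a b v i j)) ≤
      ∑ v, ∑ i, ∑ j, (actH c (edgeH b v j) + actH c (edgeH b (stepA a v i) j) +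
        (actV c (edgeV a v i) + actV c (edgeV a (stepB b v j) i))) :=
    Finset.sum_le_sum fun v _ => Finset.sum_le_sum fun i _ => Finset.sum_le_sum fun j _ => h1 v i j
  have s1 : ∑ v, ∑ i : Fin n, ∑ j, actH c (edgeH b v j) = n * (2 * weightH c) := by
    rw [← sum_degH_vert b c, Finset.mul_sum]
    simp [degH]
  have s2 : ∑ v, ∑ i, ∑ j, actH c (edgeH b (stepA a v i) j) = n * (2 * weightH c) := by
    rw [Finset.sum_comm]
    have := hmovA (degH b c)
    simp only [degH] at this
    simp only [this]
    rw [← sum_degH_vert b c]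
    simp [degH]
  have s3 : ∑ v, ∑ i, ∑ j : Fin n, actV c (edgeV a v i) = n * (2 * weightV c) := by
    rw [← sum_degV_vert a c, Finset.mul_sum]
    simp [degV, Finset.mul_sum]
  have s4 : ∑ v, ∑ i, ∑ j, actV c (edgeV a (stepB b v j) i) = n * (2 * weightV c) := by
    rw [Finset.sum_congr rfl fun v _ => Finset.sum_comm, Finset.sum_comm]
    have := hmovB (degV a c)
    simp only [degV] at this
    simp only [this]
    rw [← sum_degV_vert a c]
    simp [degV]
  simp only [Finset.sum_add_distrib] at h3
  rw [edgeWeight_eq]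
  linarith

end Decoding

/-! ### Every run of the decoder on a small error ends in the right class. -/

section Run

variable {G : Type*} [Group G] [DecidableEq G] [Fintype G] {n ma mb : ℕ} {a b : Fin n → G}
  {HA : Matrix (Fin ma) (Fin n) (ZMod 2)} {HB : Matrix (Fin mb) (Fin n) (ZMod 2)}

/-- The hypotheses do not bound `d₁` and `d₂` from above when there are no nonzero words to test
them on; a nonzero minimal cochain provides such words. -/
theorem IsMinimal.distance_le {d₁ d₂ : ℝ} (h2 : 0 ≤ d₂)
    (hA : Function.Surjective HA.mulVec) (hB : Function.Surjective HB.mulVec)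
    (hdA : HasDistance (dual (code HA)) d₁) (hdB : HasDistance (dual (code HB)) d₁)
    (hrob : IsRobust (dual (code HA)) (dual (code HB)) d₂) {c : XOne G n ma mb → ZMod 2}
    (hc : IsMinimal a b HA HB c) (h0 : c ≠ 0) : d₁ ≤ n ∧ d₂ ≤ n := by
  have hsum : ∀ w : Fin n → ZMod 2, ∑ i, bit (w i) ≤ n := fun w =>
    (Finset.sum_le_sum fun i _ => bit_le_one (w i)).trans (by simp)
  constructor
  · obtain ⟨⟨e, k⟩ | ⟨e, k⟩, hx⟩ := Function.ne_iff.mp h0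
    · have h1 := le_sum_bit_wordH hA hdA c e
      have : actH c e = 1 := if_pos ⟨k, hx⟩
      rw [this, mul_one] at h1
      exact h1.trans (hsum _)
    · have h1 := le_sum_bit_wordV hB hdB c e
      have : actV c e = 1 := if_pos ⟨k, hx⟩
      rw [this, mul_one] at h1
      exact h1.trans (hsum _)
  · have hpos : (0 : ℝ) < edgeWeight c := by
      have : edgeWeight c ≠ 0 := fun h => h0 (eq_zero_of_edgeWeight h)
      exact_mod_cast Nat.pos_of_ne_zero this
    have h3 := sum_degAt (a := a) (b := b) c
    obtain ⟨v, -, hv⟩ : ∃ v ∈ Finset.univ, 0 < degAt a b c v := by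
      by_contra! hcon
      have := Finset.sum_nonpos hcon
      linarith
    have h4 := hc.degAt_le h2 hA hB hrob v
    have h5 : ∑ i, ∑ j, bit (localView a b HA HB c v i j) ≤ n * degAt a b c v := by
      calc ∑ i, ∑ j, bit (localView a b HA HB c v i j)
          ≤ ∑ i, ∑ j, (actH c (edgeH b v j) + actV c (edgeV a v i)) := by
            refine Finset.sum_le_sum fun i _ => Finset.sum_le_sum fun j _ => ?_
            have hL : localView a b HA HB c v i j =
              wordH HA c (edgeH b v j) i + wordV HB c (edgeV a v i) j := rfl
            have n3 := actV_nonneg c (edgeV a v i)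
            have n4 := actH_nonneg c (edgeH b v j)
            have b1 := bit_le_one (localView a b HA HB c v i j)
            rcases actV_or_wordV_eq_zero c HB (edgeV a v i) j with t3 | t3
            · linarith
            rcases actH_or_wordH_eq_zero c HA (edgeH b v j) i with t4 | t4
            · linarith
            rw [hL, t3, t4, add_zero, bit_zero]
            linarith
        _ = n * degAt a b c v := by
            simp only [Finset.sum_add_distrib, degAt, degH, degV, Finset.sum_const,
              Finset.card_univ, Fintype.card_fin, nsmul_eq_mul, ← Finset.mul_sum]
            ring
    exact le_of_mul_le_mul_right (h4.trans h5) hv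

/-- Induction along the run with two invariants for the residual error: its class contains a chain
of weight at most `η' N`, and its syndrome has weight at most `n κ N`. -/
theorem FlipRun.sameClass {d₁ d₂ lam : ℝ} (hn : 0 < n) (h2 : 0 < d₂) (hl : 0 ≤ lam)
    (ha : IsSymmGenSet a) (hb : IsSymmGenSet b)
    (hMa : IsSpectralExpander (cayleyAdj a) lam) (hMb : IsSpectralExpander (cayleyAdj b) lam)
    (hA : Function.Surjective HA.mulVec) (hB : Function.Surjective HB.mulVec)
    (hdA : HasDistance (dual (code HA)) d₁) (hdB : HasDistance (dual (code HB)) d₁)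
    (hrob : IsRobust (dual (code HA)) (dual (code HB)) d₂)
    (hpos : 0 < d₁ * d₂ / 4 - lam * d₂ / 2 - 8 * lam * n) {c c' : XOne G n ma mb → ZMod 2}
    (hw : (edgeWeight c : ℝ) ≤ kappaC n d₁ d₂ lam * Fintype.card G)
    (hrun : FlipRun a b HA HB (cobdryOne a b HA HB c) c') : SameClass a b HA HB c c' := by
  -- If only `0` is minimal, there is a single class and nothing to prove; otherwise `d₁ ≤ n` and
  -- `d₂ ≤ n` become available.
  by_cases htriv : ∀ c₀ : XOne G n ma mb → ZMod 2, IsMinimal a b HA HB c₀ → c₀ = 0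
  · have : ∀ c₀ : XOne G n ma mb → ZMod 2, SameClass a b HA HB c₀ 0 := by
      intro c₀
      obtain ⟨c₁, h1, h3⟩ := exists_isMinimal (a := a) (b := b) (HA := HA) (HB := HB) c₀
      rwa [htriv c₁ h3] at h1
    exact (this c).trans (this c').symm
  push Not at htriv
  obtain ⟨c₁, hc₁, hc₁0⟩ := htriv
  obtain ⟨hd1, hd2⟩ := hc₁.distance_le h2.le hA hB hdA hdB hrob hc₁0
  have hN : (0 : ℝ) < Fintype.card G := by exact_mod_cast Fintype.card_pos
  have hn' : (0 : ℝ) < n := by exact_mod_cast hn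
  have hln : 0 ≤ lam * n := by positivity
  have hld : 0 ≤ lam * d₂ := by positivity
  set N : ℝ := ((Fintype.card G : ℕ) : ℝ) with hNdef
  set num : ℝ := d₁ * d₂ - lam * d₂ - 8 * lam * n with hnum
  set num' : ℝ := d₁ * d₂ / 4 - lam * d₂ / 2 - 8 * lam * n with hnum'
  set η' : ℝ := etaC' n d₁ d₂ lam with hη'
  have hden' : 0 < n * d₂ / 4 + 2 * n := by positivity
  have hden : 0 < n * d₂ / 2 + 2 * n := by positivity
  have eη' : η' * (n * d₂ / 4 + 2 * n) = num' := div_mul_cancel₀ _ hden'.ne'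
  have hη'pos : 0 < η' := div_pos hpos hden'
  have hnum4 : 4 * num' ≤ num := by rw [hnum, hnum']; linarith
  have hnumpos : 0 < num := by linarith
  have hnum_le : num ≤ d₁ * d₂ := by rw [hnum]; linarith
  -- `n d₂/2 + 2n` is at most twice the denominator of `η'`, so the left side is at most `4 num'`.
  have hMη' : 2 * ((n * d₂ / 2 + 2 * n) * η') ≤ num := by nlinarith
  have hκ : kappaC n d₁ d₂ lam * (8 * n * (d₂ + 2 * n)) = num * η' := by
    unfold kappaC etaC
    rw [← hη', ← hnum]
    have : (8 * n * d₂ + 16 * (n : ℝ) ^ 2) ≠ 0 := by positivity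
    field_simp
    ring
  have hκ0 : 0 ≤ kappaC n d₁ d₂ lam := by
    have h3 : 0 ≤ kappaC n d₁ d₂ lam * (8 * n * (d₂ + 2 * n)) := by rw [hκ]; positivity
    exact nonneg_of_mul_nonneg_left h3 (by positivity)
  set κ := kappaC n d₁ d₂ lam with hκdef
  -- A flip changes at most `2 n κ N` syndrome bits, so by robustness it has a representative of
  -- weight at most `η' N / 8`.
  have hstep : 8 * (2 * n * κ) ≤ d₂ * η' := by
    have h3 : (8 * (2 * n * κ)) * (d₂ + 2 * n) ≤ (d₂ * η') * (d₂ + 2 * n) := by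
      have h4 : num * η' ≤ n * d₂ * η' := by
        refine mul_le_mul_of_nonneg_right (hnum_le.trans ?_) hη'pos.le
        exact mul_le_mul_of_nonneg_right hd1 h2.le
      have h5 : 0 ≤ d₂ * η' * d₂ := by positivity
      nlinarith
    exact le_of_mul_le_mul_right h3 (by positivity)
  -- The bootstrap: below the threshold the quadratic term of the expansion inequality takes at most
  -- half of the linear one, and the small syndrome then forces a weight well below the threshold.
  have hmain : ∀ c : XOne G n ma mb → ZMod 2, IsMinimal a b HA HB c →
      (edgeWeight c : ℝ) ≤ η' * N →
      (hammingNorm (cobdryOne a b HA HB c) : ℝ) ≤ n * κ * N →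
      3 * (edgeWeight c : ℝ) ≤ 2 * (η' * N) := by
    intro c hc hW hS
    have h3 := hc.expansion h2.le hl ha hb hMa hMb hA hB hdA hdB hrob
    rw [← hnum, ← hNdef] at h3
    set W : ℝ := ((edgeWeight c : ℕ) : ℝ) with hWdef
    have hW0 : 0 ≤ W := Nat.cast_nonneg _
    have h4 : W ^ 2 / N ≤ η' * W := by
      rw [div_le_iff₀ hN]
      nlinarith
    have h5 : (n * d₂ / 2 + 2 * n) * (W ^ 2 / N) ≤ num / 2 * W := by
      calc (n * d₂ / 2 + 2 * n) * (W ^ 2 / N) ≤ (n * d₂ / 2 + 2 * n) * (η' * W) :=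
            mul_le_mul_of_nonneg_left h4 hden.le
        _ = (n * d₂ / 2 + 2 * n) * η' * W := by ring
        _ ≤ num / 2 * W := mul_le_mul_of_nonneg_right (by linarith) hW0
    have h6 : num / 2 * W ≤ (4 * d₂ + 4 * n) * (n * κ * N) := by
      have := mul_le_mul_of_nonneg_left hS (show (0 : ℝ) ≤ 4 * d₂ + 4 * n by positivity)
      linarith
    have h7 : num * (W * (d₂ + 2 * n)) ≤ num * ((d₂ + n) * η' * N) := by
      have h8 := mul_le_mul_of_nonneg_right h6 (show (0 : ℝ) ≤ 2 * (d₂ + 2 * n) by positivity)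
      have h9 : (4 * d₂ + 4 * n) * (n * κ * N) * (2 * (d₂ + 2 * n)) =
          (d₂ + n) * N * (κ * (8 * n * (d₂ + 2 * n))) := by ring
      rw [h9, hκ] at h8
      linarith
    have h8 := le_of_mul_le_mul_left h7 hnumpos
    -- The ratio `(d₂ + n)/(d₂ + 2n)` is at most `2/3` because `d₂ ≤ n`.
    have h9 : (3 * W) * (d₂ + 2 * n) ≤ (2 * (η' * N)) * (d₂ + 2 * n) := by
      have h10 : 0 ≤ (n - d₂) * (η' * N) := mul_nonneg (by linarith) (by positivity)
      linarith
    exact le_of_mul_le_mul_right h9 (by positivity)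
  have hloop : ∀ s c', FlipRun a b HA HB s c' → ∀ c : XOne G n ma mb → ZMod 2,
      s = cobdryOne a b HA HB c →
      (∃ c₀, SameClass a b HA HB c c₀ ∧ (edgeWeight c₀ : ℝ) ≤ η' * N) →
      (hammingNorm s : ℝ) ≤ n * κ * N → SameClass a b HA HB c c' := by
    intro s c' hrun
    induction hrun with
    | done s hno =>
      rintro c rfl ⟨c₀, h0, hW0⟩ hS
      obtain ⟨m, hm1, hm2⟩ := exists_isMinimal (a := a) (b := b) (HA := HA) (HB := HB) c
      have hWm : (edgeWeight m : ℝ) ≤ η' * N :=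
        le_trans (by exact_mod_cast hm2 c₀ (hm1.symm.trans h0)) hW0
      rw [← hm1.cobdryOne_eq] at hS hno
      have h3 := hmain m hm2 hWm hS
      have h4 := hm2.weight_le_of_not_lowers h2.le hl ha hb hMa hMb hA hB hdA hdB hrob
        (fun v x hx => by
          obtain ⟨e, he⟩ := (exists_isFlip_iff a b HA HB _).mpr ⟨v, x, hx⟩
          exact hno e he)
      rw [← hnum', ← hNdef, ← eη'] at h4
      -- Without flips a nonzero minimal cochain has weight at least `η' N`, contrary to `h3`.
      have h5 : edgeWeight m = 0 := by
        by_contra hne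
        have hWpos : (0 : ℝ) < edgeWeight m := by exact_mod_cast Nat.pos_of_ne_zero hne
        set W : ℝ := ((edgeWeight m : ℕ) : ℝ)
        have h6 : (n * d₂ / 4 + 2 * n) * (η' * W) ≤ (n * d₂ / 4 + 2 * n) * (W ^ 2 / N) := by
          linarith
        have h7 := le_of_mul_le_mul_left h6 hden'
        rw [le_div_iff₀ hN] at h7
        have h8 : W * (η' * N) ≤ W * W := by linarith
        have h9 := le_of_mul_le_mul_left h8 hWpos
        have : 0 < η' * N := by positivity
        linarith
      rwa [eq_zero_of_edgeWeight h5] at hm1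
    | flip s e c' he _ ih =>
      rintro c rfl ⟨c₀, h0, hW0⟩ hS
      obtain ⟨⟨v, hv⟩, hlt⟩ := he
      obtain ⟨m, hm1, hm2⟩ := exists_isMinimal (a := a) (b := b) (HA := HA) (HB := HB) c
      have hWm : (edgeWeight m : ℝ) ≤ η' * N :=
        le_trans (by exact_mod_cast hm2 c₀ (hm1.symm.trans h0)) hW0
      have h3 := hmain m hm2 hWm (by rwa [hm1.cobdryOne_eq])
      obtain ⟨e', he1, he2⟩ := hv.exists_sameClass_weight_le h2.le hA hB hrob
      have hlt' : (hammingNorm (cobdryOne a b HA HB c + cobdryOne a b HA HB e) : ℝ) <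
          hammingNorm (cobdryOne a b HA HB c) := by exact_mod_cast hlt
      have h4 : (hammingNorm (cobdryOne a b HA HB e) : ℝ) ≤ 2 * (n * κ * N) := by
        have h5 : hammingNorm (cobdryOne a b HA HB e) ≤
            hammingNorm (cobdryOne a b HA HB c + cobdryOne a b HA HB e) +
              hammingNorm (cobdryOne a b HA HB c) := by
          have := hammingDist_triangle (cobdryOne a b HA HB c + cobdryOne a b HA HB e)
            0 (cobdryOne a b HA HB c)
          rw [hammingDist_zero_right, hammingDist_zero_left, hammingDist_eq_hammingNorm] at this
          have hneg : -cobdryOne a b HA HB e = cobdryOne a b HA HB e :=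
            neg_eq_of_add_eq_zero_left (add_self_zmodTwo _)
          simpa [hneg] using this
        have h6 : (hammingNorm (cobdryOne a b HA HB e) : ℝ) ≤
            hammingNorm (cobdryOne a b HA HB c + cobdryOne a b HA HB e) +
              hammingNorm (cobdryOne a b HA HB c) := by exact_mod_cast h5
        linarith
      have h5 : d₂ * (8 * edgeWeight e') ≤ d₂ * (η' * N) := by
        have := mul_le_mul_of_nonneg_right hstep hN.le
        linarith
      have h6 := le_of_mul_le_mul_left h5 h2
      -- The new residual error `c + e` is represented by `m + e'`, of weight at most `(2/3 + 1/8)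
      -- η' N`.
      have h7 : SameClass a b HA HB (c + e) c' := by
        refine ih (c + e) (cobdryOne_add a b HA HB c e).symm
          ⟨m + e', hm1.add he1, ?_⟩ (hlt'.le.trans hS)
        have h8 : (edgeWeight (m + e') : ℝ) ≤ edgeWeight m + edgeWeight e' := by
          exact_mod_cast edgeWeight_add_le m e'
        have : 0 < η' * N := by positivity
        linarith
      have h8 := h7.add (SameClass.refl (a := a) (b := b) (HA := HA) (HB := HB) e)
      rwa [add_assoc, add_self_zmodTwo, add_zero, add_comm c' e] at h8
  refine hloop _ _ hrun c rfl ⟨c, SameClass.refl c, hw.trans ?_⟩ ?_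
  · refine mul_le_mul_of_nonneg_right ?_ hN.le
    -- The initial error obeys the invariant: `16 d₂ κ ≤ 16 n κ ≤ d₂ η'`, hence `κ ≤ η'`.
    have h3 : d₂ * κ ≤ n * κ := mul_le_mul_of_nonneg_right hd2 hκ0
    have h4 : d₂ * (16 * κ) ≤ d₂ * η' := by linarith
    have h5 := le_of_mul_le_mul_left h4 h2
    linarith
  · refine (hammingNorm_cobdryOne_le c).trans ?_
    rw [mul_assoc]
    exact mul_le_mul_of_nonneg_left hw hn'.le

end Run

/-! ### A program logic with running times for the word RAM. -/

section Programs

/-- Started in memory `s`, the program `P` halts after at most `T` steps in a memory which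
satisfies `Q`, writing only numbers which are at most `W`. -/
def Runs (W T : ℕ) (P : Prog) (s : Mem) (Q : Mem → Prop) : Prop :=
  ∃ t ≤ T, ∃ s', Exec W P s t s' ∧ Q s'

variable {W T T' : ℕ} {p q : Prog} {s : Mem} {Q Q' : Mem → Prop}

theorem Runs.imp (h : Runs W T p s Q) (hT : T ≤ T') (hQ : ∀ m, Q m → Q' m) :
    Runs W T' p s Q' := by
  obtain ⟨t, ht, s', he, hq⟩ := h
  exact ⟨t, ht.trans hT, s', he, hQ s' hq⟩

theorem Runs.seq (h : Runs W T p s fun m => Runs W T' q m Q) : Runs W (T + T') (.seq p q) s Q := by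
  obtain ⟨t, ht, s', he, t', ht', s'', he', hq⟩ := h
  exact ⟨t + t', add_le_add ht ht', s'', .seq _ _ _ _ _ _ _ he he', hq⟩

theorem Runs.branch {x y : ℕ} (h : s.reg x < s.reg y → Runs W T p s Q)
    (h' : ¬ s.reg x < s.reg y → Runs W T q s Q) : Runs W (T + 1) (.branch x y p q) s Q := by
  by_cases hxy : s.reg x < s.reg y
  · obtain ⟨t, ht, s', he, hq⟩ := h hxy
    exact ⟨t + 1, Nat.succ_le_succ ht, s', .branchTrue _ _ _ _ _ _ _ hxy he, hq⟩
  · obtain ⟨t, ht, s', he, hq⟩ := h' hxy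
    exact ⟨t + 1, Nat.succ_le_succ ht, s', .branchFalse _ _ _ _ _ _ _ hxy he, hq⟩

/-- A loop whose invariant `I k` is indexed by a bound `k` on the number of remaining rounds. -/
theorem Runs.loop {x y : ℕ} {I : ℕ → Mem → Prop}
    (hstep : ∀ k m, I k m → m.reg x < m.reg y → Runs W T p m fun m' => ∃ k' < k, I k' m')
    (k : ℕ) (h : I k s) :
    Runs W (k * (T + 1) + 1) (.loop x y p) s fun m => (∃ k', I k' m) ∧ ¬ m.reg x < m.reg y := by
  induction k using Nat.strong_induction_on generalizing s with
  | _ k ih =>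
    by_cases hxy : s.reg x < s.reg y
    · obtain ⟨t, ht, s', he, k', hk', hI⟩ := hstep k s h hxy
      obtain ⟨t', ht', s'', he', hq⟩ := ih k' hk' hI
      refine ⟨t + t' + 1, ?_, s'', .loopStep _ _ _ _ _ _ _ _ hxy he he', hq⟩
      have : (k' + 1) * (T + 1) ≤ k * (T + 1) := Nat.mul_le_mul_right _ hk'
      rw [Nat.add_mul, one_mul] at this
      omega
    · exact ⟨1, by omega, s, .loopDone _ _ _ _ hxy, ⟨k, h⟩, hxy⟩

/-- The program which does nothing. -/
def nop : Prog := .loop 0 0 (.const 0 0)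

theorem Runs.nop (h : Q s) : Runs W 1 nop s Q :=
  ⟨1, le_rfl, s, .loopDone _ _ _ _ (lt_irrefl _), h⟩

/-- Sequential composition of a list of programs. -/
def block (l : List Prog) : Prog := l.foldr .seq nop

/-- The body `P x` unrolled for all `x` in a list. -/
def forEach {α : Type*} (l : List α) (P : α → Prog) : Prog := block (l.map P)

theorem Runs.forEach {α : Type*} {l : List α} {P : α → Prog} (I : List α → Mem → Prop)
    (hstep : ∀ pre x m, pre ++ [x] <+: l → I pre m → Runs W T (P x) m (I (pre ++ [x]))) (h : I [] s) :
    Runs W (l.length * T + 1) (forEach l P) s (I l) := by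
  have key : ∀ (post pre : List α) (m : Mem), pre ++ post = l → I pre m →
      Runs W (post.length * T + 1) (CoDec.forEach post P) m (I (pre ++ post)) := by
    intro post
    induction post with
    | nil =>
      intro pre m _ hm
      refine (Runs.nop (W := W) hm).imp (by simp) fun m hm => ?_
      simpa using hm
    | cons x post ih =>
      intro pre m hmem hm
      have h1 := Runs.seq ((hstep pre x m ⟨post, by simpa using hmem⟩ hm).imp le_rfl fun m' hm' =>
        ih (pre ++ [x]) m' (by simpa using hmem) hm')
      refine h1.imp (by simp only [List.length_cons]; ring_nf; omega) fun m' hm' => ?_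
      simpa using hm'
  simpa using key l [] s rfl h

/-- Weakest preconditions of straight-line programs. -/
def wp (W : ℕ) : List Prog → Mem → (Mem → Prop) → Prop
  | [], m, Q => Q m
  | .const r v :: l, m, Q => v ≤ W ∧ wp W l (m.setReg r v) Q
  | .add r x y :: l, m, Q =>
      m.reg x + m.reg y ≤ W ∧ wp W l (m.setReg r (m.reg x + m.reg y)) Q
  | .sub r x y :: l, m, Q =>
      m.reg x - m.reg y ≤ W ∧ wp W l (m.setReg r (m.reg x - m.reg y)) Q
  | .mul r x y :: l, m, Q =>
      m.reg x * m.reg y ≤ W ∧ wp W l (m.setReg r (m.reg x * m.reg y)) Q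
  | .load r k x :: l, m, Q =>
      m.arr k (m.reg x) ≤ W ∧ wp W l (m.setReg r (m.arr k (m.reg x))) Q
  | .store k x y :: l, m, Q =>
      m.reg y ≤ W ∧ wp W l (m.setArr k (m.reg x) (m.reg y)) Q
  | _ :: _, _, _ => False

/-- Each instruction takes one step; the extra step is the `nop` which ends a block. -/
theorem Runs.of_wp : ∀ {l : List Prog} {s : Mem}, wp W l s Q → Runs W (l.length + 1) (block l) s Q
  | [], _, h => Runs.nop h
  | .const _ _ :: _, _, h => (Runs.seq ⟨1, le_rfl, _, .const _ _ _ h.1, Runs.of_wp h.2⟩).imp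
      (by simp only [List.length_cons]; omega) fun _ h => h
  | .add _ _ _ :: _, _, h => (Runs.seq ⟨1, le_rfl, _, .add _ _ _ _ h.1, Runs.of_wp h.2⟩).imp
      (by simp only [List.length_cons]; omega) fun _ h => h
  | .sub _ _ _ :: _, _, h => (Runs.seq ⟨1, le_rfl, _, .sub _ _ _ _ h.1, Runs.of_wp h.2⟩).imp
      (by simp only [List.length_cons]; omega) fun _ h => h
  | .mul _ _ _ :: _, _, h => (Runs.seq ⟨1, le_rfl, _, .mul _ _ _ _ h.1, Runs.of_wp h.2⟩).imp
      (by simp only [List.length_cons]; omega) fun _ h => h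
  | .load _ _ _ :: _, _, h => (Runs.seq ⟨1, le_rfl, _, .load _ _ _ _ h.1, Runs.of_wp h.2⟩).imp
      (by simp only [List.length_cons]; omega) fun _ h => h
  | .store _ _ _ :: _, _, h => (Runs.seq ⟨1, le_rfl, _, .store _ _ _ _ h.1, Runs.of_wp h.2⟩).imp
      (by simp only [List.length_cons]; omega) fun _ h => h

@[simp] theorem Mem.setReg_arr (m : Mem) (r v : ℕ) : (m.setReg r v).arr = m.arr := rfl

@[simp] theorem Mem.setArr_reg (m : Mem) (k p v : ℕ) : (m.setArr k p v).reg = m.reg := rfl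

theorem Mem.setReg_reg (m : Mem) (r v r' : ℕ) :
    (m.setReg r v).reg r' = if r' = r then v else m.reg r' := by
  simp [Mem.setReg, Function.update_apply]

theorem Mem.setArr_arr (m : Mem) (k p v k' : ℕ) :
    (m.setArr k p v).arr k' = if k' = k then Function.update (m.arr k) p v else m.arr k' := by
  simp [Mem.setArr, Function.update_apply]

end Programs

/-! ### Mixed-radix numbers of vertices, edges and faces. -/

section Numbering

variable {G : Type*} [Fintype G] {n : ℕ} (num : G ≃ Fin (Fintype.card G))

/-- Uniqueness of quotient and remainder; it makes the array positions below injective. -/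
theorem mul_add_inj {n x x' i i' : ℕ} (hi : i < n) (hi' : i' < n) (h : x * n + i = x' * n + i') :
    x = x' ∧ i = i' := by
  have h1 : (x * n + i) / n = x := by
    rw [mul_comm, Nat.mul_add_div (by omega), Nat.div_eq_of_lt hi, add_zero]
  have h2 : (x' * n + i') / n = x' := by
    rw [mul_comm, Nat.mul_add_div (by omega), Nat.div_eq_of_lt hi', add_zero]
  have h3 : x = x' := by rw [← h1, h, h2]
  subst h3
  exact ⟨rfl, by omega⟩

theorem mul_add_lt {n x i N : ℕ} (hx : x < N) (hi : i < n) : x * n + i < N * n := by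
  have : (x + 1) * n ≤ N * n := Nat.mul_le_mul_right _ hx
  rw [Nat.add_mul, one_mul] at this
  omega

/-- The number of a vertex. -/
def vertNum (v : Vert G) : ℕ :=
  (2 * v.1.toNat + v.2.1.toNat) * Fintype.card G + num v.2.2

/-- The number of a face. -/
def faceNum (f : Face G n) : ℕ := (num f.1 * n + f.2.1) * n + f.2.2

/-- The number of an edge, among the horizontal or among the vertical ones. -/
def edgeNum (e : Bool × G × Fin n) : ℕ := (e.1.toNat * Fintype.card G + num e.2.1) * n + e.2.2

theorem vertNum_lt (v : Vert G) : vertNum num v < 4 * Fintype.card G := by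
  refine mul_add_lt ?_ (num v.2.2).isLt
  rcases v with ⟨_ | _, _ | _, g⟩ <;> simp

theorem faceNum_lt (f : Face G n) : faceNum num f < Fintype.card G * n * n :=
  mul_add_lt (mul_add_lt (num f.1).isLt f.2.1.isLt) f.2.2.isLt

theorem edgeNum_lt (e : Bool × G × Fin n) : edgeNum num e < 2 * Fintype.card G * n := by
  refine mul_add_lt (mul_add_lt ?_ (num e.2.1).isLt) e.2.2.isLt
  rcases e with ⟨_ | _, g, i⟩ <;> simp

theorem vertNum_injective : Function.Injective (vertNum num) := by
  rintro ⟨p, q, g⟩ ⟨p', q', g'⟩ h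
  obtain ⟨h1, h2⟩ := mul_add_inj (num g).isLt (num g').isLt h
  obtain rfl : g = g' := num.injective (Fin.ext h2)
  rcases p with _ | _ <;> rcases q with _ | _ <;> rcases p' with _ | _ <;>
    rcases q' with _ | _ <;> simp at h1 ⊢

theorem faceNum_injective : Function.Injective (faceNum num (n := n)) := by
  rintro ⟨g, i, j⟩ ⟨g', i', j'⟩ h
  obtain ⟨h1, h2⟩ := mul_add_inj j.isLt j'.isLt h
  obtain ⟨h3, h4⟩ := mul_add_inj i.isLt i'.isLt h1
  obtain rfl : g = g' := num.injective (Fin.ext h3)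
  obtain rfl : i = i' := Fin.ext h4
  obtain rfl : j = j' := Fin.ext h2
  rfl

theorem edgeNum_injective : Function.Injective (edgeNum num (n := n)) := by
  rintro ⟨p, g, j⟩ ⟨p', g', j'⟩ h
  obtain ⟨h1, h2⟩ := mul_add_inj j.isLt j'.isLt h
  obtain ⟨h3, h4⟩ := mul_add_inj (num g).isLt (num g').isLt h1
  obtain rfl : g = g' := num.injective (Fin.ext h4)
  obtain rfl : j = j' := Fin.ext h2
  rcases p with _ | _ <;> rcases p' with _ | _ <;> simp at h3 ⊢

/-- The vertex numbers fill an initial segment, so filling the queue with consecutive integers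
enters every vertex. -/
theorem exists_vertNum {x : ℕ} (hx : x < 4 * Fintype.card G) : ∃ v, vertNum num v = x := by
  have hN : 0 < Fintype.card G := by omega
  have hd : x / Fintype.card G < 4 := Nat.div_lt_of_lt_mul (by rwa [mul_comm])
  have hm := Nat.mod_lt x hN
  have he : x / Fintype.card G * Fintype.card G + x % Fintype.card G = x := Nat.div_add_mod' _ _
  obtain ⟨p, q, hpq⟩ : ∃ p q : Bool, 2 * p.toNat + q.toNat = x / Fintype.card G := by
    generalize x / Fintype.card G = y at hd
    interval_cases y
    · exact ⟨false, false, rfl⟩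
    · exact ⟨false, true, rfl⟩
    · exact ⟨true, false, rfl⟩
    · exact ⟨true, true, rfl⟩
  refine ⟨(p, q, num.symm ⟨x % Fintype.card G, hm⟩), ?_⟩
  simp [vertNum, hpq, he]

end Numbering

/-! ### Lookup tables for the incidences of vertices, edges and faces. -/

section Tables

variable {G : Type*} [Group G] [Fintype G] {n : ℕ}

/-- The lookup tables agree with the complex for the faces at vertices listed in `S`. -/
structure TablesOn (a b : Fin n → G) (num : G ≃ Fin (Fintype.card G))
    (S : Set (Vert G × Fin n × Fin n)) (arr : ℕ → ℕ → ℕ) : Prop where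
  face : ∀ v i j, (v, i, j) ∈ S →
    arr 6 ((vertNum num v * n + i) * n + j) = faceNum num (faceAt a b v i j)
  horizontal : ∀ v i j, (v, i, j) ∈ S → arr 7 (vertNum num v * n + j) = edgeNum num (edgeH b v j)
  vertical : ∀ v i j, (v, i, j) ∈ S → arr 8 (vertNum num v * n + i) = edgeNum num (edgeV a v i)
  vertex : ∀ v i j, (v, i, j) ∈ S →
    arr 9 (faceNum num (faceAt a b v i j) * 4 + (2 * v.1.toNat + v.2.1.toNat)) = vertNum num v

/-- Cells may be written repeatedly, as an edge belongs to several faces. This is harmless because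
the position of a cell determines its correct content. -/
theorem TablesOn.insert {a b : Fin n → G} {num : G ≃ Fin (Fintype.card G)}
    {S : Set (Vert G × Fin n × Fin n)} {arr arr' : ℕ → ℕ → ℕ} (h : TablesOn a b num S arr)
    (v : Vert G) (i j : Fin n)
    (h6 : arr' 6 = Function.update (arr 6) ((vertNum num v * n + i) * n + j)
      (faceNum num (faceAt a b v i j)))
    (h7 : arr' 7 = Function.update (arr 7) (vertNum num v * n + j) (edgeNum num (edgeH b v j)))
    (h8 : arr' 8 = Function.update (arr 8) (vertNum num v * n + i) (edgeNum num (edgeV a v i)))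
    (h9 : arr' 9 = Function.update (arr 9)
      (faceNum num (faceAt a b v i j) * 4 + (2 * v.1.toNat + v.2.1.toNat)) (vertNum num v)) :
    TablesOn a b num (insert (v, i, j) S) arr' := by
  have inv : ∀ u : Vert G, 2 * u.1.toNat + u.2.1.toNat < 4 := by
    rintro ⟨_ | _, _ | _, g⟩ <;> simp
  refine ⟨fun u i' j' hu => ?_, fun u i' j' hu => ?_, fun u i' j' hu => ?_, fun u i' j' hu => ?_⟩
  · rw [h6, Function.update_apply]
    split_ifs with he
    · obtain ⟨e1, e2⟩ := mul_add_inj j'.isLt j.isLt he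
      obtain ⟨e3, e4⟩ := mul_add_inj i'.isLt i.isLt e1
      rw [vertNum_injective num e3, Fin.ext e4, Fin.ext e2]
    · exact h.face u i' j' (hu.resolve_left fun h0 => he (by cases h0; rfl))
  · rw [h7, Function.update_apply]
    split_ifs with he
    · obtain ⟨e1, e2⟩ := mul_add_inj j'.isLt j.isLt he
      rw [vertNum_injective num e1, Fin.ext e2]
    · exact h.horizontal u i' j' (hu.resolve_left fun h0 => he (by cases h0; rfl))
  · rw [h8, Function.update_apply]
    split_ifs with he
    · obtain ⟨e1, e2⟩ := mul_add_inj i'.isLt i.isLt he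
      rw [vertNum_injective num e1, Fin.ext e2]
    · exact h.vertical u i' j' (hu.resolve_left fun h0 => he (by cases h0; rfl))
  · rw [h9, Function.update_apply]
    split_ifs with he
    · obtain ⟨e1, e2⟩ := mul_add_inj (inv u) (inv v) he
      have e3 := faceNum_injective num e1
      have e4 : i' = i := congrArg (fun f => f.2.1) e3
      have e5 : j' = j := congrArg (fun f => f.2.2) e3
      subst e4 e5
      have hp : u.1 = v.1 ∧ u.2.1 = v.2.1 := by
        rcases u with ⟨_ | _, _ | _, g⟩ <;> rcases v with ⟨_ | _, _ | _, g'⟩ <;> simp at e2 ⊢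
      -- A face has only one corner in each layer.
      rw [← corner_faceAt a b v i' j', ← e3, ← hp.1, ← hp.2, corner_faceAt]
    · exact h.vertex u i' j' (hu.resolve_left fun h0 => he (by cases h0; rfl))

/-- Enters the data of one corner of a face into the tables. The registers `x`, `h`, `w` hold the
element of `G`, the horizontal and the vertical edge at the corner. -/
def cornerBlock (x h w : ℕ) (p q : Bool) : List Prog :=
  [.const 20 (2 * p.toNat + q.toNat), .mul 21 20 0, .add 21 21 x,
    .const 22 4, .mul 22 19 22, .add 22 22 20, .store 9 22 21,
    .mul 22 21 10, .add 23 22 11, .store 8 23 w, .add 22 22 12, .store 7 22 h,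
    .mul 23 23 10, .add 23 23 12, .store 6 23 19]

/-- Room for the numbers which occur in the construction of the tables. -/
structure Room (W N n : ℕ) : Prop where
  four : 4 ≤ W
  dir : n ≤ W
  vert : 4 * N ≤ W
  edge : 4 * N * n ≤ W
  face : 4 * N * n * n ≤ W

variable {a b : Fin n → G} {num : G ≃ Fin (Fintype.card G)} {W : ℕ}

/-- The temporaries are registers `20` to `23`, so the data of the face, kept in registers below
`20`, survive all four corners. -/
theorem wp_cornerBlock (hW : Room W (Fintype.card G) n) {S : Set (Vert G × Fin n × Fin n)}
    {m : Mem} (hm : TablesOn a b num S m.arr) {x h w : ℕ} (hx : x < 20) (hh : h < 20)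
    (hw : w < 20) (v : Vert G) (i j : Fin n) (m0 : m.reg 0 = Fintype.card G) (m10 : m.reg 10 = n)
    (m11 : m.reg 11 = i) (m12 : m.reg 12 = j)
    (m19 : m.reg 19 = faceNum num (faceAt a b v i j)) (mx : m.reg x = num v.2.2)
    (mh : m.reg h = edgeNum num (edgeH b v j)) (mw : m.reg w = edgeNum num (edgeV a v i)) :
    wp W (cornerBlock x h w v.1 v.2.1) m fun m' => (∀ r < 20, m'.reg r = m.reg r) ∧
      (∀ k < 6, m'.arr k = m.arr k) ∧ TablesOn a b num (insert (v, i, j) S) m'.arr := by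
  have hx' : x ≠ 20 ∧ x ≠ 21 := by omega
  have hh' : h ≠ 20 ∧ h ≠ 21 ∧ h ≠ 22 ∧ h ≠ 23 := by omega
  have hw' : w ≠ 20 ∧ w ≠ 21 ∧ w ≠ 22 ∧ w ≠ 23 := by omega
  have c4 : 2 * v.1.toNat + v.2.1.toNat < 4 := by rcases v with ⟨_ | _, _ | _, g⟩ <;> simp
  have b1 := vertNum_lt num v
  have b2 := faceNum_lt num (faceAt a b v i j)
  have b3 := edgeNum_lt num (edgeH b v j)
  have b4 := edgeNum_lt num (edgeV a v i)
  have b5 := mul_add_lt b1 i.isLt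
  have b6 := mul_add_lt b1 j.isLt
  have b7 := mul_add_lt b5 j.isLt
  have b8 := mul_add_lt b2 c4
  have b9 : Fintype.card G * n * n * 4 = 4 * Fintype.card G * n * n := by ring
  have b10 : 2 * Fintype.card G * n ≤ 4 * Fintype.card G * n :=
    Nat.mul_le_mul_right _ (Nat.mul_le_mul_right _ (by norm_num))
  have b11 := (num v.2.2).isLt
  obtain ⟨r4, -, rv, re, rf⟩ := hW
  have hv : (2 * v.1.toNat + v.2.1.toNat) * Fintype.card G + (num v.2.2 : ℕ) = vertNum num v := rfl
  simp [cornerBlock, wp, Mem.setReg_reg, Mem.setArr_arr, hx', hh', hw', m0, m10, m11, m12, m19,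
    mx, mh, mw, hv]
  refine ⟨by omega, by omega, by omega, by omega, by omega, by omega, by omega, by omega, by omega,
    by omega, by omega, by omega, by omega, by omega, by omega, fun r hr => ?_, fun k hk => ?_,
    hm.insert v i j ?_ ?_ ?_ ?_⟩
  · have : r ≠ 20 ∧ r ≠ 21 ∧ r ≠ 22 ∧ r ≠ 23 := by omega
    simp [this]
  · have : k ≠ 6 ∧ k ≠ 7 ∧ k ≠ 8 ∧ k ≠ 9 := by omega
    simp [this]
  all_goals simp [Mem.setArr_arr]

/-- Computes, for the element in register `2`, the numbers which belong to the face in directions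
`i`, `j`. -/
def faceBlock (n i j : ℕ) : List Prog :=
  [.const 10 n, .const 11 i, .const 12 j, .mul 13 2 10, .add 14 13 11, .load 15 0 14,
    .add 16 13 12, .load 17 1 16, .mul 18 15 10, .add 18 18 12, .load 18 1 18, .mul 19 14 10,
    .add 19 19 12, .add 4 0 15, .mul 4 4 10, .add 4 4 12, .add 5 0 17, .mul 5 5 10, .add 5 5 11]

/-- The register which holds the element of `G` at the corner `(p, q)`. -/
def elemReg : Bool → Bool → ℕ
  | false, false => 2
  | true, false => 15
  | false, true => 17
  | true, true => 18

/-- The four corners of a face. -/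
def corners : List (Bool × Bool) := [(false, false), (false, true), (true, false), (true, true)]

/-- Enters the data of the face in directions `i`, `j` at the element in register `2`. -/
def faceBody (n i j : ℕ) : Prog :=
  .seq (block (faceBlock n i j)) (forEach corners fun x =>
    block (cornerBlock (elemReg x.1 x.2) (if x.1 then 4 else 16) (if x.2 then 5 else 14) x.1 x.2))

/-- The state while the tables are under construction: the elements below `γ` are done, and so
are the faces listed in `S`. -/
structure TableState (a b : Fin n → G) (num : G ≃ Fin (Fintype.card G)) (A : ℕ → ℕ → ℕ) (γ : ℕ)
    (S : Set (Vert G × Fin n × Fin n)) (m : Mem) : Prop where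
  card : m.reg 0 = Fintype.card G
  one : m.reg 1 = 1
  count : m.reg 2 = γ
  tail : m.reg 3 = 4 * Fintype.card G
  keep : ∀ k < 6, m.arr k = A k
  tables : TablesOn a b num S m.arr

/-- The input tables contain products but no inverses. From the base element `g` all corners and
edges of the face are reached by products, and the results are stored under each corner, so inverses
never have to be looked up. -/
theorem runs_faceBody (hW : Room W (Fintype.card G) n) {A : ℕ → ℕ → ℕ}
    (hA0 : ∀ g (i : Fin n), A 0 (num g * n + i) = num (a i * g))
    (hA1 : ∀ g (j : Fin n), A 1 (num g * n + j) = num (g * b j)) {S : Set (Vert G × Fin n × Fin n)}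
    {m : Mem} (g : G) (hm : TableState a b num A (num g) S m) (i j : Fin n) :
    Runs W 100 (faceBody n i j) m
      (TableState a b num A (num g) (S ∪ {x | faceAt a b x.1 x.2.1 x.2.2 = (g, i, j)})) := by
  have hstart : wp W (faceBlock n i j) m fun m' => TableState a b num A (num g) S m' ∧
      m'.reg 10 = n ∧ m'.reg 11 = i ∧ m'.reg 12 = j ∧
      m'.reg 14 = edgeNum num (false, g, i) ∧ m'.reg 15 = num (a i * g) ∧
      m'.reg 16 = edgeNum num (false, g, j) ∧ m'.reg 17 = num (g * b j) ∧
      m'.reg 18 = num (a i * g * b j) ∧ m'.reg 19 = faceNum num (g, i, j) ∧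
      m'.reg 4 = edgeNum num (true, a i * g, j) ∧ m'.reg 5 = edgeNum num (true, g * b j, i) := by
    obtain ⟨m0, m1, m2, m3, mk, mt⟩ := hm
    have b1 := edgeNum_lt num (false, g, i)
    have b2 := edgeNum_lt num (false, g, j)
    have b3 := edgeNum_lt num (true, a i * g, j)
    have b4 := edgeNum_lt num (true, g * b j, i)
    have b5 := faceNum_lt num (g, i, j)
    have e1 : (num g : ℕ) * n + i = edgeNum num (false, g, i) := by simp [edgeNum]
    have e2 : (num g : ℕ) * n + j = edgeNum num (false, g, j) := by simp [edgeNum]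
    have e3 : (Fintype.card G + (num (a i * g) : ℕ)) * n + j = edgeNum num (true, a i * g, j) := by
      simp [edgeNum]
    have e4 : (Fintype.card G + (num (g * b j) : ℕ)) * n + i = edgeNum num (true, g * b j, i) := by
      simp [edgeNum]
    have e5 : edgeNum num (false, g, i) * n + j = faceNum num (g, i, j) := by
      simp [edgeNum, faceNum]
    have f1 : A 0 (edgeNum num (false, g, i)) = num (a i * g) := e1 ▸ hA0 g i
    have f2 : A 1 (edgeNum num (false, g, j)) = num (g * b j) := e2 ▸ hA1 g j
    have b10 : 2 * Fintype.card G * n ≤ 4 * Fintype.card G * n :=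
      Nat.mul_le_mul_right _ (Nat.mul_le_mul_right _ (by norm_num))
    have b11 : Fintype.card G * n * n ≤ 4 * Fintype.card G * n * n :=
      Nat.mul_le_mul_right _ (Nat.mul_le_mul_right _ (by omega))
    have b12 : Fintype.card G * n ≤ 4 * Fintype.card G * n :=
      Nat.mul_le_mul_right _ (by omega)
    have b6 := (num (a i * g)).isLt
    have b7 := (num (g * b j)).isLt
    have b8 := (num (a i * g * b j)).isLt
    have b9 := mul_add_lt b6 j.isLt
    have hi := i.isLt
    have hj := j.isLt
    obtain ⟨r4, rd, rv, re, rf⟩ := hW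
    simp [faceBlock, wp, Mem.setReg_reg, m0, m2, mk, e1, e2, e3, e4, e5, f1, f2, hA1]
    refine ⟨by omega, by omega, by omega, by omega, by omega, by omega, by omega, by omega,
      by omega, by omega, by omega, by omega, by omega, by omega, by omega, by omega, by omega,
      by omega, by omega, ?_⟩
    exact ⟨by simp [Mem.setReg_reg, m0], by simp [Mem.setReg_reg, m1],
      by simp [Mem.setReg_reg, m2], by simp [Mem.setReg_reg, m3], mk, mt⟩
  refine (Runs.seq (T' := 4 * 16 + 1) ((Runs.of_wp hstart).imp le_rfl ?_)).imp
    (by simp [faceBlock]) fun m h => h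
  rintro m' ⟨hm', h10, h11, h12, h14, h15, h16, h17, h18, h19, h4, h5⟩
  have hfin := Runs.forEach (W := W) (T := 16) (l := corners)
    (P := fun x => block (cornerBlock (elemReg x.1 x.2) (if x.1 then 4 else 16)
      (if x.2 then 5 else 14) x.1 x.2))
    (I := fun pre m'' => (∀ r < 20, m''.reg r = m'.reg r) ∧ (∀ k < 6, m''.arr k = m'.arr k) ∧
      TablesOn a b num (S ∪ {x | ∃ y ∈ pre, x = (corner a b (g, i, j) y.1 y.2, i, j)}) m''.arr)
    (s := m') ?_ ⟨fun _ _ => rfl, fun _ _ => rfl, by simpa using hm'.tables⟩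
  · refine hfin.imp (by simp [corners]) ?_
    rintro m'' ⟨hr, hk, ht⟩
    refine ⟨by rw [hr 0 (by norm_num), hm'.card], by rw [hr 1 (by norm_num), hm'.one],
      by rw [hr 2 (by norm_num), hm'.count], by rw [hr 3 (by norm_num), hm'.tail],
      fun k hk' => by rw [hk k hk', hm'.keep k hk'], ?_⟩
    -- The triples `(v, i, j)` leading to this face are exactly its four corners.
    convert ht using 2
    ext ⟨v, i', j'⟩
    simp only [Set.mem_ofPred_eq]
    constructor
    · intro h
      obtain rfl : i' = i := congrArg (fun f => f.2.1) h
      obtain rfl : j' = j := congrArg (fun f => f.2.2) h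
      refine ⟨(v.1, v.2.1), ?_, ?_⟩
      · rcases v with ⟨_ | _, _ | _, _⟩ <;> simp [corners]
      · rw [← h, corner_faceAt]
    · rintro ⟨y, -, h⟩
      obtain ⟨rfl, rfl, rfl⟩ : v = corner a b (g, i, j) y.1 y.2 ∧ i' = i ∧ j' = j := by
        simpa using h
      exact faceAt_corner a b (g, i', j') y.1 y.2
  · rintro pre ⟨p, q⟩ m'' - ⟨hr, hk, ht⟩
    have hf : faceAt a b (corner a b (g, i, j) p q) i j = (g, i, j) :=
      faceAt_corner a b (g, i, j) p q
    have hc := wp_cornerBlock hW ht (x := elemReg p q) (h := if p then 4 else 16)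
      (w := if q then 5 else 14) (by rcases p with _ | _ <;> rcases q with _ | _ <;> simp [elemReg])
      (by split_ifs <;> norm_num) (by split_ifs <;> norm_num) (corner a b (g, i, j) p q) i j
      (by rw [hr 0 (by norm_num), hm'.card]) (by rw [hr 10 (by norm_num), h10])
      (by rw [hr 11 (by norm_num), h11]) (by rw [hr 12 (by norm_num), h12])
      (by rw [hr 19 (by norm_num), h19, hf])
      (by
        rcases p with _ | _ <;> rcases q with _ | _ <;>
          simp [elemReg, hr, corner, hm'.count, h15, h17, h18, mul_assoc])
      (by
        rcases p with _ | _ <;> rcases q with _ | _ <;>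
          simp [hr, corner, edgeH, h16, h4, mul_assoc])
      (by
        rcases p with _ | _ <;> rcases q with _ | _ <;>
          simp [hr, corner, edgeV, h14, h5])
    refine (Runs.of_wp hc).imp (by simp [cornerBlock]) ?_
    rintro m3 ⟨hr3, hk3, ht3⟩
    refine ⟨fun r h => (hr3 r h).trans (hr r h), fun k h => (hk3 k h).trans (hk k h), ?_⟩
    convert ht3 using 2
    ext x
    simp only [List.mem_append, List.mem_singleton, Set.mem_union, Set.mem_ofPred_eq,
      Set.mem_insert_iff, or_and_right, exists_or, exists_eq_left]
    rw [or_comm (a := x = _), or_assoc]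

end Tables

/-! ### The initial queue and the construction of the tables. -/

section Setup

variable {G : Type*} [Group G] [Fintype G] {n : ℕ} {a b : Fin n → G}
  {num : G ≃ Fin (Fintype.card G)} {W : ℕ}

/-- All pairs of directions. -/
noncomputable def directions (n : ℕ) : List (Fin n × Fin n) := Finset.univ.toList

theorem length_directions (n : ℕ) : (directions n).length = n * n := by
  simp [directions]

theorem mem_directions (x : Fin n × Fin n) : x ∈ directions n := by simp [directions]

/-- Puts the numbers of all vertices into the queue. -/
def fillQueue : Prog :=
  .seq (block [.const 1 1, .const 10 4, .mul 10 10 0])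
    (.loop 3 10 (block [.store 5 3 3, .add 3 3 1]))

/-- Computes the lookup tables. -/
noncomputable def buildTables (n : ℕ) : Prog :=
  .seq (.loop 2 0 (.seq (forEach (directions n) fun x => faceBody n x.1 x.2)
    (block [.add 2 2 1]))) (block [.const 2 0])

theorem runs_fillQueue (hW : Room W (Fintype.card G) n) {m : Mem}
    (m0 : m.reg 0 = Fintype.card G) (m2 : m.reg 2 = 0) (m3 : m.reg 3 = 0) :
    Runs W (16 * Fintype.card G + 5) fillQueue m fun m' =>
      m'.reg 0 = Fintype.card G ∧ m'.reg 1 = 1 ∧ m'.reg 2 = 0 ∧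
      m'.reg 3 = 4 * Fintype.card G ∧ (∀ k ≠ 5, m'.arr k = m.arr k) ∧
      ∀ x < 4 * Fintype.card G, m'.arr 5 x = x := by
  obtain ⟨r4, -, rv, -, -⟩ := hW
  have h1 : wp W [.const 1 1, .const 10 4, .mul 10 10 0] m fun m' =>
      m'.reg 0 = Fintype.card G ∧ m'.reg 1 = 1 ∧ m'.reg 2 = 0 ∧
      m'.reg 3 + 4 * Fintype.card G = 4 * Fintype.card G ∧ m'.reg 10 = 4 * Fintype.card G ∧
      (∀ k ≠ 5, m'.arr k = m.arr k) ∧ ∀ x < m'.reg 3, m'.arr 5 x = x := by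
    simp [wp, Mem.setReg_reg, m0, m2, m3]
    omega
  -- Register `3` is both the counter and the end of the queue; `k` is its distance from `4 |G|`.
  refine (Runs.seq ((Runs.of_wp h1).imp le_rfl fun m' hm' => Runs.loop (T := 3)
    (I := fun k m' => m'.reg 0 = Fintype.card G ∧ m'.reg 1 = 1 ∧ m'.reg 2 = 0 ∧
      m'.reg 3 + k = 4 * Fintype.card G ∧ m'.reg 10 = 4 * Fintype.card G ∧
      (∀ k ≠ 5, m'.arr k = m.arr k) ∧ ∀ x < m'.reg 3, m'.arr 5 x = x)
    ?_ (4 * Fintype.card G) hm')).imp ?_ ?_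
  · rintro k m' ⟨p0, p1, p2, p3, p10, pk, p5⟩ hlt
    refine (Runs.of_wp (l := [.store 5 3 3, .add 3 3 1]) (Q := fun m' => ∃ k' < k,
      m'.reg 0 = Fintype.card G ∧ m'.reg 1 = 1 ∧ m'.reg 2 = 0 ∧
      m'.reg 3 + k' = 4 * Fintype.card G ∧ m'.reg 10 = 4 * Fintype.card G ∧
      (∀ k ≠ 5, m'.arr k = m.arr k) ∧ ∀ x < m'.reg 3, m'.arr 5 x = x) ?_).imp (by simp)
      fun _ h => h
    simp only [wp, Mem.setReg_reg, Mem.setArr_reg, Mem.setReg_arr, Mem.setArr_arr, p1]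
    refine ⟨by omega, by omega, k - 1, by omega, ?_⟩
    refine ⟨by simp [p0], by simp, by simp [p2], by simp; omega, by simp [p10], ?_, ?_⟩
    · intro k hk
      rw [if_neg hk, pk k hk]
    · intro x hx
      simp only [if_true] at hx ⊢
      rw [Function.update_apply]
      split_ifs with h
      · exact h.symm
      · exact p5 x (by omega)
  · simp
    omega
  · rintro m' ⟨⟨k, p0, p1, p2, p3, p10, pk, p5⟩, hlt⟩
    have : m'.reg 3 = 4 * Fintype.card G := by omega
    exact ⟨p0, p1, p2, this, pk, this ▸ p5⟩

theorem runs_buildTables (hW : Room W (Fintype.card G) n) {A : ℕ → ℕ → ℕ}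
    (hA0 : ∀ g (i : Fin n), A 0 (num g * n + i) = num (a i * g))
    (hA1 : ∀ g (j : Fin n), A 1 (num g * n + j) = num (g * b j)) {m : Mem}
    (hm : TableState a b num A 0 ∅ m) :
    Runs W (Fintype.card G * (n * n * 100 + 4) + 3) (buildTables n) m
      (TableState a b num A 0 Set.univ) := by
  -- After `γ` rounds the finished entries are those of the faces whose base element has number
  -- below `γ`.
  have hloop := Runs.loop (W := W) (T := n * n * 100 + 3) (x := 2) (y := 0)
    (p := .seq (forEach (directions n) fun x => faceBody n x.1 x.2) (block [.add 2 2 1]))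
    (s := m) (I := fun k m => ∃ γ, γ + k = Fintype.card G ∧ TableState a b num A γ
      {x | (num (faceAt a b x.1 x.2.1 x.2.2).1 : ℕ) < γ} m) ?_ (Fintype.card G)
    ⟨0, by simp, by simpa using hm⟩
  -- Register `2`, the counter so far, is reset because it becomes the head of the queue.
  · refine (Runs.seq (hloop.imp le_rfl fun m' hm' => (Runs.of_wp (l := [.const 2 0])
      (Q := TableState a b num A 0 Set.univ) ?_))).imp (by simp) fun _ h => h
    obtain ⟨⟨k, γ, hγ, hs⟩, hlt⟩ := hm'
    rw [hs.count, hs.card] at hlt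
    obtain rfl : γ = Fintype.card G := by omega
    have hu : {x : Vert G × Fin n × Fin n | (num (faceAt a b x.1 x.2.1 x.2.2).1 : ℕ) <
        Fintype.card G} = Set.univ := Set.eq_univ_of_forall fun x => (num _).isLt
    rw [hu] at hs
    exact ⟨Nat.zero_le _, by simp [Mem.setReg_reg, hs.card], by simp [Mem.setReg_reg, hs.one],
      by simp [Mem.setReg_reg], by simp [Mem.setReg_reg, hs.tail], hs.keep, hs.tables⟩
  · rintro k m' ⟨γ, hγ, hs⟩ hlt
    rw [hs.count, hs.card] at hlt
    set g : G := num.symm ⟨γ, hlt⟩ with hg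
    have hgγ : (num g : ℕ) = γ := by simp [hg]
    set S : Set (Vert G × Fin n × Fin n) :=
      {x | (num (faceAt a b x.1 x.2.1 x.2.2).1 : ℕ) < γ} with hS
    have h1 := Runs.forEach (W := W) (T := 100) (l := directions n) (s := m')
      (P := fun x => faceBody n x.1 x.2)
      (I := fun pre m => TableState a b num A γ
        (S ∪ {x | ∃ y ∈ pre, faceAt a b x.1 x.2.1 x.2.2 = (g, y.1, y.2)}) m)
      (by
        intro pre y m'' _ hm''
        rw [← hgγ] at hm''
        refine (runs_faceBody hW hA0 hA1 g hm'' y.1 y.2).imp le_rfl fun m3 hm3 => ?_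
        rw [hgγ] at hm3
        convert hm3 using 1
        ext x
        simp only [List.mem_append, List.mem_singleton, Set.mem_union, Set.mem_ofPred_eq,
          or_and_right, exists_or, exists_eq_left, or_assoc])
      (by simpa using hs)
    refine (Runs.seq (h1.imp le_rfl fun m3 hm3 => Runs.of_wp (l := [.add 2 2 1])
      (Q := fun m => ∃ k' < k, ∃ γ, γ + k' = Fintype.card G ∧ TableState a b num A γ
        {x | (num (faceAt a b x.1 x.2.1 x.2.2).1 : ℕ) < γ} m) ?_)).imp ?_ fun _ h => h
    · have hr := hW.vert
      have hu : S ∪ {x | ∃ y ∈ directions n, faceAt a b x.1 x.2.1 x.2.2 = (g, y.1, y.2)} =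
          {x | (num (faceAt a b x.1 x.2.1 x.2.2).1 : ℕ) < γ + 1} := by
        ext x
        simp only [hS, Set.mem_union, Set.mem_ofPred_eq]
        rw [Nat.lt_succ_iff_lt_or_eq]
        refine or_congr Iff.rfl ⟨?_, fun h => ?_⟩
        · rintro ⟨y, -, h⟩
          rw [h, hgγ]
        · refine ⟨(x.2.1, x.2.2), mem_directions _, ?_⟩
          have : (faceAt a b x.1 x.2.1 x.2.2).1 = g := num.injective (Fin.ext (by rw [h, hgγ]))
          rw [← this]
          rfl
      rw [hu] at hm3
      simp only [wp, hm3.count, hm3.one]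
      refine ⟨by omega, k - 1, by omega, γ + 1, by omega, ?_⟩
      exact ⟨by simp [Mem.setReg_reg, hm3.card], by simp [Mem.setReg_reg, hm3.one],
        by simp [Mem.setReg_reg], by simp [Mem.setReg_reg, hm3.tail], hm3.keep, hm3.tables⟩
    · rw [length_directions]
      simp

end Setup

/-! ### The memory of the decoder and its elementary operations. -/

section DecoderState

variable {G : Type*} [Group G] [Fintype G] [DecidableEq G] {n ma mb : ℕ}

/-- The arrays hold the lookup tables, the syndrome `s` and the chain `c`. -/
structure Holds (a b : Fin n → G) (num : G ≃ Fin (Fintype.card G)) (s : Face G n → ZMod 2)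
    (c : XOne G n ma mb → ZMod 2) (arr : ℕ → ℕ → ℕ) : Prop where
  tables : TablesOn a b num Set.univ arr
  syndrome : ∀ f, arr 2 (faceNum num f) = (s f).val
  horizontal : ∀ e (k : Fin ma), arr 3 (edgeNum num e * ma + k) = (c (Sum.inl (e, k))).val
  vertical : ∀ e (k : Fin mb), arr 4 (edgeNum num e * mb + k) = (c (Sum.inr (e, k))).val

/-- The state of the decoder while it works on the vertex `v`: the queue `qs` starts at position
`hd`, the syndrome is `s`, the sum of the flips is `c`. -/
structure DecoderState (a b : Fin n → G) (num : G ≃ Fin (Fintype.card G)) (hd : ℕ)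
    (qs : List (Vert G)) (v : Vert G) (s : Face G n → ZMod 2) (c : XOne G n ma mb → ZMod 2)
    (m : Mem) : Prop where
  one : m.reg 1 = 1
  head : m.reg 2 = hd
  tail : m.reg 3 = hd + qs.length
  vert : m.reg 4 = vertNum num v
  data : Holds a b num s c m.arr
  queue : ∀ x (h : x < qs.length), m.arr 5 (hd + x) = vertNum num qs[x]

/-- Room for the numbers which occur in the decoder, `B` being a bound for the end of the queue. -/
structure DecoderRoom (W N n ma mb B : ℕ) : Prop extends Room W N n where
  counter : 2 * (n * n) ≤ W
  rowsA : ma ≤ W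
  rowsB : mb ≤ W
  horizontal : 2 * N * n * ma ≤ W
  vertical : 2 * N * n * mb ≤ W
  queue : B ≤ W

variable {a b : Fin n → G} {num : G ≃ Fin (Fintype.card G)} {W B hd : ℕ} {qs : List (Vert G)}
  {v : Vert G} {s : Face G n → ZMod 2} {c : XOne G n ma mb → ZMod 2} {m : Mem}

/-- The machine flips a bit `x` by computing `1 - x`. -/
theorem val_add_one (x : ZMod 2) : (x + 1).val = 1 - x.val := by revert x; decide

theorem val_le_one (x : ZMod 2) : x.val ≤ 1 := by revert x; decide

theorem add_single_one_apply {X : Type*} [DecidableEq X] (s : X → ZMod 2) (x y : X) :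
    ((s + Pi.single x 1 : X → ZMod 2) y).val = if y = x then 1 - (s x).val else (s y).val := by
  rw [Pi.add_apply, Pi.single_apply]
  split_ifs with h
  · rw [h, val_add_one]
  · rw [add_zero]

/-- Array `5` is the queue, which these data do not involve. -/
theorem Holds.congr {arr arr' : ℕ → ℕ → ℕ} (h : Holds a b num s c arr)
    (hk : ∀ k ≠ 5, arr' k = arr k) : Holds a b num s c arr' := by
  obtain ⟨⟨h6, h7, h8, h9⟩, h2, h3, h4⟩ := h
  refine ⟨⟨?_, ?_, ?_, ?_⟩, ?_, ?_, ?_⟩ <;> rw [hk _ (by norm_num)] <;> assumption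

theorem TablesOn.congr {S : Set (Vert G × Fin n × Fin n)} {arr arr' : ℕ → ℕ → ℕ}
    (h : TablesOn a b num S arr) (hk : ∀ k, 5 < k → arr' k = arr k) : TablesOn a b num S arr' := by
  obtain ⟨h6, h7, h8, h9⟩ := h
  refine ⟨?_, ?_, ?_, ?_⟩ <;> rw [hk _ (by norm_num)] <;> assumption

theorem Holds.flipFace {arr : ℕ → ℕ → ℕ} (h : Holds a b num s c arr) (f : Face G n) :
    Holds a b num (s + Pi.single f 1) c
      (Function.update arr 2 (Function.update (arr 2) (faceNum num f) (1 - (s f).val))) := by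
  refine ⟨h.tables.congr fun k hk => Function.update_of_ne (by omega) _ _, fun f' => ?_,
    by simpa using h.horizontal, by simpa using h.vertical⟩
  rw [add_single_one_apply, Function.update_self, Function.update_apply, h.syndrome]
  simp only [(faceNum_injective num).eq_iff]

theorem Holds.flipHorizontal {arr : ℕ → ℕ → ℕ} (h : Holds a b num s c arr) (e : HEdge G n)
    (k : Fin ma) :
    Holds a b num s (c + Pi.single (Sum.inl (e, k)) 1) (Function.update arr 3
      (Function.update (arr 3) (edgeNum num e * ma + k) (1 - (c (Sum.inl (e, k))).val))) := by
  refine ⟨h.tables.congr fun k hk => Function.update_of_ne (by omega) _ _,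
    by simpa using h.syndrome, fun e' k' => ?_, by simpa using h.vertical⟩
  rw [add_single_one_apply, Function.update_self, Function.update_apply, h.horizontal]
  refine if_congr ⟨fun he => ?_, ?_⟩ rfl rfl
  · obtain ⟨h1, h2⟩ := mul_add_inj k'.isLt k.isLt he
    rw [edgeNum_injective num h1, Fin.ext h2]
  · rintro h'
    cases h'
    rfl

theorem Holds.flipVertical {arr : ℕ → ℕ → ℕ} (h : Holds a b num s c arr) (e : VEdge G n)
    (k : Fin mb) :
    Holds a b num s (c + Pi.single (Sum.inr (e, k)) 1) (Function.update arr 4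
      (Function.update (arr 4) (edgeNum num e * mb + k) (1 - (c (Sum.inr (e, k))).val))) := by
  refine ⟨h.tables.congr fun k hk => Function.update_of_ne (by omega) _ _,
    by simpa using h.syndrome, by simpa using h.horizontal, fun e' k' => ?_⟩
  rw [add_single_one_apply, Function.update_self, Function.update_apply, h.vertical]
  refine if_congr ⟨fun he => ?_, ?_⟩ rfl rfl
  · obtain ⟨h1, h2⟩ := mul_add_inj k'.isLt k.isLt he
    rw [edgeNum_injective num h1, Fin.ext h2]
  · rintro h'
    cases h'
    rfl

/-- Loads the number of the face in directions `i`, `j` at the current vertex into register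
`11`. -/
def locateFace (n i j : ℕ) : List Prog :=
  [.const 10 n, .mul 11 4 10, .const 12 i, .add 11 11 12, .mul 11 11 10, .const 12 j,
    .add 11 11 12, .load 11 6 11]

/-- Adds the syndrome bit at the face in directions `i`, `j` to register `5`. -/
def countFace (n i j : ℕ) : Prog := block (locateFace n i j ++ [.load 12 2 11, .add 5 5 12])

/-- Flips the syndrome bit at the face in directions `i`, `j`. -/
def flipFace (n i j : ℕ) : Prog :=
  block (locateFace n i j ++ [.load 12 2 11, .sub 12 1 12, .store 2 11 12])

/-- Flips the bit `k` at the horizontal edge in direction `j`. -/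
def flipHorizontal (n ma j k : ℕ) : Prog :=
  block [.const 10 n, .mul 11 4 10, .const 12 j, .add 11 11 12, .load 11 7 11, .const 10 ma,
    .mul 11 11 10, .const 12 k, .add 11 11 12, .load 12 3 11, .sub 12 1 12, .store 3 11 12]

/-- Flips the bit `k` at the vertical edge in direction `i`. -/
def flipVertical (n mb i k : ℕ) : Prog :=
  block [.const 10 n, .mul 11 4 10, .const 12 i, .add 11 11 12, .load 11 8 11, .const 10 mb,
    .mul 11 11 10, .const 12 k, .add 11 11 12, .load 12 4 11, .sub 12 1 12, .store 4 11 12]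

/-- Appends the corner `(p, q)` of the face in directions `i`, `j` to the queue. -/
def pushCorner (n i j : ℕ) (p q : Bool) : Prog :=
  block (locateFace n i j ++ [.const 10 4, .mul 11 11 10, .const 12 (2 * p.toNat + q.toNat),
    .add 11 11 12, .load 11 9 11, .store 5 3 11, .add 3 3 1])

/-- Collects, once for all operations, the word bounds for the address arithmetic. -/
theorem locateFace_bounds (hW : Room W (Fintype.card G) n) (v : Vert G) (i j : Fin n) :
    n ≤ W ∧ vertNum num v * n ≤ W ∧ (i : ℕ) ≤ W ∧ vertNum num v * n + i ≤ W ∧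
      (vertNum num v * n + i) * n ≤ W ∧ (j : ℕ) ≤ W ∧ (vertNum num v * n + i) * n + j ≤ W ∧
      vertNum num v * n + j ≤ W ∧
      faceNum num (faceAt a b v i j) * 4 + 4 ≤ W := by
  have b1 := vertNum_lt num v
  have b2 := faceNum_lt num (faceAt a b v i j)
  have b5 := mul_add_lt b1 i.isLt
  have b6 := mul_add_lt b1 j.isLt
  have b7 := mul_add_lt b5 j.isLt
  have b9 : Fintype.card G * n * n * 4 = 4 * Fintype.card G * n * n := by ring
  have hi := i.isLt
  have hj := j.isLt
  obtain ⟨r4, rd, rv, re, rf⟩ := hW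
  exact ⟨by omega, by omega, by omega, by omega, by omega, by omega, by omega, by omega, by omega⟩

theorem runs_countFace (hW : Room W (Fintype.card G) n)
    (hm : DecoderState a b num hd qs v s c m) (i j : Fin n) (h5 : m.reg 5 + 1 ≤ W) :
    Runs W 11 (countFace n i j) m fun m' => DecoderState a b num hd qs v s c m' ∧
      m'.reg 5 = m.reg 5 + (s (faceAt a b v i j)).val := by
  obtain ⟨m1, m2, m3, m4, md, mq⟩ := hm
  obtain ⟨c1, c2, c3, c4, c5, c6, c7, -, c8⟩ := locateFace_bounds (a := a) (b := b) (num := num)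
    hW v i j
  have t1 := md.tables.face v i j trivial
  have t2 := md.syndrome (faceAt a b v i j)
  have t3 := val_le_one (s (faceAt a b v i j))
  refine Runs.of_wp (l := locateFace n i j ++ [.load 12 2 11, .add 5 5 12]) ?_
  simp [locateFace, wp, Mem.setReg_reg, m4, t1, t2]
  refine ⟨by omega, by omega, by omega, by omega, by omega, by omega, by omega, by omega,
    by omega, by omega, ?_⟩
  exact ⟨by simp [Mem.setReg_reg, m1], by simp [Mem.setReg_reg, m2],
    by simp [Mem.setReg_reg, m3], by simp [Mem.setReg_reg, m4], md, mq⟩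

theorem runs_flipFace (hW : Room W (Fintype.card G) n)
    (hm : DecoderState a b num hd qs v s c m) (i j : Fin n) :
    Runs W 12 (flipFace n i j) m
      (DecoderState a b num hd qs v (s + Pi.single (faceAt a b v i j) 1) c) := by
  obtain ⟨m1, m2, m3, m4, md, mq⟩ := hm
  obtain ⟨c1, c2, c3, c4, c5, c6, c7, -, c8⟩ := locateFace_bounds (a := a) (b := b) (num := num)
    hW v i j
  have t1 := md.tables.face v i j trivial
  have t2 := md.syndrome (faceAt a b v i j)
  have t3 := val_le_one (s (faceAt a b v i j))
  have r4 := hW.four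
  refine Runs.of_wp (l := locateFace n i j ++ [.load 12 2 11, .sub 12 1 12, .store 2 11 12]) ?_
  simp [locateFace, wp, Mem.setReg_reg, m1, m4, t1, t2]
  refine ⟨by omega, by omega, by omega, by omega, by omega, by omega, by omega, by omega,
    by omega, by omega, ?_⟩
  exact ⟨by simp [Mem.setReg_reg, m1], by simp [Mem.setReg_reg, m2],
    by simp [Mem.setReg_reg, m3], by simp [Mem.setReg_reg, m4], md.flipFace _,
    by simpa [Mem.setArr_arr] using mq⟩

theorem runs_flipHorizontal (hW : DecoderRoom W (Fintype.card G) n ma mb B)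
    (hm : DecoderState a b num hd qs v s c m) (j : Fin n) (k : Fin ma) :
    Runs W 13 (flipHorizontal n ma j k) m
      (DecoderState a b num hd qs v s (c + Pi.single (Sum.inl (edgeH b v j, k)) 1)) := by
  obtain ⟨m1, m2, m3, m4, md, mq⟩ := hm
  obtain ⟨c1, c2, c3, c4, c5, c6, c7, c8, -⟩ := locateFace_bounds (a := a) (b := b) (num := num)
    hW.toRoom v j j
  have t1 := md.tables.horizontal v j j trivial
  have t2 := md.horizontal (edgeH b v j) k
  have t3 := val_le_one (c (Sum.inl (edgeH b v j, k)))
  have t4 := mul_add_lt (edgeNum_lt num (edgeH b v j)) k.isLt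
  have t5 : edgeNum num (edgeH b v j) * 1 ≤ edgeNum num (edgeH b v j) * ma :=
    Nat.mul_le_mul_left _ (by have := k.isLt; omega)
  have t6 := k.isLt
  have r4 := hW.four
  have r5 := hW.horizontal
  have r6 := hW.rowsA
  refine Runs.of_wp (l := [.const 10 n, .mul 11 4 10, .const 12 j, .add 11 11 12, .load 11 7 11,
    .const 10 ma, .mul 11 11 10, .const 12 k, .add 11 11 12, .load 12 3 11, .sub 12 1 12,
    .store 3 11 12]) ?_
  simp [wp, Mem.setReg_reg, m1, m4, t1, t2]
  refine ⟨by omega, by omega, by omega, by omega, by omega, by omega, by omega, by omega,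
    by omega, by omega, by omega, ?_⟩
  exact ⟨by simp [Mem.setReg_reg, m1], by simp [Mem.setReg_reg, m2],
    by simp [Mem.setReg_reg, m3], by simp [Mem.setReg_reg, m4], md.flipHorizontal _ _,
    by simpa [Mem.setArr_arr] using mq⟩

theorem runs_flipVertical (hW : DecoderRoom W (Fintype.card G) n ma mb B)
    (hm : DecoderState a b num hd qs v s c m) (i : Fin n) (k : Fin mb) :
    Runs W 13 (flipVertical n mb i k) m
      (DecoderState a b num hd qs v s (c + Pi.single (Sum.inr (edgeV a v i, k)) 1)) := by
  obtain ⟨m1, m2, m3, m4, md, mq⟩ := hm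
  obtain ⟨c1, c2, c3, c4, c5, c6, c7, c8, -⟩ := locateFace_bounds (a := a) (b := b) (num := num)
    hW.toRoom v i i
  have t1 := md.tables.vertical v i i trivial
  have t2 := md.vertical (edgeV a v i) k
  have t3 := val_le_one (c (Sum.inr (edgeV a v i, k)))
  have t4 := mul_add_lt (edgeNum_lt num (edgeV a v i)) k.isLt
  have t5 : edgeNum num (edgeV a v i) * 1 ≤ edgeNum num (edgeV a v i) * mb :=
    Nat.mul_le_mul_left _ (by have := k.isLt; omega)
  have t6 := k.isLt
  have r4 := hW.four
  have r5 := hW.vertical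
  have r6 := hW.rowsB
  refine Runs.of_wp (l := [.const 10 n, .mul 11 4 10, .const 12 i, .add 11 11 12, .load 11 8 11,
    .const 10 mb, .mul 11 11 10, .const 12 k, .add 11 11 12, .load 12 4 11, .sub 12 1 12,
    .store 4 11 12]) ?_
  simp [wp, Mem.setReg_reg, m1, m4, t1, t2]
  refine ⟨by omega, by omega, by omega, by omega, by omega, by omega, by omega, by omega,
    by omega, by omega, by omega, ?_⟩
  exact ⟨by simp [Mem.setReg_reg, m1], by simp [Mem.setReg_reg, m2],
    by simp [Mem.setReg_reg, m3], by simp [Mem.setReg_reg, m4], md.flipVertical _ _,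
    by simpa [Mem.setArr_arr] using mq⟩

theorem runs_pushCorner (hW : Room W (Fintype.card G) n)
    (hm : DecoderState a b num hd qs v s c m) (i j : Fin n) (p q : Bool)
    (hq : hd + qs.length + 1 ≤ W) :
    Runs W 16 (pushCorner n i j p q) m
      (DecoderState a b num hd (qs ++ [corner a b (faceAt a b v i j) p q]) v s c) := by
  obtain ⟨m1, m2, m3, m4, md, mq⟩ := hm
  obtain ⟨c1, c2, c3, c4, c5, c6, c7, -, c8⟩ := locateFace_bounds (a := a) (b := b) (num := num)
    hW v i j
  have t1 := md.tables.face v i j trivial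
  -- The corner is found by two lookups: from the current vertex to the face, and from the face to
  -- its corner. The table entry is stated from the viewpoint of that corner, which sees the same
  -- face.
  have t2 := md.tables.vertex (corner a b (faceAt a b v i j) p q) i j trivial
  have hf : faceAt a b (corner a b (faceAt a b v i j) p q) i j = faceAt a b v i j :=
    faceAt_corner a b (faceAt a b v i j) p q
  have hp : (corner a b (faceAt a b v i j) p q).1 = p := rfl
  have hq' : (corner a b (faceAt a b v i j) p q).2.1 = q := rfl
  rw [hf, hp, hq'] at t2
  have t3 := vertNum_lt num (corner a b (faceAt a b v i j) p q)
  have t4 : 2 * p.toNat + q.toNat < 4 := by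
    rcases p with _ | _ <;> rcases q with _ | _ <;> simp
  have r4 := hW.four
  have r5 := hW.vert
  refine Runs.of_wp (l := locateFace n i j ++ [.const 10 4, .mul 11 11 10,
    .const 12 (2 * p.toNat + q.toNat), .add 11 11 12, .load 11 9 11, .store 5 3 11,
    .add 3 3 1]) ?_
  simp [locateFace, wp, Mem.setReg_reg, m1, m3, m4, t1, t2]
  refine ⟨by omega, by omega, by omega, by omega, by omega, by omega, by omega, by omega,
    by omega, by omega, by omega, by omega, by omega, by omega, ?_⟩
  refine ⟨by simp [Mem.setReg_reg, m1], by simp [Mem.setReg_reg, m2],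
    by simp [Mem.setReg_reg, add_assoc], by simp [Mem.setReg_reg, m4],
    md.congr fun k hk => by simp [Mem.setArr_arr, hk], fun x hx => ?_⟩
  simp only [Mem.setReg_arr, Mem.setArr_arr, if_true]
  rw [Function.update_apply]
  split_ifs with h
  · obtain rfl : x = qs.length := by omega
    simp
  · simp only [List.length_append, List.length_singleton] at hx
    rw [mq x (by omega), List.getElem_append_left]

end DecoderState

/-! ### Trying and applying one local chain. -/

section Candidates

variable {G : Type*} [Group G] [Fintype G] [DecidableEq G] {n ma mb : ℕ} (a b : Fin n → G)
  (HA : Matrix (Fin ma) (Fin n) (ZMod 2)) (HB : Matrix (Fin mb) (Fin n) (ZMod 2))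

/-- Writes the chain as a sum of unit vectors, which the program adds one bit at a time. -/
theorem embed_eq_sum (v : Vert G) (x : LocalChain n ma mb) :
    embed a b v x =
      ∑ y : Fin n × Fin ma, Pi.single (Sum.inl (edgeH b v y.1, y.2)) (x.1 y.1 y.2) +
      ∑ y : Fin n × Fin mb, Pi.single (Sum.inr (edgeV a v y.1, y.2)) (x.2 y.1 y.2) := by
  funext w
  rw [Pi.add_apply, Finset.sum_apply, Finset.sum_apply]
  rcases w with ⟨e, k⟩ | ⟨e, k⟩
  · rw [Finset.sum_eq_single (e.2.2, k), Finset.sum_eq_zero, add_zero]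
    · simp [embed, Pi.single_apply, eq_comm]
    · simp
    · rintro ⟨j, k'⟩ - h
      refine Pi.single_eq_of_ne (fun he => h ?_) _
      simp only [Sum.inl.injEq, Prod.mk.injEq] at he
      rw [he.2, he.1]
      rfl
    · simp
  · rw [Finset.sum_eq_single_of_mem (e.2.2, k) (Finset.mem_univ _), Finset.sum_eq_zero, zero_add]
    · simp [embed, Pi.single_apply, eq_comm]
    · simp
    · rintro ⟨j, k'⟩ - h
      refine Pi.single_eq_of_ne (fun he => h ?_) _
      simp only [Sum.inr.injEq, Prod.mk.injEq] at he
      rw [he.2, he.1]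
      rfl

theorem cobdryOne_embed_eq_sum (v : Vert G) (x : LocalChain n ma mb) :
    cobdryOne a b HA HB (embed a b v x) = ∑ y : Fin n × Fin n,
      Pi.single (faceAt a b v y.1 y.2) (localSyndrome HA HB x y.1 y.2) := by
  funext f
  rw [cobdryOne_embed, Finset.sum_apply,
    Finset.sum_eq_single_of_mem (f.2.1, f.2.2) (Finset.mem_univ _)]
  · simp [Pi.single_apply, eq_comm]
  · rintro ⟨i, j⟩ - h
    refine Pi.single_eq_of_ne (fun he => h ?_) _
    rw [he]
    rfl

/-- The vertices which share a face with `v`. -/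
noncomputable def neighbours (v : Vert G) : List (Vert G) :=
  (directions n ×ˢ corners).map fun y => corner a b (faceAt a b v y.1.1 y.1.2) y.2.1 y.2.2

/-- Repetitions in the list are kept; the exact length makes the account of the queue simple. -/
theorem length_neighbours (v : Vert G) : (neighbours a b v).length = 4 * (n * n) := by
  rw [neighbours, List.length_map, List.length_product, length_directions, mul_comm]
  rfl

theorem mem_neighbours {u v : Vert G} {i j : Fin n} (h : faceAt a b v i j = faceAt a b u i j) :
    u ∈ neighbours a b v := by
  refine List.mem_map.mpr ⟨((i, j), u.1, u.2.1), ?_, ?_⟩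
  · refine List.pair_mem_product.mpr ⟨mem_directions _, ?_⟩
    rcases u with ⟨_ | _, _ | _, g⟩ <;> simp [corners]
  · simp only [h, corner_faceAt]

/-- Locality: a flip at `v` does not touch the faces of vertices outside the list, so it creates no
new flips there. -/
theorem lowers_add_cobdryOne_embed_iff {u v : Vert G} (hu : u ∉ neighbours a b v)
    (s : Face G n → ZMod 2) (x y : LocalChain n ma mb) :
    Lowers a b HA HB (s + cobdryOne a b HA HB (embed a b v x)) u y ↔ Lowers a b HA HB s u y := by
  have h : ∀ i j, (s + cobdryOne a b HA HB (embed a b v x)) (faceAt a b u i j) =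
      s (faceAt a b u i j) := fun i j => by
    rw [Pi.add_apply, cobdryOne_embed, if_neg, add_zero]
    exact fun he => hu (mem_neighbours a b he)
  simp only [Lowers, h]

/-- Runs `P` if the bit `t` is set. -/
def ifBit (t : ZMod 2) (P : Prog) : Prog := if t = 0 then nop else P

/-- The number of faces at its vertex which a local chain flips. -/
def localWeight (x : LocalChain n ma mb) : ℕ := ∑ i, ∑ j, (localSyndrome HA HB x i j).val

/-- Adds the local chain `x` at the current vertex to the chain, updates the syndrome, and appends
the vertices which share a face with the current one to the queue. -/
noncomputable def applyFlip (x : LocalChain n ma mb) : Prog :=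
  .seq (forEach (directions n) fun y => ifBit (localSyndrome HA HB x y.1 y.2)
    (flipFace n y.1 y.2))
  (.seq (forEach Finset.univ.toList fun y : Fin n × Fin ma => ifBit (x.1 y.1 y.2)
    (flipHorizontal n ma y.1 y.2))
  (.seq (forEach Finset.univ.toList fun y : Fin n × Fin mb => ifBit (x.2 y.1 y.2)
    (flipVertical n mb y.1 y.2))
  (forEach (directions n ×ˢ corners) fun y => pushCorner n y.1.1 y.1.2 y.2.1 y.2.2)))

/-- Applies the local chain `x` at the current vertex if this lowers the weight of the
syndrome. -/
noncomputable def tryFlip (x : LocalChain n ma mb) : Prog :=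
  .seq (block [.const 5 0])
  (.seq (forEach (directions n) fun y => ifBit (localSyndrome HA HB x y.1 y.2)
    (countFace n y.1 y.2))
  (.seq (block [.add 5 5 5, .const 6 (localWeight HA HB x)])
  (.branch 6 5 (applyFlip HA HB x) nop)))

variable {a b HA HB} {num : G ≃ Fin (Fintype.card G)} {W B hd : ℕ} {qs : List (Vert G)}
  {v : Vert G} {s : Face G n → ZMod 2} {c : XOne G n ma mb → ZMod 2} {m : Mem}

/-- The bit is known when the program is written, so no test happens at run time; `Q` describes both
cases uniformly. -/
theorem Runs.ifBit {T : ℕ} {t : ZMod 2} {P : Prog} {Q : ZMod 2 → Mem → Prop} (hT : 1 ≤ T)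
    (h0 : Q 0 m) (h1 : Runs W T P m (Q 1)) : Runs W T (ifBit t P) m (Q t) := by
  rcases zmodTwo_cases t with rfl | rfl
  · exact (Runs.nop h0).imp hT fun _ h => h
  · exact h1

theorem DecoderState.setReg (hm : DecoderState a b num hd qs v s c m) {r : ℕ} (hr : 5 ≤ r)
    (x : ℕ) : DecoderState a b num hd qs v s c (m.setReg r x) := by
  obtain ⟨m1, m2, m3, m4, md, mq⟩ := hm
  refine ⟨?_, ?_, ?_, ?_, md, mq⟩ <;> rw [Mem.setReg_reg, if_neg (by omega)] <;> assumption

/-- Per pair of directions, `12` steps flip the face and `4 · 16` steps queue its corners, whence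
`76`. -/
theorem runs_applyFlip (hW : DecoderRoom W (Fintype.card G) n ma mb B)
    (hm : DecoderState a b num hd qs v s c m) (x : LocalChain n ma mb)
    (hq : hd + qs.length + 4 * (n * n) ≤ W) :
    Runs W (76 * (n * n) + 13 * (n * ma) + 13 * (n * mb) + 4) (applyFlip HA HB x) m
      (DecoderState a b num hd (qs ++ neighbours a b v) v
        (s + cobdryOne a b HA HB (embed a b v x)) (c + embed a b v x)) := by
  have h1 := Runs.forEach (W := W) (T := 12) (l := directions n) (s := m)
    (P := fun y => ifBit (localSyndrome HA HB x y.1 y.2) (flipFace n y.1 y.2))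
    (I := fun pre => DecoderState a b num hd qs v (s + (pre.map fun y =>
      Pi.single (faceAt a b v y.1 y.2) (localSyndrome HA HB x y.1 y.2)).sum) c)
    (fun pre y m' _ hm' => by
      simp only [List.map_append, List.sum_append, List.map_singleton, List.sum_singleton,
        ← add_assoc]
      exact Runs.ifBit (Q := fun t => DecoderState a b num hd qs v (s + (pre.map fun y =>
        Pi.single (faceAt a b v y.1 y.2) (localSyndrome HA HB x y.1 y.2)).sum +
        Pi.single (faceAt a b v y.1 y.2) t) c) (by norm_num) (by simpa using hm')
        (runs_flipFace hW.toRoom hm' y.1 y.2))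
    (by simpa using hm)
  have h2 : ∀ {s c m}, DecoderState a b num hd qs v s c m → _ := fun {s c m} hm =>
    Runs.forEach (W := W) (T := 13) (l := Finset.univ.toList) (s := m)
    (P := fun y : Fin n × Fin ma => ifBit (x.1 y.1 y.2) (flipHorizontal n ma y.1 y.2))
    (I := fun pre => DecoderState a b num hd qs v s (c + (pre.map fun y =>
      Pi.single (Sum.inl (edgeH b v y.1, y.2)) (x.1 y.1 y.2)).sum))
    (fun pre y m' _ hm' => by
      simp only [List.map_append, List.sum_append, List.map_singleton, List.sum_singleton,
        ← add_assoc]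
      exact Runs.ifBit (Q := fun t => DecoderState a b num hd qs v s (c + (pre.map fun y =>
        Pi.single (Sum.inl (edgeH b v y.1, y.2)) (x.1 y.1 y.2)).sum +
        Pi.single (Sum.inl (edgeH b v y.1, y.2)) t)) (by norm_num) (by simpa using hm')
        (runs_flipHorizontal hW hm' y.1 y.2))
    (by simpa using hm)
  have h3 : ∀ {s c m}, DecoderState a b num hd qs v s c m → _ := fun {s c m} hm =>
    Runs.forEach (W := W) (T := 13) (l := Finset.univ.toList) (s := m)
    (P := fun y : Fin n × Fin mb => ifBit (x.2 y.1 y.2) (flipVertical n mb y.1 y.2))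
    (I := fun pre => DecoderState a b num hd qs v s (c + (pre.map fun y =>
      Pi.single (Sum.inr (edgeV a v y.1, y.2)) (x.2 y.1 y.2)).sum))
    (fun pre y m' _ hm' => by
      simp only [List.map_append, List.sum_append, List.map_singleton, List.sum_singleton,
        ← add_assoc]
      exact Runs.ifBit (Q := fun t => DecoderState a b num hd qs v s (c + (pre.map fun y =>
        Pi.single (Sum.inr (edgeV a v y.1, y.2)) (x.2 y.1 y.2)).sum +
        Pi.single (Sum.inr (edgeV a v y.1, y.2)) t)) (by norm_num) (by simpa using hm')
        (runs_flipVertical hW hm' y.1 y.2))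
    (by simpa using hm)
  have hlen : (directions n ×ˢ corners).length = 4 * (n * n) := by
    rw [← length_neighbours a b v, neighbours, List.length_map]
  have h4 : ∀ {s} {c : XOne G n ma mb → ZMod 2} {m}, DecoderState a b num hd qs v s c m → _ := fun {s c m} hm =>
    Runs.forEach (W := W) (T := 16) (l := directions n ×ˢ corners) (s := m)
    (P := fun y => pushCorner n y.1.1 y.1.2 y.2.1 y.2.2)
    (I := fun pre => DecoderState a b num hd (qs ++ pre.map fun y =>
      corner a b (faceAt a b v y.1.1 y.1.2) y.2.1 y.2.2) v s c)
    (fun pre y m' hpre hm' => by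
      have hl := hpre.length_le
      rw [hlen, List.length_append, List.length_singleton] at hl
      simp only [List.map_append, List.map_singleton, ← List.append_assoc]
      refine runs_pushCorner hW.toRoom hm' _ _ _ _ ?_
      rw [List.length_append, List.length_map]
      omega)
    (by simpa using hm)
  refine (Runs.seq (h1.imp le_rfl fun m1 hm1 => Runs.seq ((h2 hm1).imp le_rfl fun m2 hm2 =>
    Runs.seq ((h3 hm2).imp le_rfl fun m3 hm3 => h4 hm3)))).imp ?_ ?_
  · rw [hlen, length_directions]
    simp only [Finset.length_toList, Finset.card_univ, Fintype.card_prod, Fintype.card_fin]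
    ring_nf
    omega
  · intro m' hm'
    simp only [directions, Finset.sum_map_toList] at hm'
    rwa [← cobdryOne_embed_eq_sum, add_assoc, ← embed_eq_sum] at hm'

/-- Register `5` accumulates the overlap of the syndrome with the coboundary of `x` and is doubled;
`localWeight` is a constant of the program. Room in the queue is needed only if the flip takes
place. -/
theorem runs_tryFlip (hW : DecoderRoom W (Fintype.card G) n ma mb B)
    (hm : DecoderState a b num hd qs v s c m) (x : LocalChain n ma mb)
    (hq : Lowers a b HA HB s v x → hd + qs.length + 4 * (n * n) ≤ W) :
    Runs W (87 * (n * n) + 13 * (n * ma) + 13 * (n * mb) + 11) (tryFlip HA HB x) m fun m' =>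
      (Lowers a b HA HB s v x ∧ DecoderState a b num hd (qs ++ neighbours a b v) v
        (s + cobdryOne a b HA HB (embed a b v x)) (c + embed a b v x) m') ∨
      (¬ Lowers a b HA HB s v x ∧ DecoderState a b num hd qs v s c m') := by
  have hlow : Lowers a b HA HB s v x ↔ localWeight HA HB x < 2 * ∑ y : Fin n × Fin n,
      (s (faceAt a b v y.1 y.2)).val * (localSyndrome HA HB x y.1 y.2).val := by
    rw [Fintype.sum_prod_type]
    rfl
  have hcount := hW.counter
  have hweight : localWeight HA HB x ≤ n * n := by
    refine (Finset.sum_le_card_nsmul _ _ n fun i _ => ?_).trans (by simp)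
    exact (Finset.sum_le_card_nsmul _ _ 1 fun j _ => val_le_one _).trans (by simp)
  have hsum : ∀ l : List (Fin n × Fin n), (l.map fun y => (s (faceAt a b v y.1 y.2)).val *
      (localSyndrome HA HB x y.1 y.2).val).sum ≤ l.length := fun l => by
    refine (List.sum_le_card_nsmul _ 1 fun z hz => ?_).trans (by simp)
    obtain ⟨y, -, rfl⟩ := List.mem_map.mp hz
    exact Nat.mul_le_mul (val_le_one _) (val_le_one _)
  have h0 : wp W [.const 5 0] m fun m' => DecoderState a b num hd qs v s c m' ∧
      m'.reg 5 = 0 := ⟨Nat.zero_le _, hm.setReg le_rfl _, by simp [Mem.setReg_reg]⟩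
  have h1 : ∀ {m}, (DecoderState a b num hd qs v s c m ∧ m.reg 5 = 0) → _ := fun {m} hm =>
    Runs.forEach (W := W) (T := 11) (l := directions n) (s := m)
    (P := fun y => ifBit (localSyndrome HA HB x y.1 y.2) (countFace n y.1 y.2))
    (I := fun pre m => DecoderState a b num hd qs v s c m ∧ m.reg 5 = (pre.map fun y =>
      (s (faceAt a b v y.1 y.2)).val * (localSyndrome HA HB x y.1 y.2).val).sum)
    (fun pre y m' hpre hm' => by
      have hl := hpre.length_le
      rw [length_directions, List.length_append, List.length_singleton] at hl
      have hs := hsum pre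
      rw [← hm'.2] at hs
      simp only [List.map_append, List.sum_append, List.map_singleton, List.sum_singleton,
        ← hm'.2]
      refine Runs.ifBit (Q := fun t m'' => DecoderState a b num hd qs v s c m'' ∧
        m''.reg 5 = m'.reg 5 + (s (faceAt a b v y.1 y.2)).val * t.val) (by norm_num)
        (by simpa using hm'.1) ?_
      simpa [ZMod.val_one] using runs_countFace hW.toRoom hm'.1 y.1 y.2 (by omega))
    (by simpa using hm)
  refine (Runs.seq ((Runs.of_wp h0).imp le_rfl fun m1 hm1 => Runs.seq ((h1 hm1).imp le_rfl
    fun m2 hm2 => Runs.seq (T := 3)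
      (T' := 76 * (n * n) + 13 * (n * ma) + 13 * (n * mb) + 4 + 1) ?_))).imp ?_ fun _ h => h
  · have hs := hsum (directions n)
    rw [length_directions, ← hm2.2] at hs
    refine (Runs.of_wp (l := [.add 5 5 5, .const 6 (localWeight HA HB x)])
      (Q := fun m3 => DecoderState a b num hd qs v s c m3 ∧
        (m3.reg 6 < m3.reg 5 ↔ Lowers a b HA HB s v x)) ?_).imp le_rfl fun m3 hm3 => ?_
    · refine ⟨by omega, by omega, (hm2.1.setReg le_rfl _).setReg (by norm_num) _, ?_⟩
      simp only [Mem.setReg_reg]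
      rw [hlow, ← Finset.sum_map_toList, ← directions, ← hm2.2, two_mul]
      simp
    · refine Runs.branch (fun h => ?_) fun h => ?_
      · have hl := hm3.2.mp h
        exact (runs_applyFlip hW hm3.1 x (hq hl)).imp le_rfl fun _ h => Or.inl ⟨hl, h⟩
      · exact (Runs.nop (Or.inr ⟨fun hl => h (hm3.2.mpr hl), hm3.1⟩)).imp (by omega) fun _ h => h
  · rw [length_directions]
    simp only [List.length_singleton]
    omega

end Candidates

/-! ### The queue: correctness and amortized running time. -/

section Decoder

variable {G : Type*} [Group G] [Fintype G] [DecidableEq G] {n ma mb : ℕ} (a b : Fin n → G)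
  (HA : Matrix (Fin ma) (Fin n) (ZMod 2)) (HB : Matrix (Fin mb) (Fin n) (ZMod 2))

/-- Takes a vertex from the queue and tries all local chains at it. -/
noncomputable def processVertex : Prog :=
  .seq (block [.load 4 5 2, .add 2 2 1])
    (forEach (Finset.univ : Finset (LocalChain n ma mb)).toList (tryFlip HA HB))

/-- The flips made so far, with sum `c`, turn the syndrome `s₀` into `s`; all vertices with a flip
are in the queue, except perhaps the current vertex `v`, at which only the local chains in `tried`
have been excluded; the queue will not get longer than `B`. -/
def Pending (num : G ≃ Fin (Fintype.card G)) (s₀ : Face G n → ZMod 2) (B hd : ℕ) (v : Vert G)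
    (tried : List (LocalChain n ma mb)) (m : Mem) : Prop :=
  ∃ qs s c, DecoderState a b num hd qs v s c m ∧
    (∀ c', FlipRun a b HA HB s c' → FlipRun a b HA HB s₀ (c + c')) ∧
    (∀ u, u ∈ qs ∨ (∀ x, ¬ Lowers a b HA HB s u x) ∨
      u = v ∧ ∀ x ∈ tried, ¬ Lowers a b HA HB s u x) ∧
    hd + qs.length + 4 * (n * n) * hammingNorm s ≤ B

/-- A bound for the running time of `tryFlip`. -/
def tryTime (n ma mb : ℕ) : ℕ := 87 * (n * n) + 13 * (n * ma) + 13 * (n * mb) + 11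

/-- A bound for the running time of `processVertex`. -/
def vertexTime (n ma mb : ℕ) : ℕ := Fintype.card (LocalChain n ma mb) * tryTime n ma mb + 4

variable {a b HA HB} {num : G ≃ Fin (Fintype.card G)} {W B hd : ℕ} {v : Vert G}
  {s₀ : Face G n → ZMod 2} {m : Mem}

/-- A flip adds `4 n²` queue entries but lowers the syndrome weight by at least one, so `hd +
qs.length + 4 n² |s|` does not grow. -/
theorem Pending.runs_tryFlip (hn : 0 < n) (hW : DecoderRoom W (Fintype.card G) n ma mb B)
    {tried : List (LocalChain n ma mb)} (hm : Pending a b HA HB num s₀ B hd v tried m)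
    (x : LocalChain n ma mb) :
    Runs W (tryTime n ma mb) (tryFlip HA HB x) m
      (Pending a b HA HB num s₀ B hd v (tried ++ [x])) := by
  obtain ⟨qs, s, c, hs, hrun, hqs, hB⟩ := hm
  have hdrop : Lowers a b HA HB s v x → 4 * (n * n) *
      hammingNorm (s + cobdryOne a b HA HB (embed a b v x)) + 4 * (n * n) ≤
      4 * (n * n) * hammingNorm s := fun hl =>
    Nat.mul_le_mul_left (4 * (n * n)) ((hammingNorm_add_embed_lt_iff a b HA HB s v x).mpr hl)
  have hr := hW.queue
  refine (CoDec.runs_tryFlip hW hs x fun hl => ?_).imp le_rfl fun m' hm' => ?_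
  · have := hdrop hl
    omega
  rcases hm' with ⟨hl, hs'⟩ | ⟨hl, hs'⟩
  · refine ⟨_, _, _, hs', fun c' hc' => ?_, fun u => ?_, ?_⟩
    · rw [add_assoc]
      exact hrun _ (.flip _ _ _ ⟨⟨v, supportedAt_embed a b v x⟩,
        (hammingNorm_add_embed_lt_iff a b HA HB s v x).mpr hl⟩ hc')
    · by_cases hu : u ∈ neighbours a b v
      · exact Or.inl (List.mem_append_right _ hu)
      rcases hqs u with h | h | ⟨rfl, -⟩
      · exact Or.inl (List.mem_append_left _ h)
      · exact Or.inr (Or.inl fun y => by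
          rw [lowers_add_cobdryOne_embed_iff a b HA HB hu]
          exact h y)
      -- The current vertex shares a face with itself, so after a flip it is queued again and all
      -- chains at it, including those tried before, will be retried.
      · exact absurd (mem_neighbours a b (i := ⟨0, hn⟩) (j := ⟨0, hn⟩) rfl) hu
    · rw [List.length_append, length_neighbours]
      have := hdrop hl
      omega
  · refine ⟨qs, s, c, hs', hrun, fun u => (hqs u).imp_right (Or.imp_right ?_), hB⟩
    rintro ⟨rfl, h⟩
    refine ⟨rfl, fun y hy => ?_⟩
    rcases List.mem_append.mp hy with hy | hy
    · exact h y hy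
    · rwa [List.mem_singleton.mp hy]

theorem Pending.runs_processVertex (hn : 0 < n)
    (hW : DecoderRoom W (Fintype.card G) n ma mb B)
    (hm : Pending a b HA HB num s₀ B hd v Finset.univ.toList m) (hlt : m.reg 2 < m.reg 3) :
    Runs W (vertexTime n ma mb) (processVertex HA HB) m fun m' =>
      ∃ v', Pending a b HA HB num s₀ B (hd + 1) v' Finset.univ.toList m' := by
  obtain ⟨qs, s, c, ⟨m1, m2, m3, m4, md, mq⟩, hrun, hqs, hB⟩ := hm
  rw [m2, m3] at hlt
  obtain ⟨u, qs, rfl⟩ : ∃ u qs', qs = u :: qs' := by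
    rcases qs with _ | ⟨u, qs⟩
    · simp at hlt
    · exact ⟨u, qs, rfl⟩
  have hv : m.arr 5 hd = vertNum num u := mq 0 (by simp)
  rw [List.length_cons] at hB
  have hstart : wp W [.load 4 5 2, .add 2 2 1] m
      (Pending a b HA HB num s₀ B (hd + 1) u []) := by
    have b1 := vertNum_lt num u
    have b2 := hW.vert
    have b3 := hW.queue
    simp [wp, Mem.setReg_reg, m1, m2, hv]
    refine ⟨by omega, by omega, qs, s, c, ⟨by simp [Mem.setReg_reg, m1],
      by simp [Mem.setReg_reg], ?_, by simp [Mem.setReg_reg], md, fun x hx => ?_⟩, hrun,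
      fun u' => ?_, by omega⟩
    · simp [Mem.setReg_reg, m3]
      omega
    · have := mq (x + 1) (by simpa using hx)
      rw [List.getElem_cons_succ] at this
      rw [← this]
      simp only [Mem.setReg_arr]
      congr 1
      omega
    -- The vertex leaving the queue becomes the current one with nothing tried; the previous current
    -- vertex has had all its chains excluded.
    · rcases hqs u' with h | h | ⟨rfl, h⟩
      · rcases List.mem_cons.mp h with rfl | h
        · exact Or.inr (Or.inr ⟨rfl, by simp⟩)
        · exact Or.inl h
      · exact Or.inr (Or.inl h)
      · exact Or.inr (Or.inl fun x => h x (Finset.mem_toList.mpr (Finset.mem_univ x)))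
  refine (Runs.seq ((Runs.of_wp hstart).imp le_rfl fun m' hm' => Runs.forEach
    (Pending a b HA HB num s₀ B (hd + 1) u)
    (fun pre x m'' _ hm'' => hm''.runs_tryFlip hn hW x) hm')).imp ?_ fun _ h => ⟨u, h⟩
  rw [Finset.length_toList, Finset.card_univ, vertexTime]
  simp only [List.length_cons, List.length_nil]
  omega

theorem runs_processQueue (hn : 0 < n) (hW : DecoderRoom W (Fintype.card G) n ma mb B)
    {qs : List (Vert G)} (hm : DecoderState a b num 0 qs v s₀ (0 : XOne G n ma mb → ZMod 2) m)
    (hqs : ∀ u, u ∈ qs) (hB : qs.length + 4 * (n * n) * hammingNorm s₀ ≤ B) :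
    Runs W (B * (vertexTime n ma mb + 1) + 1) (.loop 2 3 (processVertex HA HB)) m fun m' =>
      ∃ s c, Holds a b num s c m'.arr ∧ FlipRun a b HA HB s₀ c := by
  refine (Runs.loop (I := fun k m => ∃ hd v, hd + k = B ∧
    Pending a b HA HB num s₀ B hd v Finset.univ.toList m) ?_ B ⟨0, v, zero_add B, qs, s₀, 0, hm,
      fun c' h => by rwa [zero_add], fun u => Or.inl (hqs u), by omega⟩).imp le_rfl ?_
  · rintro k m' ⟨hd, v, hk, hm'⟩ hlt
    -- The queue is nonempty and ends at most at `B`, so its head is below `B`.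
    have hk0 : 0 < k := by
      obtain ⟨qs, s, c, hs, -, -, hB'⟩ := hm'
      rw [hs.head, hs.tail] at hlt
      omega
    exact (hm'.runs_processVertex hn hW hlt).imp le_rfl fun m'' ⟨v', h⟩ =>
      ⟨k - 1, by omega, hd + 1, v', by omega, h⟩
  · rintro m' ⟨⟨k, hd, v, -, qs, s, c, hs, hrun, hqs', -⟩, hlt⟩
    rw [hs.head, hs.tail] at hlt
    obtain rfl : qs = [] := List.length_eq_zero_iff.mp (by omega)
    refine ⟨s, c, hs.data, ?_⟩
    rw [← add_zero c]
    -- With an empty queue the invariant leaves no vertex with a flip, so the run is complete.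
    refine hrun 0 (.done s fun e he => ?_)
    obtain ⟨u, x, hx⟩ := (exists_isFlip_iff a b HA HB s).mp ⟨e, he⟩
    rcases hqs' u with h | h | ⟨-, h⟩
    · simp at h
    · exact h x hx
    · exact h x (Finset.mem_toList.mpr (Finset.mem_univ x)) hx

end Decoder

/-! ### The complete program, its constants, and the theorem. -/

section Assembly

variable {G : Type*} [Group G] [Fintype G] [DecidableEq G] {n ma mb : ℕ}

theorem finProdFinEquiv_symm_mk {M : ℕ} (x : Fin M) (i : Fin n) (h : (x : ℕ) * n + i < M * n) :
    finProdFinEquiv.symm (⟨(x : ℕ) * n + i, h⟩ : Fin (M * n)) = (x, i) := by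
  rw [Equiv.symm_apply_eq]
  refine Fin.ext ?_
  simp [finProdFinEquiv, mul_comm, add_comm]

section Input

variable (a b : Fin n → G) (num : G ≃ Fin (Fintype.card G)) (s : Face G n → ZMod 2)

theorem inputMem_arr_zero (g : G) (i : Fin n) :
    (inputMem a b num s).arr 0 (num g * n + i) = num (a i * g) := by
  have h := mul_add_lt (num g).isLt i.isLt
  simp only [inputMem, if_true, dif_pos h]
  rw [finProdFinEquiv_symm_mk, Equiv.symm_apply_apply]

theorem inputMem_arr_one (g : G) (j : Fin n) :
    (inputMem a b num s).arr 1 (num g * n + j) = num (g * b j) := by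
  have h := mul_add_lt (num g).isLt j.isLt
  simp only [inputMem, if_neg (show (1 : ℕ) ≠ 0 by norm_num), if_true, dif_pos h]
  rw [finProdFinEquiv_symm_mk, Equiv.symm_apply_apply]

theorem inputMem_arr_two (f : Face G n) :
    (inputMem a b num s).arr 2 (faceNum num f) = (s f).val := by
  have h1 := mul_add_lt (num f.1).isLt f.2.1.isLt
  have h2 := mul_add_lt h1 f.2.2.isLt
  have h3 := finProdFinEquiv_symm_mk ⟨_, h1⟩ f.2.2 h2
  simp only [inputMem, faceNum, if_neg (show (2 : ℕ) ≠ 0 by norm_num),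
    if_neg (show (2 : ℕ) ≠ 1 by norm_num), if_true, dif_pos h2]
  rw [h3, finProdFinEquiv_symm_mk]
  simp

end Input

variable (HA : Matrix (Fin ma) (Fin n) (ZMod 2)) (HB : Matrix (Fin mb) (Fin n) (ZMod 2))

/-- The co-decoder. -/
noncomputable def decoder : Prog :=
  .seq fillQueue (.seq (buildTables n) (.seq (block [.const 4 0]) (.loop 2 3 (processVertex HA HB))))

/-- A list of all vertices in the order of their numbers. -/
theorem exists_vertList (num : G ≃ Fin (Fintype.card G)) :
    ∃ qs : List (Vert G), qs.length = 4 * Fintype.card G ∧ (∀ u, u ∈ qs) ∧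
      ∀ x (h : x < qs.length), x = vertNum num qs[x] := by
  choose f hf using fun x : Fin (4 * Fintype.card G) => exists_vertNum num x.isLt
  refine ⟨List.ofFn f, List.length_ofFn, fun u => ?_, fun x h => ?_⟩
  · rw [List.mem_ofFn]
    exact ⟨⟨vertNum num u, vertNum_lt num u⟩, vertNum_injective num (hf _)⟩
  · rw [List.getElem_ofFn, hf]

/-- A bound for the length of the queue, per element of the group. -/
def queueBound (n : ℕ) : ℕ := 4 + 4 * (n * n) * (n * n)

/-- The constant in the running time of the co-decoder. -/
def decoderConst (n ma mb : ℕ) : ℕ :=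
  31 + 100 * (n * n) + queueBound n * (vertexTime n ma mb + 1) + 4 * n + 4 * (n * n) +
    ma + mb + 2 * (n * ma) + 2 * (n * mb)

/-- Every required bound is a summand of `decoderConst`, possibly multiplied by `N`. -/
theorem decoderRoom {W N : ℕ} (hN : 0 < N) (hW : N * decoderConst n ma mb ≤ W) :
    DecoderRoom W N n ma mb (N * queueBound n) := by
  have key : ∀ k ≤ decoderConst n ma mb, N * k ≤ W := fun k hk =>
    (Nat.mul_le_mul_left N hk).trans hW
  have key' : ∀ k ≤ decoderConst n ma mb, k ≤ W := fun k hk =>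
    (Nat.le_mul_of_pos_left k hN).trans (key k hk)
  have hq : queueBound n ≤ queueBound n * (vertexTime n ma mb + 1) :=
    Nat.le_mul_of_pos_right _ (Nat.succ_pos _)
  have hC : decoderConst n ma mb = 31 + 100 * (n * n) +
    queueBound n * (vertexTime n ma mb + 1) + 4 * n + 4 * (n * n) +
    ma + mb + 2 * (n * ma) + 2 * (n * mb) := rfl
  refine ⟨⟨key' _ (by omega), key' _ (by omega), ?_, ?_, ?_⟩, key' _ (by omega),
    key' _ (by omega), key' _ (by omega), ?_, ?_, key _ (by omega)⟩
  · exact (key 4 (by omega)).trans' (by rw [mul_comm])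
  · exact (key (4 * n) (by omega)).trans' (le_of_eq (by ring))
  · exact (key (4 * (n * n)) (by omega)).trans' (le_of_eq (by ring))
  · exact (key (2 * (n * ma)) (by omega)).trans' (le_of_eq (by ring))
  · exact (key (2 * (n * mb)) (by omega)).trans' (le_of_eq (by ring))

variable {HA HB}

theorem runs_decoder (hn : 0 < n) {W : ℕ} (hW : Fintype.card G * decoderConst n ma mb ≤ W)
    (a b : Fin n → G) (num : G ≃ Fin (Fintype.card G)) (s : Face G n → ZMod 2) :
    Runs W W (decoder HA HB) (inputMem a b num s) fun m =>
      ∃ c, IsOutput num m c ∧ FlipRun a b HA HB s c := by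
  have hN : 0 < Fintype.card G := Fintype.card_pos
  have hroom := decoderRoom hN hW
  obtain ⟨qs, hlen, hmem, hqs⟩ := exists_vertList num
  obtain ⟨v, hv⟩ := exists_vertNum num (x := 0) (by omega)
  -- Initially the queue holds the `4 |G|` vertices, and the syndrome weight is at most the number
  -- `|G| n²` of faces.
  have hnorm : qs.length + 4 * (n * n) * hammingNorm s ≤ Fintype.card G * queueBound n := by
    have h1 : hammingNorm s ≤ Fintype.card G * (n * n) :=
      hammingNorm_le_card_fintype.trans (by simp)
    have h2 := Nat.mul_le_mul_left (4 * (n * n)) h1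
    have h3 : Fintype.card G * queueBound n = 4 * Fintype.card G +
      4 * (n * n) * (Fintype.card G * (n * n)) := by rw [queueBound]; ring
    omega
  refine Runs.imp (T := (16 * Fintype.card G + 5) +
    ((Fintype.card G * (n * n * 100 + 4) + 3) + (2 + (Fintype.card G * queueBound n *
      (vertexTime n ma mb + 1) + 1)))) (Q := fun m => ∃ s' c, Holds a b num s' c m.arr ∧
      FlipRun a b HA HB s c) ?_ ?_ ?_
  · refine Runs.seq ((runs_fillQueue hroom.toRoom rfl rfl rfl).imp le_rfl ?_)
    rintro m1 ⟨p0, p1, p2, p3, pk, p5⟩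
    refine Runs.seq ((runs_buildTables (a := a) (b := b) (num := num) (A := m1.arr) hroom.toRoom
      (fun g i => ?_) (fun g i => ?_) ⟨p0, p1, p2, p3, fun _ _ => rfl,
        ⟨by simp, by simp, by simp, by simp⟩⟩).imp le_rfl fun m2 hm2 => ?_)
    · rw [pk 0 (by norm_num), inputMem_arr_zero]
    · rw [pk 1 (by norm_num), inputMem_arr_one]
    refine Runs.seq ((Runs.of_wp (l := [.const 4 0]) (Q := DecoderState a b num 0 qs v s
      (0 : XOne G n ma mb → ZMod 2)) ⟨Nat.zero_le _, ?_⟩).imp le_rfl fun m3 hm3 =>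
      runs_processQueue hn hroom hm3 hmem hnorm)
    change DecoderState _ _ _ _ _ _ _ _ _
    refine ⟨by simp [Mem.setReg_reg, hm2.one], by simp [Mem.setReg_reg, hm2.count],
      by simp [Mem.setReg_reg, hm2.tail, hlen], by simp [Mem.setReg_reg, hv],
      ⟨hm2.tables, fun f => ?_, fun e k => ?_, fun e k => ?_⟩, fun x hx => ?_⟩ <;>
      rw [Mem.setReg_arr, hm2.keep _ (by norm_num)]
    · rw [pk 2 (by norm_num), inputMem_arr_two]
    · rw [pk 3 (by norm_num)]
      simp [inputMem]
    · rw [pk 4 (by norm_num)]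
      simp [inputMem]
    · rw [zero_add, p5 x (by omega), ← hqs x hx]
  · refine le_trans ?_ hW
    -- Setup and bookkeeping cost `20 |G| + 11` steps besides the products, hence the `31`; the last
    -- summand serves only the word bounds.
    have h1 : Fintype.card G * decoderConst n ma mb = 31 * Fintype.card G +
      Fintype.card G * (n * n * 100) + Fintype.card G * queueBound n * (vertexTime n ma mb + 1) +
      Fintype.card G * (4 * n + 4 * (n * n) + ma + mb + 2 * (n * ma) + 2 * (n * mb)) := by
      rw [decoderConst]
      ring
    rw [h1, mul_add]
    omega
  · rintro m ⟨s', c, hc, hrun⟩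
    exact ⟨c, ⟨fun p g j k => hc.horizontal (p, g, j) k, fun q g i k => hc.vertical (q, g, i) k⟩,
      hrun⟩

theorem card_XOne : Fintype.card (XOne G n ma mb) = 2 * n * (ma + mb) * Fintype.card G := by
  simp only [Fintype.card_sum, Fintype.card_prod, Fintype.card_bool, Fintype.card_fin]
  ring

theorem exists_computes (hn : 0 < n) (hm : 0 < ma + mb) (a b : Fin n → G)
    (num : G ≃ Fin (Fintype.card G)) (s : Face G n → ZMod 2) :
    ∃ c, Computes (decoder HA HB) (decoderConst n ma mb * Fintype.card (XOne G n ma mb)) a b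
      num s c ∧ FlipRun a b HA HB s c := by
  -- Here `ma + mb ≥ 1` is needed: otherwise the middle term would be zero and leave no time.
  have hX : Fintype.card G ≤ Fintype.card (XOne G n ma mb) := by
    rw [card_XOne]
    exact Nat.le_mul_of_pos_left _ (by positivity)
  obtain ⟨t, ht, m, he, c, hc, hrun⟩ := runs_decoder (HA := HA) (HB := HB) hn
    ((Nat.mul_le_mul_right _ hX).trans_eq (mul_comm _ _)) a b num s
  exact ⟨c, ⟨t, m, ht, he, hc⟩, hrun⟩

end Assembly

end CoDec

theorem mainTheorem9 (Δ ma mb : ℕ) (hΔ : 0 < Δ) (hm : 0 < ma + mb) :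
    ∃ C : ℕ, ∀ (HA : Matrix (Fin ma) (Fin Δ) (ZMod 2)) (HB : Matrix (Fin mb) (Fin Δ) (ZMod 2)),
      Function.Surjective HA.mulVec → Function.Surjective HB.mulVec →
      ∃ P : Prog, ∀ (G : Type*) [Group G] [Fintype G] [DecidableEq G] (a b : Fin Δ → G),
        IsSymmGenSet a → IsSymmGenSet b →
        -- on every input, `P` is a linear-time implementation of the small-set-flip decoder
        (∀ (num : G ≃ Fin (Fintype.card G)) (s : Face G Δ → ZMod 2),
          ∃ c : XOne G Δ ma mb → ZMod 2,
            Computes P (C * Fintype.card (XOne G Δ ma mb)) a b num s c ∧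
            FlipRun a b HA HB s c) ∧
        -- errors of weight up to `κ / (2 Δ (ma + mb)) |X(1)|` are corrected
        (∀ d₁ d₂ lam : ℝ, 0 < d₂ → 0 ≤ lam →
          IsSpectralExpander (cayleyAdj a) lam → IsSpectralExpander (cayleyAdj b) lam →
          HasDistance (dual (code HA)) d₁ → HasDistance (dual (code HB)) d₁ →
          IsRobust (dual (code HA)) (dual (code HB)) d₂ →
          0 < d₁ * d₂ / 4 - lam * d₂ / 2 - 8 * lam * Δ →
          ∀ c : XOne G Δ ma mb → ZMod 2,
            (edgeWeight c : ℝ) ≤ kappaC Δ d₁ d₂ lam / (2 * Δ * (ma + mb)) *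
              (Fintype.card (XOne G Δ ma mb) : ℝ) →
            -- by every run of the small-set-flip decoder
            (∀ c', FlipRun a b HA HB (cobdryOne a b HA HB c) c' →
              SameClass a b HA HB c c') ∧
            -- and by the linear-time program `P`
            (∀ num : G ≃ Fin (Fintype.card G), ∃ c',
              Computes P (C * Fintype.card (XOne G Δ ma mb)) a b num
                (cobdryOne a b HA HB c) c' ∧
              SameClass a b HA HB c c')) := by
  refine ⟨decoderConst Δ ma mb, fun HA HB hA hB => ⟨decoder HA HB, fun G _ _ _ a b ha hb =>
    ⟨exists_computes hΔ hm a b, fun d₁ d₂ lam h2 hl hMa hMb hdA hdB hrob hpos c hw => ?_⟩⟩⟩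
  have hcorrect : ∀ c', FlipRun a b HA HB (cobdryOne a b HA HB c) c' →
      SameClass a b HA HB c c' := by
    intro c' hrun
    -- Since `|X(1)| = 2 Δ (ma + mb) |G|`, the bound on the error is `κ |G|`.
    refine FlipRun.sameClass hΔ h2 hl ha hb hMa hMb hA hB hdA hdB hrob hpos (hw.trans_eq ?_) hrun
    have hΔ0 : (Δ : ℝ) ≠ 0 := by exact_mod_cast hΔ.ne'
    have hm0 : (ma + mb : ℝ) ≠ 0 := by exact_mod_cast hm.ne'
    rw [card_XOne]
    push_cast
    field_simp
  refine ⟨hcorrect, fun num => ?_⟩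
  obtain ⟨c', hc', hrun⟩ := exists_computes (HA := HA) (HB := HB) hΔ hm a b num
    (cobdryOne a b HA HB c)
  exact ⟨c', hc', hcorrect c' hrun⟩
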